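/- Let $\mathbb T=\mathbb R/\mathbb Z$, let $J_0(q,p)=(-p,q)$ be the standard complex structure of $\mathbb R^{2n}$, and let $H\in C^\infty(\mathbb T\times\mathbb R^{2n})$ be quadratically convex: there are $\underline h,\overline h>0$ with $\underline h\,I\le\nabla^2H_t(z)\le\overline h\,I$ for all $(t,z)$. Let $H_t^*(x)=\max_y\,(x\cdot y-H_t(y))$ be the Fenchel conjugate, let $$\mathbb H_1=\Big\{x\in H^1(\mathbb T,\mathbb R^{2n})\ \Big|\ \int_{\mathbb T}x\,dt=0\Big\},\qquad (x,y)_{\mathbb H_1}=(\dot x,\dot y)_{L^2},$$ and let Clarke's dual action functional be $$\Psi_{H^*}(x)=-\frac12\int_{\mathbb T}J_0\dot x\cdot x\,dt+\int_{\mathbb T}H_t^*(J_0\dot x)\,dt,\qquad x\in\mathbb H_1 .$$ For $N\in\mathbb N$ write $\mathbb H_1=\mathbb H_1^{N,+}\oplus\widehat{\mathbb H}_1^{N,+}$, where, in terms of the Fourier expansion $x(t)=\sum_{k\in\mathbb Z}e^{-2\pi kJ_0t}\hat x_k$ with $\hat x_k\in\mathbb R^{2n}$, the space $\mathbb H_1^{N,+}$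 consists of the $x\in\mathbb H_1$ with $\hat x_k=0$ unless $1\le k\le N$, and $\widehat{\mathbb H}_1^{N,+}$ of the $x\in\mathbb H_1$ with $\hat x_k=0$ for $0\le k\le N$. The functional $\Psi_{H^*}$ is $C^1$ and twice Gateaux differentiable; the index $\mathrm{ind}(z;\Psi_{H^*})$ (maximal dimension of a subspace on which $d^2\Psi_{H^*}(z)$ is negative definite) and the nullity $\mathrm{null}(z;\Psi_{H^*})$ (dimension of the kernel) of a critical point refer to its second Gateaux differential. A critical point is called non-degenerate if $u\mapsto d^2f[u,\cdot]$ is a bijection onto the dual space. There is $N_0$, depending on $H$, such that for every $N\ge N_0$ the following hold. (a) For every $x\in\mathbb H_1^{N,+}$ the function $y\mapsto\Psi_{H^*}(x+y)$ on $\widehat{\mathbb H}_1^{N,+}$ has a unique critical point $Y(x)$, which is a non-degenerate global minimizer. (b) The map $Y:\mathbb H_1^{N,+}\to\widehat{\mathbb H}_1^{N,+}$ takes values in $C^\infty(\mathbb T,\mathbb R^{2n})$ and, for every $k\in\mathbb N$, is smooth as a map into $C^k(\mathbb T,\mathbb R^{2n})$. Its graph $M=\{x+Y(x)\mid x\in\mathbb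 H_1^{N,+}\}$ is a smooth embedded submanifold of $\mathbb H_1$ of dimension $2nN$ consisting of smooth loops. (c) The restriction $\psi_{H^*}=\Psi_{H^*}|_M:M\to\mathbb R$ is smooth. (d) A point $z\in\mathbb H_1$ is a critical point of $\Psi_{H^*}$ if and only if $z\in M$ and $z$ is a critical point of $\psi_{H^*}$. In this case $\mathrm{ind}(z;\Psi_{H^*})=\mathrm{ind}(z;\psi_{H^*})$ and $\mathrm{null}(z;\Psi_{H^*})=\mathrm{null}(z;\psi_{H^*})$. (e) Assume in addition that $H$ is non-resonant at infinity, i.e. there are $\epsilon,r>0$ such that every smooth $x:\mathbb T\to\mathbb R^{2n}$ with $\|\dot x-X_H(x)\|_{L^2}\le\epsilon$, where $X_H=-J_0\nabla H$, satisfies $\|x\|_{L^2}\le r$. Then $\psi_{H^*}$ satisfies the Palais–Smale condition on $M$ with the Riemannian metric induced by $\mathbb H_1$: every sequence $(z_j)\subset M$ such that $\|d\psi_{H^*}(z_j)\|\to0$ in the dual norm of that metric has a subsequence converging in $M$. -/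

import Mathlib

open scoped ContDiff Manifold Topology

noncomputable section

namespace DualAction

open MeasureTheory Set Filter

/-! ### Phase space and Hamiltonians -/

/-- `ℝ²ⁿ` with its Euclidean structure; `z (Sum.inl i) = qᵢ` and `z (Sum.inr i) = pᵢ`. -/
abbrev PhaseSpace (n : ℕ) : Type := EuclideanSpace ℝ (Fin n ⊕ Fin n)

/-- The standard complex structure `J₀ (q, p) = (-p, q)`. -/
def J0 (n : ℕ) : PhaseSpace n →L[ℝ] PhaseSpace n :=
  LinearMap.toContinuousLinearMap
    { toFun := fun z => WithLp.toLp 2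
        (Sum.elim (fun i => -z (Sum.inr i)) (fun i => z (Sum.inl i)))
      map_add' := by
        intro x y
        ext i
        cases i <;> simp [add_comm]
      map_smul' := by
        intro c x
        ext i
        cases i <;> simp }

/-- `e^{θ J₀} = cos θ · I + sin θ · J₀` (recall `J₀² = -I`). -/
def expJ0 (n : ℕ) (θ : ℝ) : PhaseSpace n →L[ℝ] PhaseSpace n :=
  Real.cos θ • ContinuousLinearMap.id ℝ (PhaseSpace n) + Real.sin θ • J0 n

/-- `H ∈ C^∞(𝕋 × ℝ²ⁿ)`, where `𝕋 = ℝ / ℤ`: a smooth function, `1`-periodic in time. -/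
def IsSmoothHamiltonian {n : ℕ} (H : ℝ → PhaseSpace n → ℝ) : Prop :=
  ContDiff ℝ ∞ (fun p : ℝ × PhaseSpace n => H p.1 p.2) ∧ ∀ t z, H (t + 1) z = H t z

/-- Quadratic convexity: `h₁ I ≤ ∇²H_t(z) ≤ h₂ I` for some positive `h₁, h₂` and all `t, z`. -/
def IsQuadraticallyConvex {n : ℕ} (H : ℝ → PhaseSpace n → ℝ) : Prop :=
  ∃ h₁ h₂ : ℝ, 0 < h₁ ∧ 0 < h₂ ∧ ∀ (t : ℝ) (z u : PhaseSpace n),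
    h₁ * ‖u‖ ^ 2 ≤ iteratedFDeriv ℝ 2 (H t) z ![u, u] ∧
      iteratedFDeriv ℝ 2 (H t) z ![u, u] ≤ h₂ * ‖u‖ ^ 2

/-- The Hamiltonian vector field `X_H = -J₀ ∇H`. -/
def hamVF {n : ℕ} (H : ℝ → PhaseSpace n → ℝ) (t : ℝ) (z : PhaseSpace n) : PhaseSpace n :=
  -J0 n (gradient (H t) z)

/-- A smooth closed curve `𝕋 → ℝ²ⁿ`. -/
def IsSmoothLoop {n : ℕ} (x : ℝ → PhaseSpace n) : Prop :=
  ContDiff ℝ ∞ x ∧ Function.Periodic x 1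

/-- The `L²(𝕋)`-norm of a (continuous, `1`-periodic) function. -/
def normL2 {n : ℕ} (x : ℝ → PhaseSpace n) : ℝ := Real.sqrt (∫ t in (0 : ℝ)..1, ‖x t‖ ^ 2)

/-- Non-resonance at infinity: there are `ε, r > 0` such that every smooth loop `x` with
`‖x' - X_H(x)‖_{L²} ≤ ε` satisfies `‖x‖_{L²} ≤ r`. -/
def IsNonresonantAtInfinity {n : ℕ} (H : ℝ → PhaseSpace n → ℝ) : Prop :=
  ∃ ε r : ℝ, 0 < ε ∧ 0 < r ∧ ∀ x : ℝ → PhaseSpace n, IsSmoothLoop x →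
    normL2 (fun t => deriv x t - hamVF H t (x t)) ≤ ε → normL2 x ≤ r

/-- The Fenchel conjugate `H*_t(x) = max_y (x · y - H_t(y))`. -/
def fenchel {n : ℕ} (H : ℝ → PhaseSpace n → ℝ) (t : ℝ) (x : PhaseSpace n) : ℝ :=
  ⨆ y : PhaseSpace n, (inner ℝ x y - H t y)

/-! ### The Hilbert space `ℍ₁` of closed curves of class `H¹` with zero mean -/

/-- `L²(𝕋, ℝ²ⁿ)`. -/
abbrev L2 (n : ℕ) : Type := Lp (PhaseSpace n) 2 (volume.restrict (Ioc (0 : ℝ) 1))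

theorem L2.intervalIntegrable {n : ℕ} (v : L2 n) :
    IntervalIntegrable (fun t => v t) volume 0 1 := by
  rw [intervalIntegrable_iff_integrableOn_Ioc_of_le zero_le_one]
  exact (Lp.memLp v).integrable (by norm_num)

/-- `v` is the derivative of the absolutely continuous `1`-periodic curve `x`. -/
def IsLoopWithVelocity {n : ℕ} (x : ℝ → PhaseSpace n) (v : L2 n) : Prop :=
  Function.Periodic x 1 ∧ ∀ t ∈ Icc (0 : ℝ) 1, x t = x 0 + ∫ s in (0 : ℝ)..t, v s

theorem IsLoopWithVelocity.intervalIntegrable {n : ℕ} {x : ℝ → PhaseSpace n} {v : L2 n}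
    (h : IsLoopWithVelocity x v) : IntervalIntegrable x volume 0 1 := by
  have hc : ContinuousOn (fun t : ℝ => x 0 + ∫ s in (0 : ℝ)..t, v s) (uIcc (0 : ℝ) 1) :=
    continuousOn_const.add
      (intervalIntegral.continuousOn_primitive_interval' v.intervalIntegrable left_mem_uIcc)
  refine (hc.congr ?_).intervalIntegrable
  intro t ht
  rw [uIcc_of_le zero_le_one] at ht
  exact h.2 t ht

theorem IsLoopWithVelocity.add {n : ℕ} {x y : ℝ → PhaseSpace n} {v w : L2 n}
    (hx : IsLoopWithVelocity x v) (hy : IsLoopWithVelocity y w) :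
    IsLoopWithVelocity (x + y) (v + w) := by
  refine ⟨hx.1.add hy.1, fun t ht => ?_⟩
  have hsub : uIcc (0 : ℝ) t ⊆ uIcc (0 : ℝ) 1 := by
    rw [uIcc_of_le ht.1, uIcc_of_le zero_le_one]
    exact Icc_subset_Icc_right ht.2
  have e : ∫ s in (0 : ℝ)..t, (v + w : L2 n) s = ∫ s in (0 : ℝ)..t, (v s + w s) := by
    rw [intervalIntegral.integral_of_le ht.1, intervalIntegral.integral_of_le ht.1]
    exact integral_congr_ae
      (ae_restrict_of_ae_restrict_of_subset (Ioc_subset_Ioc_right ht.2) (Lp.coeFn_add v w))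
  rw [e, intervalIntegral.integral_add (v.intervalIntegrable.mono_set hsub)
    (w.intervalIntegrable.mono_set hsub), Pi.add_apply, Pi.add_apply, hx.2 t ht, hy.2 t ht]
  abel

theorem IsLoopWithVelocity.smul {n : ℕ} {x : ℝ → PhaseSpace n} {v : L2 n} (c : ℝ)
    (hx : IsLoopWithVelocity x v) : IsLoopWithVelocity (c • x) (c • v) := by
  refine ⟨hx.1.smul c, fun t ht => ?_⟩
  have e : ∫ s in (0 : ℝ)..t, (c • v : L2 n) s = ∫ s in (0 : ℝ)..t, c • v s := by
    rw [intervalIntegral.integral_of_le ht.1, intervalIntegral.integral_of_le ht.1]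
    exact integral_congr_ae
      (ae_restrict_of_ae_restrict_of_subset (Ioc_subset_Ioc_right ht.2) (Lp.coeFn_smul c v))
  rw [e, intervalIntegral.integral_smul, Pi.smul_apply, Pi.smul_apply, hx.2 t ht, smul_add]

theorem IsLoopWithVelocity.zero (n : ℕ) :
    IsLoopWithVelocity (0 : ℝ → PhaseSpace n) (0 : L2 n) := by
  refine ⟨fun _ => rfl, fun t ht => ?_⟩
  have e : ∫ s in (0 : ℝ)..t, (0 : L2 n) s = ∫ s in (0 : ℝ)..t, (0 : PhaseSpace n) := by
    rw [intervalIntegral.integral_of_le ht.1, intervalIntegral.integral_of_le ht.1]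
    exact integral_congr_ae
      (ae_restrict_of_ae_restrict_of_subset (Ioc_subset_Ioc_right ht.2)
        (Lp.coeFn_zero (PhaseSpace n) 2 _))
  rw [e, intervalIntegral.integral_zero]
  simp

/-- The pairs `(x, x')` with `x : 𝕋 → ℝ²ⁿ` absolutely continuous, `x' ∈ L²` and `∫ x = 0`. -/
def h1Submodule (n : ℕ) : Submodule ℝ ((ℝ → PhaseSpace n) × L2 n) where
  carrier := {p | IsLoopWithVelocity p.1 p.2 ∧ ∫ t in (0 : ℝ)..1, p.1 t = 0}
  zero_mem' := ⟨IsLoopWithVelocity.zero n, by simp⟩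
  add_mem' := by
    intro p q hp hq
    refine ⟨hp.1.add hq.1, ?_⟩
    simp only [Prod.fst_add, Pi.add_apply]
    rw [intervalIntegral.integral_add hp.1.intervalIntegrable hq.1.intervalIntegrable, hp.2, hq.2,
      add_zero]
  smul_mem' := by
    intro c p hp
    refine ⟨hp.1.smul c, ?_⟩
    simp only [Prod.smul_fst, Pi.smul_apply]
    rw [intervalIntegral.integral_smul, hp.2, smul_zero]

/-- `ℍ₁ = {x ∈ H¹(𝕋, ℝ²ⁿ) | ∫ x = 0}`. An element is a loop together with its derivative in
`L²`; each of the two determines the other. -/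
def H1 (n : ℕ) : Type := h1Submodule n

namespace H1

variable {n : ℕ}

instance : AddCommGroup (H1 n) := inferInstanceAs (AddCommGroup (h1Submodule n))

instance : Module ℝ (H1 n) := inferInstanceAs (Module ℝ (h1Submodule n))

/-- The underlying closed curve, as a `1`-periodic function on `ℝ`. -/
def curve : H1 n →ₗ[ℝ] (ℝ → PhaseSpace n) :=
  LinearMap.fst ℝ (ℝ → PhaseSpace n) (L2 n) ∘ₗ (h1Submodule n).subtype

/-- The derivative `x'`. -/
def vel : H1 n →ₗ[ℝ] L2 n :=
  LinearMap.snd ℝ (ℝ → PhaseSpace n) (L2 n) ∘ₗ (h1Submodule n).subtype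

theorem isLoopWithVelocity (x : H1 n) : IsLoopWithVelocity (curve x) (vel x) :=
  (Subtype.property (p := fun p => p ∈ h1Submodule n) x).1

theorem mean_eq_zero (x : H1 n) : ∫ t in (0 : ℝ)..1, curve x t = 0 :=
  (Subtype.property (p := fun p => p ∈ h1Submodule n) x).2

theorem vel_injective : Function.Injective (vel : H1 n → L2 n) := by
  refine (injective_iff_map_eq_zero (vel : H1 n →ₗ[ℝ] L2 n)).2 fun x hx => ?_
  have h := x.isLoopWithVelocity
  have hc : ∀ t ∈ Icc (0 : ℝ) 1, curve x t = curve x 0 := by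
    intro t ht
    have h0 := (IsLoopWithVelocity.zero n).2 t ht
    have ht' := h.2 t ht
    rw [hx] at ht'
    simp only [Pi.zero_apply, zero_add] at h0
    rw [ht', ← h0, add_zero]
  have hm := x.mean_eq_zero
  have hm' : ∫ t in (0 : ℝ)..1, curve x t = ∫ _t in (0 : ℝ)..1, curve x 0 := by
    refine intervalIntegral.integral_congr fun t ht => ?_
    rw [uIcc_of_le zero_le_one] at ht
    exact hc t ht
  rw [hm'] at hm
  have h00 : curve x 0 = 0 := by simpa using hm
  have hcurve : curve x = 0 := by
    funext t
    obtain ⟨s, hs, hst⟩ := h.1.exists_mem_Ico₀ one_pos t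
    rw [hst, hc s ⟨hs.1, hs.2.le⟩, h00]
    rfl
  exact Subtype.ext (Prod.ext hcurve hx)

/-- The Hilbert structure of `ℍ₁`: `(x, y) = (x', y')_{L²}`. -/
instance : NormedAddCommGroup (H1 n) :=
  NormedAddCommGroup.induced (H1 n) (L2 n) (vel : H1 n →ₗ[ℝ] L2 n) vel_injective

instance : InnerProductSpace ℝ (H1 n) where
  norm_smul_le c x := by
    change ‖vel (c • x)‖ ≤ ‖c‖ * ‖vel x‖
    rw [map_smul]
    exact norm_smul_le c (vel x)
  inner x y := inner ℝ (vel x) (vel y)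
  norm_sq_eq_re_inner x := norm_sq_eq_re_inner (𝕜 := ℝ) (vel x)
  conj_inner_symm x y := inner_conj_symm (𝕜 := ℝ) (vel x) (vel y)
  add_left x y z := by rw [map_add, inner_add_left]
  smul_left x y c := by rw [map_smul, inner_smul_left]

end H1

/-- Clarke's dual action functional
`Ψ_{H*}(x) = -½ ∫ J₀ x' · x dt + ∫ H*_t(J₀ x') dt` on `ℍ₁`. -/
def dualAction {n : ℕ} (H : ℝ → PhaseSpace n → ℝ) (x : H1 n) : ℝ :=
  -(1 / 2) * (∫ t in (0 : ℝ)..1, inner ℝ (J0 n (x.vel t)) (x.curve t)) +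
    ∫ t in (0 : ℝ)..1, fenchel H t (J0 n (x.vel t))

/-! ### The Fourier splitting -/

/-- The coefficient `x̂_k = ∫ e^{2πkJ₀t} x(t) dt` in the Fourier expansion
`x(t) = ∑_k e^{-2πkJ₀t} x̂_k`. -/
def fourierCoef {n : ℕ} (k : ℤ) (x : ℝ → PhaseSpace n) : PhaseSpace n :=
  ∫ t in (0 : ℝ)..1, expJ0 n (2 * Real.pi * k * t) (x t)

/-- `ℍ₁^{N,+}`: the `x ∈ ℍ₁` of the form `x(t) = ∑_{k=1}^N e^{-2πkJ₀t} x̂_k`. -/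
def lowModes (n N : ℕ) : Submodule ℝ (H1 n) where
  carrier := {x | ∃ c : ℕ → PhaseSpace n, ∀ t : ℝ,
    x.curve t = ∑ k ∈ Finset.Icc 1 N, expJ0 n (-(2 * Real.pi * k * t)) (c k)}
  zero_mem' := ⟨0, fun t => by simp⟩
  add_mem' := by
    rintro x y ⟨c, hc⟩ ⟨d, hd⟩
    exact ⟨c + d, fun t => by simp [hc, hd, Finset.sum_add_distrib]⟩
  smul_mem' := by
    rintro a x ⟨c, hc⟩
    exact ⟨a • c, fun t => by simp [hc, Finset.smul_sum]⟩

theorem intervalIntegrable_expJ0 {n : ℕ} (k : ℤ) (x : H1 n) :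
    IntervalIntegrable (fun t => expJ0 n (2 * Real.pi * k * t) (x.curve t)) volume 0 1 := by
  have hx := x.isLoopWithVelocity.intervalIntegrable
  have h1 : IntervalIntegrable (fun t : ℝ => Real.cos (2 * Real.pi * k * t) • x.curve t)
      volume 0 1 :=
    hx.continuousOn_smul (by fun_prop)
  have hJ : IntervalIntegrable (fun t : ℝ => J0 n (x.curve t)) volume 0 1 :=
    ⟨(J0 n).integrable_comp hx.1, (J0 n).integrable_comp hx.2⟩
  have h2 : IntervalIntegrable (fun t : ℝ => Real.sin (2 * Real.pi * k * t) • J0 n (x.curve t))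
      volume 0 1 :=
    hJ.continuousOn_smul (by fun_prop)
  simpa [expJ0] using h1.add h2

/-- The complement of `ℍ₁^{N,+}`: the `x ∈ ℍ₁` whose Fourier expansion only contains
the modes `k ≤ -1` and `k ≥ N + 1`. -/
def highModes (n N : ℕ) : Submodule ℝ (H1 n) where
  carrier := {x | ∀ k : ℤ, 0 ≤ k → k ≤ N → fourierCoef k x.curve = 0}
  zero_mem' := by
    intro k _ _
    simp [fourierCoef]
  add_mem' := by
    intro x y hx hy k h0 hN
    have h := intervalIntegral.integral_add (intervalIntegrable_expJ0 k x)
      (intervalIntegrable_expJ0 k y)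
    have hx' := hx k h0 hN
    have hy' := hy k h0 hN
    simp only [fourierCoef] at hx' hy' ⊢
    simp only [map_add, Pi.add_apply]
    rw [h, hx', hy', add_zero]
  smul_mem' := by
    intro a x hx k h0 hN
    have hx' := hx k h0 hN
    simp only [fourierCoef] at hx' ⊢
    simp only [map_smul, Pi.smul_apply]
    rw [intervalIntegral.integral_smul, hx', smul_zero]

/-! ### The Banach spaces `C^k(𝕋, ℝ²ⁿ)` -/

/-- The `1`-periodic curves of class `C^k`. -/
def ckSubmodule (n k : ℕ) : Submodule ℝ (ℝ → PhaseSpace n) where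
  carrier := {x | Function.Periodic x 1 ∧ ContDiff ℝ k x}
  zero_mem' := ⟨fun _ => rfl, contDiff_const⟩
  add_mem' := fun hx hy => ⟨hx.1.add hy.1, hx.2.add hy.2⟩
  smul_mem' := fun c _ hx => ⟨hx.1.smul c, hx.2.const_smul c⟩

/-- `C^k(𝕋, ℝ²ⁿ)`. -/
def CkLoop (n k : ℕ) : Type := ckSubmodule n k

namespace CkLoop

variable {n k : ℕ}

instance : AddCommGroup (CkLoop n k) := inferInstanceAs (AddCommGroup (ckSubmodule n k))

instance : Module ℝ (CkLoop n k) := inferInstanceAs (Module ℝ (ckSubmodule n k))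

/-- The underlying `1`-periodic function on `ℝ`. -/
def curve : CkLoop n k →ₗ[ℝ] (ℝ → PhaseSpace n) := (ckSubmodule n k).subtype

theorem periodic (x : CkLoop n k) : Function.Periodic (curve x) 1 :=
  (Subtype.property (p := fun p => p ∈ ckSubmodule n k) x).1

theorem contDiff (x : CkLoop n k) : ContDiff ℝ k (curve x) :=
  (Subtype.property (p := fun p => p ∈ ckSubmodule n k) x).2

theorem continuous_iteratedDeriv (x : CkLoop n k) (j : Fin (k + 1)) :
    Continuous (iteratedDeriv j (curve x)) :=
  x.contDiff.continuous_iteratedDeriv j (by exact_mod_cast Nat.lt_succ_iff.1 j.2)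

theorem periodic_iteratedDeriv (x : CkLoop n k) (j : ℕ) :
    Function.Periodic (iteratedDeriv j (curve x)) 1 := by
  intro t
  have h := iteratedDeriv_comp_add_const j (curve x) 1
  have h' : (fun z => curve x (z + 1)) = curve x := funext x.periodic
  rw [h'] at h
  exact (congrFun h t).symm

theorem exists_bound (x : CkLoop n k) (j : Fin (k + 1)) :
    ∃ C, ∀ t, ‖iteratedDeriv j (curve x) t‖ ≤ C := by
  obtain ⟨C, hC⟩ := isCompact_Icc.exists_bound_of_continuousOn
    (s := Icc (0 : ℝ) 1) (x.continuous_iteratedDeriv j).continuousOn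
  refine ⟨C, fun t => ?_⟩
  obtain ⟨s, hs, hst⟩ := (x.periodic_iteratedDeriv j).exists_mem_Ico₀ one_pos t
  rw [hst]
  exact hC s ⟨hs.1, hs.2.le⟩

/-- The tuple `(x, x', …, x^{(k)})` of bounded continuous functions. -/
def jet : CkLoop n k →ₗ[ℝ] (Fin (k + 1) → BoundedContinuousFunction ℝ (PhaseSpace n)) where
  toFun x j := BoundedContinuousFunction.ofNormedAddCommGroup (iteratedDeriv j (curve x))
    (x.continuous_iteratedDeriv j) (x.exists_bound j).choose (x.exists_bound j).choose_spec
  map_add' x y := by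
    funext j
    ext1 t
    have hj : ((j : ℕ) : WithTop ℕ∞) ≤ (k : WithTop ℕ∞) := by
      exact_mod_cast Nat.lt_succ_iff.1 j.2
    simpa using iteratedDeriv_add (x.contDiff.of_le hj).contDiffAt
      (y.contDiff.of_le hj).contDiffAt (x := t)
  map_smul' c x := by
    funext j
    ext1 t
    simp

theorem jet_injective : Function.Injective (jet : CkLoop n k → _) := by
  intro x y h
  have h0 : ∀ t, curve x t = curve y t := fun t => by
    have := congrArg (fun f => f t) (congrFun h 0)
    simpa [jet] using this
  exact Subtype.ext (funext h0)

/-- The `C^k`-norm `max_{j ≤ k} sup_t |x^{(j)}(t)|`. -/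
instance : NormedAddCommGroup (CkLoop n k) :=
  NormedAddCommGroup.induced (CkLoop n k)
    (Fin (k + 1) → BoundedContinuousFunction ℝ (PhaseSpace n)) jet jet_injective

instance : NormedSpace ℝ (CkLoop n k) where
  norm_smul_le c x := by
    change ‖jet (c • x)‖ ≤ ‖c‖ * ‖jet x‖
    rw [map_smul]
    exact norm_smul_le c (jet x)

end CkLoop

/-! ### Critical points, index and nullity -/

section Critical

variable {V : Type*} [NormedAddCommGroup V] [NormedSpace ℝ V]

/-- `z` is a critical point of `f`: the differential of `f` at `z` exists and vanishes. -/
def IsCritical (f : V → ℝ) (z : V) : Prop := HasFDerivAt f (0 : V →L[ℝ] ℝ) z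

/-- The second Gateaux differential: `d²f(z)[u, ·]` is the derivative at `s = 0` of
`s ↦ df(z + s u)`, in the dual norm. For `f` of class `C²` it is the usual second differential. -/
def secondDiff (f : V → ℝ) (z u : V) : V →L[ℝ] ℝ := lineDeriv ℝ (fderiv ℝ f) z u

/-- The second Gateaux differential of `f` at `z` is non-degenerate:
`u ↦ d²f(z)[u, ·]` is a bijection onto the dual space. -/
def IsNondegenerateAt (f : V → ℝ) (z : V) : Prop :=
  Function.Bijective (secondDiff f z)

/-- The maximal dimension of a linear subspace on which `d²f(z)` is negative definite. -/
def morseIndex (f : V → ℝ) (z : V) : ℕ∞ :=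
  ⨆ (W : Submodule ℝ V) (_ : FiniteDimensional ℝ W ∧ ∀ w ∈ W, w ≠ 0 → secondDiff f z w w < 0),
    (Module.finrank ℝ W : ℕ∞)

/-- The dimension of the kernel of `d²f(z)`; as `d²f(z)[u, ·]` is linear in `u`, the kernel is
a linear subspace and taking the span changes nothing. -/
def nullity (f : V → ℝ) (z : V) : ℕ∞ :=
  Cardinal.toENat (Module.rank ℝ (Submodule.span ℝ {u : V | secondDiff f z u = 0}))

end Critical

/-! ### Functions on a finite dimensional submanifold -/

section Manifold

variable {M : Type*} [TopologicalSpace M]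

/-- `z` is a critical point of the function `f` on the manifold `M`. -/
def IsCriticalOn (d : ℕ) [ChartedSpace (EuclideanSpace ℝ (Fin d)) M] (f : M → ℝ) (z : M) : Prop :=
  HasMFDerivAt (𝓡 d) 𝓘(ℝ, ℝ) f z 0

/-- The expression of `f` in the preferred chart at `z`. -/
def inChart (d : ℕ) [ChartedSpace (EuclideanSpace ℝ (Fin d)) M] (f : M → ℝ) (z : M) :
    EuclideanSpace ℝ (Fin d) → ℝ :=
  f ∘ (chartAt (EuclideanSpace ℝ (Fin d)) z).symm

/-- The Morse index at a critical point `z` of `f : M → ℝ`: the index of the Hessian in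
local coordinates. -/
def morseIndexOn (d : ℕ) [ChartedSpace (EuclideanSpace ℝ (Fin d)) M] (f : M → ℝ) (z : M) : ℕ∞ :=
  morseIndex (inChart d f z) (chartAt (EuclideanSpace ℝ (Fin d)) z z)

/-- The nullity at a critical point `z` of `f : M → ℝ`: the dimension of the kernel of the Hessian
in local coordinates. -/
def nullityOn (d : ℕ) [ChartedSpace (EuclideanSpace ℝ (Fin d)) M] (f : M → ℝ) (z : M) : ℕ∞ :=
  nullity (inChart d f z) (chartAt (EuclideanSpace ℝ (Fin d)) z z)

/-- The differential `df(z) : T_z M → V` of a map `f` from `M` to a normed space; the type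
`TangentSpace (𝓡 d) z` of tangent vectors is by definition the model space. -/
def diffOn (d : ℕ) [ChartedSpace (EuclideanSpace ℝ (Fin d)) M]
    {V : Type*} [NormedAddCommGroup V] [NormedSpace ℝ V] (f : M → V) (z : M) :
    EuclideanSpace ℝ (Fin d) →L[ℝ] V :=
  mfderiv (𝓡 d) 𝓘(ℝ, V) f z

/-- The Palais–Smale condition for a smooth `f : M → ℝ` when `M` carries the Riemannian metric
induced by an immersion `ι` into the inner product space `V`: every sequence `z_j` such that the
dual norm of `df(z_j)`, with respect to the norm `v ↦ ‖dι(z_j) v‖` on `T_{z_j} M`, tends to zero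
has a convergent subsequence. -/
def PalaisSmaleOn (d : ℕ) [ChartedSpace (EuclideanSpace ℝ (Fin d)) M]
    {V : Type*} [NormedAddCommGroup V] [InnerProductSpace ℝ V] (ι : M → V) (f : M → ℝ) : Prop :=
  ∀ z : ℕ → M,
    (∃ ε : ℕ → ℝ, Tendsto ε atTop (𝓝 0) ∧
      ∀ (j : ℕ) (v : EuclideanSpace ℝ (Fin d)),
        |diffOn d f (z j) v| ≤ ε j * ‖diffOn d ι (z j) v‖) →
    ∃ (z' : M) (φ : ℕ → ℕ), StrictMono φ ∧ Tendsto (z ∘ φ) atTop (𝓝 z')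

end Manifold

/-- The graph `M = {x + y | x ∈ ℍ₁^{N,+}, y = Y(x)}` of a map `Y` between the two summands,
as a subset of `ℍ₁`. -/
def graphSet {n N : ℕ} (Y : lowModes n N → highModes n N) : Set (H1 n) :=
  {z | ∃ x : lowModes n N, z = (x : H1 n) + (Y x : H1 n)}

end DualAction

end

open DualAction

/-! Since `∇H_t` is strongly monotone and Lipschitz, it has a smooth inverse `∇H*_t` with the same
two properties (`IsSmoothHamiltonian.exists_legendrePair`). On the mode `e^{-2πkJ₀t}` the operator
`J₀ d/dt` is multiplication by `2πk`, so on the modes `k < 0` and `k > N` the indefinite part of the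
dual action costs at most `(2π(N+1))⁻¹ ‖u‖²` (`inner_J2_velL_curveL_le`). For large `N` the strong
convexity of `H*` wins: the dual action `Ψ` is uniformly convex along the high modes. The theorem on
Lipschitz strongly monotone operators then gives the unique critical point `Y(x)` on each slice, and
its linear case gives non-degeneracy.

Smoothness of `Y` is the delicate point, because the superposition operator of `∇H*` on `L²` is in
general only Gateaux differentiable, so the implicit function theorem is not available in `ℍ₁`. On
continuous loops with the sup norm superposition operators are smooth. Criticality along the high
modes says that `∇H*(J₀z') - z` is a trigonometric polynomial `p` with modes `0, …, N`, that is, `z'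
= X_H(t, z + p)`; hence `z'` is continuous, and it solves an equation in `C⁰(𝕋)` (`eulerMap`). Its
linearization is bijective: coercivity of the second differential on the high modes gives
injectivity and a weak solution, and invertibility of the derivative of `∇H*_t` makes the weak
solution continuous. The inverse function theorem yields smooth dependence of `z'` on `x` in `C⁰`
(`contDiff_velC`), and the equation itself bootstraps this to every `C^k` (`isSmoothFamily_velC`).

`dΨ` vanishes on the high modes at each point of the graph `M`. So critical points of `Ψ` and of its
restriction agree. Differentiating this identity along `M` shows that the tangent space is
orthogonal, for the second differential, to the high modes, where that form is positive; index and
nullity therefore agree (`IsReductionAt`).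

For Palais–Smale, a small differential on `M` is a small `dΨ`, since tangent vectors are controlled
by their low component. Adding to `z` the mean of its `L²` gradient gives a loop that almost solves
Hamilton's equation (`exists_almost_orbit`); non-resonance bounds it, hence `z`, and `M` has a
global finite dimensional chart. -/

noncomputable section

namespace DualAction

open MeasureTheory Set Filter

/-! ### Strongly monotone operators -/

section Monotone

variable {V : Type*} [NormedAddCommGroup V] [InnerProductSpace ℝ V] [CompleteSpace V]

/-- A Lipschitz, strongly monotone operator from a Hilbert space to its dual is bijective. -/
theorem bijective_of_stronglyMonotone {A : V → (V →L[ℝ] ℝ)} {μ L : ℝ} (hμ : 0 < μ)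
    (hmono : ∀ x y, μ * ‖x - y‖ ^ 2 ≤ (A x - A y) (x - y))
    (hlip : ∀ x y, ‖A x - A y‖ ≤ L * ‖x - y‖) : Function.Bijective A := by
  constructor
  · intro x y hxy
    have h := hmono x y
    rw [hxy, sub_self, zero_apply] at h
    have h2 : ‖x - y‖ ^ 2 ≤ 0 := by nlinarith
    have h3 : ‖x - y‖ = 0 := by
      have := sq_nonneg ‖x - y‖
      exact pow_eq_zero_iff two_ne_zero |>.1 (le_antisymm h2 this)
    exact sub_eq_zero.1 (norm_eq_zero.1 h3)
  · intro φ
    -- Enlarging `L` to `M ≥ μ` makes `M` positive and the factor `q` below nonnegative, whatever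
    -- the sign of `L`.
    obtain ⟨M, hMμ, hML⟩ : ∃ M, μ ≤ M ∧ L ≤ M := ⟨max L μ, le_max_right _ _, le_max_left _ _⟩
    have hM : 0 < M := hμ.trans_le hMμ
    set R := (InnerProductSpace.toDual ℝ V).symm with hR
    -- This step size minimizes `1 - 2τμ + τ²M²`, the bound for the squared contraction factor of
    -- `T`; the minimum is `q`.
    set τ : ℝ := μ / M ^ 2 with hτ
    have hτ0 : 0 < τ := by positivity
    set T : V → V := fun x => x - τ • R (A x - φ) with hT
    set q : ℝ := 1 - μ ^ 2 / M ^ 2 with hq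
    have hq0 : 0 ≤ q := by
      rw [hq, sub_nonneg, div_le_one (by positivity)]
      gcongr
    have hq1 : q < 1 := by
      rw [hq]
      have : 0 < μ ^ 2 / M ^ 2 := by positivity
      linarith
    have key : ∀ x y, ‖T x - T y‖ ^ 2 ≤ q * ‖x - y‖ ^ 2 := by
      intro x y
      have e : T x - T y = (x - y) - τ • R (A x - A y) := by
        simp only [hT, map_sub, smul_sub]
        abel
      rw [e, norm_sub_sq_real, inner_smul_right, norm_smul, real_inner_comm,
        hR, InnerProductSpace.toDual_symm_apply, LinearIsometryEquiv.norm_map,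
        Real.norm_of_nonneg hτ0.le]
      have h1 := hmono x y
      have h2 : ‖A x - A y‖ ^ 2 ≤ M ^ 2 * ‖x - y‖ ^ 2 := by
        rw [← mul_pow]
        have := hlip x y
        have h3 : L * ‖x - y‖ ≤ M * ‖x - y‖ := by gcongr
        exact pow_le_pow_left₀ (norm_nonneg _) (this.trans h3) 2
      have h4 : τ * (μ * ‖x - y‖ ^ 2) ≤ τ * ((A x - A y) (x - y)) := by gcongr
      have h5 : τ ^ 2 * ‖A x - A y‖ ^ 2 ≤ τ ^ 2 * (M ^ 2 * ‖x - y‖ ^ 2) := by gcongr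
      have h6 : τ ^ 2 * M ^ 2 = τ * μ := by rw [hτ]; field_simp
      have h7 : τ * μ = μ ^ 2 / M ^ 2 := by rw [hτ]; ring
      rw [hq, ← h7, mul_pow]
      calc _ ≤ ‖x - y‖ ^ 2 - 2 * (τ * (μ * ‖x - y‖ ^ 2)) + τ ^ 2 * (M ^ 2 * ‖x - y‖ ^ 2) := by
            linarith
        _ = ‖x - y‖ ^ 2 - 2 * (τ * (μ * ‖x - y‖ ^ 2)) + (τ ^ 2 * M ^ 2) * ‖x - y‖ ^ 2 := by ring
        _ = _ := by rw [h6]; ring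
    have hcon : ContractingWith (Real.toNNReal (Real.sqrt q)) T := by
      refine ⟨?_, LipschitzWith.of_dist_le_mul fun x y => ?_⟩
      · rw [Real.toNNReal_lt_one, Real.sqrt_lt' one_pos]
        simpa using hq1
      · rw [dist_eq_norm, dist_eq_norm, Real.coe_toNNReal _ (Real.sqrt_nonneg _)]
        refine abs_le_of_sq_le_sq' ?_ (by positivity) |>.2
        rw [mul_pow, Real.sq_sqrt hq0]
        exact key x y
    refine ⟨hcon.fixedPoint T, ?_⟩
    have h := hcon.fixedPoint_isFixedPt (f := T)
    have h' : τ • R (A (hcon.fixedPoint T) - φ) = 0 := by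
      have : T (hcon.fixedPoint T) = hcon.fixedPoint T := h
      simpa [hT] using this
    have h'' : R (A (hcon.fixedPoint T) - φ) = 0 := (smul_eq_zero.1 h').resolve_left hτ0.ne'
    exact sub_eq_zero.1 ((map_eq_zero_iff R R.injective).1 h'')

end Monotone

/-! ### Superposition operators on spaces of continuous loops -/

/-- A smooth map `ℝ × F → F'`, `1`-periodic in the first variable. -/
structure PeriodicMap (F F' : Type) [NormedAddCommGroup F] [NormedSpace ℝ F]
    [NormedAddCommGroup F'] [NormedSpace ℝ F'] where
  toFun : ℝ → F → F'
  contDiff : ContDiff ℝ ∞ (fun p : ℝ × F => toFun p.1 p.2)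
  periodic : ∀ t z, toFun (t + 1) z = toFun t z

namespace PeriodicMap

variable {F F' : Type} [NormedAddCommGroup F] [NormedSpace ℝ F]
  [NormedAddCommGroup F'] [NormedSpace ℝ F']

theorem contDiff_right (f : PeriodicMap F F') (t : ℝ) : ContDiff ℝ ∞ (f.toFun t) :=
  f.contDiff.comp (contDiff_const.prodMk contDiff_id)

theorem hasFDerivAt (f : PeriodicMap F F') (t : ℝ) (z : F) :
    HasFDerivAt (f.toFun t) (fderiv ℝ (f.toFun t) z) z :=
  ((f.contDiff_right t).differentiable (by simp) z).hasFDerivAt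

/-- The derivative in the second variable. -/
def deriv₂ (f : PeriodicMap F F') : PeriodicMap F (F →L[ℝ] F') where
  toFun t z := fderiv ℝ (f.toFun t) z
  contDiff := by
    have h : ContDiff ℝ ∞ (fun p : ℝ × F => fderiv ℝ (f.toFun p.1) p.2) := by
      refine ContDiff.fderiv (f := fun p : ℝ × F => f.toFun p.1) (n := ∞) (m := ∞) ?_ contDiff_snd ?_
      · exact f.contDiff.comp ((contDiff_fst.comp contDiff_fst).prodMk contDiff_snd)
      · simp
    exact h
  periodic t z := by
    rw [show f.toFun (t + 1) = f.toFun t from funext (f.periodic t)]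

/-- The induced map on `𝕋 × F`. -/
def lift (f : PeriodicMap F F') : C(UnitAddCircle × F, F') where
  toFun p := Function.Periodic.lift (f := fun t => f.toFun t p.2) (fun t => f.periodic t p.2) p.1
  continuous_toFun := by
    have hq : IsOpenQuotientMap (Prod.map ((↑) : ℝ → UnitAddCircle) (id : F → F)) :=
      QuotientAddGroup.isOpenQuotientMap_mk.prodMap IsOpenQuotientMap.id
    rw [hq.isQuotientMap.continuous_iff]
    exact f.contDiff.continuous

/-- The superposition operator `u ↦ f(t, u(t))`. -/
def superposition (f : PeriodicMap F F') (u : C(UnitAddCircle, F)) : C(UnitAddCircle, F') :=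
  f.lift.comp ((ContinuousMap.id _).prodMk u)

theorem superposition_coe (f : PeriodicMap F F') (u : C(UnitAddCircle, F)) (t : ℝ) :
    f.superposition u (t : UnitAddCircle) = f.toFun t (u (t : UnitAddCircle)) := rfl

theorem continuous_superposition (f : PeriodicMap F F') : Continuous f.superposition := by
  refine (ContinuousMap.continuous_postcomp f.lift).comp ?_
  refine ContinuousMap.continuous_of_continuous_uncurry _ ?_
  exact continuous_snd.prodMk (continuous_eval.comp continuous_id)

/-- Pointwise application of a loop of operators to a loop of vectors. -/
def applyLoop : C(UnitAddCircle, F →L[ℝ] F') →L[ℝ]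
    C(UnitAddCircle, F) →L[ℝ] C(UnitAddCircle, F') :=
  LinearMap.mkContinuous₂
    (LinearMap.mk₂ ℝ (fun (A : C(UnitAddCircle, F →L[ℝ] F')) (h : C(UnitAddCircle, F)) =>
        (⟨fun θ => A θ (h θ), by fun_prop⟩ : C(UnitAddCircle, F')))
      (fun _ _ _ => by ext; simp) (fun _ _ _ => by ext; simp)
      (fun _ _ _ => by ext; simp) (fun _ _ _ => by ext; simp)) 1
    (fun A h => by
      refine (ContinuousMap.norm_le _ (by positivity)).2 fun θ => ?_
      rw [one_mul]
      exact (A θ).le_opNorm_of_le (h.norm_coe_le_norm θ) |>.trans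
        (mul_le_mul_of_nonneg_right (A.norm_coe_le_norm θ) (norm_nonneg _)))

theorem applyLoop_apply (A : C(UnitAddCircle, F →L[ℝ] F')) (h : C(UnitAddCircle, F))
    (θ : UnitAddCircle) : applyLoop A h θ = A θ (h θ) := rfl

/-- The mean value inequality is applied at each time. The bound on the derivative is uniform in
time because the superposition operator of `deriv₂` is continuous for the sup norm. -/
theorem hasFDerivAt_superposition (f : PeriodicMap F F') (u : C(UnitAddCircle, F)) :
    HasFDerivAt f.superposition (applyLoop (f.deriv₂.superposition u)) u := by
  rw [hasFDerivAt_iff_isLittleO, Asymptotics.isLittleO_iff]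
  intro ε hε
  have hcont := f.deriv₂.continuous_superposition.continuousAt (x := u)
  obtain ⟨δ, hδ, hball⟩ := Metric.continuousAt_iff.1 hcont ε hε
  filter_upwards [Metric.ball_mem_nhds u hδ] with v hv
  refine (ContinuousMap.norm_le _ (by positivity)).2 fun θ => ?_
  obtain ⟨t, rfl⟩ := QuotientAddGroup.mk_surjective θ
  have hvt : ‖v (t : UnitAddCircle) - u (t : UnitAddCircle)‖ < δ := by
    rw [Metric.mem_ball, dist_eq_norm] at hv
    exact ((v - u).norm_coe_le_norm _).trans_lt hv
  have hder : ∀ z ∈ Metric.ball (u (t : UnitAddCircle)) δ,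
      ‖fderiv ℝ (f.toFun t) z - fderiv ℝ (f.toFun t) (u (t : UnitAddCircle))‖ ≤ ε := by
    intro z hz
    -- Translating `u` by a constant produces a loop within `δ` of `u` that passes through `z` at
    -- time `t`, so closeness of loops yields the pointwise estimate at `z`.
    set w : C(UnitAddCircle, F) := u + ContinuousMap.const _ (z - u (t : UnitAddCircle)) with hw
    have hwu : dist w u < δ := by
      rw [dist_eq_norm, hw, add_sub_cancel_left]
      refine lt_of_le_of_lt ((ContinuousMap.norm_le _ (norm_nonneg _)).2 fun _ => le_rfl) ?_
      rw [Metric.mem_ball, dist_eq_norm] at hz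
      exact hz
    have h := hball hwu
    rw [dist_eq_norm] at h
    have h2 := ((f.deriv₂.superposition w - f.deriv₂.superposition u).norm_coe_le_norm
      (t : UnitAddCircle)).trans h.le
    have e : w (t : UnitAddCircle) = z := by simp [hw]
    rw [ContinuousMap.sub_apply, superposition_coe, superposition_coe, e] at h2
    exact h2
  have := (convex_ball (u (t : UnitAddCircle)) δ).norm_image_sub_le_of_norm_hasFDerivWithin_le'
    (f := f.toFun t) (fun z _ => (f.hasFDerivAt t z).hasFDerivWithinAt) hder
    (Metric.mem_ball_self hδ) (y := v (t : UnitAddCircle))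
    (by rwa [Metric.mem_ball, dist_eq_norm])
  calc _ ≤ ε * ‖v (t : UnitAddCircle) - u (t : UnitAddCircle)‖ := this
    _ ≤ _ := by
      gcongr
      exact (v - u).norm_coe_le_norm _

/-- The differential is again a superposition operator, that of `deriv₂`, followed by the bounded
linear map `applyLoop`. Its values are operators, so the induction must let the target space `F'`
vary. -/
theorem contDiff_superposition (f : PeriodicMap F F') : ContDiff ℝ ∞ f.superposition := by
  rw [contDiff_infty]
  intro m
  induction m generalizing F' with
  | zero => exact contDiff_zero.2 f.continuous_superposition
  | succ m ih =>
    have h0 : ContDiff ℝ m (fun A : C(UnitAddCircle, F →L[ℝ] F') => applyLoop A) :=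
      ContinuousLinearMap.contDiff _
    have h := (contDiff_succ_iff_hasFDerivAt (𝕜 := ℝ) (n := m) (f := f.superposition)).2
      ⟨fun u => applyLoop (f.deriv₂.superposition u), h0.comp (ih f.deriv₂),
        f.hasFDerivAt_superposition⟩
    exact_mod_cast h

end PeriodicMap

/-! ### Second order expansions -/

section Expansion

variable {V : Type*} [NormedAddCommGroup V] [InnerProductSpace ℝ V]

/-- Along the segment, `f` minus its tangent and the quadratic term has nonnegative derivative. The
sign of `a` plays no role, and the Lipschitz upper bound follows by applying this to `-f` with `-b`.
-/
theorem le_of_gradient_stronglyMonotone {f : V → ℝ} {g : V → V} {a : ℝ}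
    (hf : ∀ x, HasFDerivAt f (innerSL ℝ (g x)) x)
    (hg : ∀ x y, a * ‖x - y‖ ^ 2 ≤ inner ℝ (g x - g y) (x - y)) (x h : V) :
    f x + inner ℝ (g x) h + a / 2 * ‖h‖ ^ 2 ≤ f (x + h) := by
  set φ : ℝ → ℝ := fun s => f (x + s • h) - s * inner ℝ (g x) h - a / 2 * ‖h‖ ^ 2 * s ^ 2 with hφ
  have hd : ∀ s, HasDerivAt φ (inner ℝ (g (x + s • h)) h - inner ℝ (g x) h - a * ‖h‖ ^ 2 * s) s := by
    intro s
    have h1 : HasDerivAt (fun s : ℝ => x + s • h) h s := by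
      simpa using ((hasDerivAt_id s).smul_const h).const_add x
    have h2 := (hf (x + s • h)).comp_hasDerivAt s h1
    have h3 := ((hasDerivAt_id s).mul_const (inner ℝ (g x) h))
    have h4 := ((hasDerivAt_id s).pow 2).const_mul (a / 2 * ‖h‖ ^ 2)
    refine ((h2.sub h3).sub h4).congr_deriv ?_
    simp only [innerSL_apply_apply, id]
    ring
  have hmono : MonotoneOn φ (Icc 0 1) := by
    refine monotoneOn_of_deriv_nonneg (convex_Icc 0 1)
      (fun s _ => (hd s).continuousAt.continuousWithinAt)
      (fun s _ => (hd s).differentiableAt.differentiableWithinAt) fun s hs => ?_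
    rw [interior_Icc] at hs
    rw [(hd s).deriv]
    have h1 := hg (x + s • h) x
    rw [add_sub_cancel_left, norm_smul, inner_smul_right, inner_sub_left, mul_pow,
      Real.norm_of_nonneg hs.1.le] at h1
    have h' : s * (a * ‖h‖ ^ 2 * s) ≤ s * (inner ℝ (g (x + s • h)) h - inner ℝ (g x) h) := by
      nlinarith
    have := le_of_mul_le_mul_left h' hs.1
    linarith
  have := hmono (left_mem_Icc.2 zero_le_one) (right_mem_Icc.2 zero_le_one) zero_le_one
  simp only [hφ, zero_smul, add_zero, one_smul] at this
  linarith

theorem le_of_gradient_lipschitz {f : V → ℝ} {g : V → V} {b : ℝ}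
    (hf : ∀ x, HasFDerivAt f (innerSL ℝ (g x)) x)
    (hg : ∀ x y, ‖g x - g y‖ ≤ b * ‖x - y‖) (x h : V) :
    f (x + h) ≤ f x + inner ℝ (g x) h + b / 2 * ‖h‖ ^ 2 := by
  have h1 := le_of_gradient_stronglyMonotone (f := fun x => -f x) (g := fun x => -g x) (a := -b)
    (fun x => by rw [map_neg]; exact (hf x).neg) (fun x y => by
      have h2 := (real_inner_le_norm (g x - g y) (x - y)).trans
        (mul_le_mul_of_nonneg_right (hg x y) (norm_nonneg _))
      have h3 : inner ℝ (-g x - -g y) (x - y) = -inner ℝ (g x - g y) (x - y) := by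
        rw [← inner_neg_left]; congr 1; abel
      rw [h3]; nlinarith) x h
  rw [inner_neg_left] at h1
  linarith

end Expansion

/-! ### The Legendre transform of a quadratically convex Hamiltonian -/

/-- A quadratically convex Hamiltonian together with the inverse `dual` of its gradient map,
its Fenchel conjugate `conj`, and the bounds that quadratic convexity implies. -/
structure LegendrePair {n : ℕ} (H : ℝ → PhaseSpace n → ℝ) where
  grad : PeriodicMap (PhaseSpace n) (PhaseSpace n)
  grad_eq : ∀ t z, grad.toFun t z = gradient (H t) z
  dual : PeriodicMap (PhaseSpace n) (PhaseSpace n)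
  grad_dual : ∀ t x, grad.toFun t (dual.toFun t x) = x
  conj : PeriodicMap (PhaseSpace n) ℝ
  conj_eq : ∀ t x, conj.toFun t x = fenchel H t x
  lo : ℝ
  up : ℝ
  upGrad : ℝ
  lo_pos : 0 < lo
  up_pos : 0 < up
  upGrad_pos : 0 < upGrad
  hasFDerivAt_conj : ∀ t x, HasFDerivAt (conj.toFun t) (innerSL ℝ (dual.toFun t x)) x
  mono : ∀ t x y, lo * ‖x - y‖ ^ 2 ≤ inner ℝ (dual.toFun t x - dual.toFun t y) (x - y)
  lip : ∀ t x y, ‖dual.toFun t x - dual.toFun t y‖ ≤ up * ‖x - y‖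
  lip_grad : ∀ t x y, ‖grad.toFun t x - grad.toFun t y‖ ≤ upGrad * ‖x - y‖

section Legendre

variable {V : Type*} [NormedAddCommGroup V] [InnerProductSpace ℝ V]

/-- Polarization: `4 B(u, v) = B(u+v, u+v) - B(u-v, u-v)`, and for unit vectors both terms lie in
`[0, 4c]`. -/
theorem norm_le_of_bilin_le {B : V →L[ℝ] V →L[ℝ] ℝ} {c : ℝ} (hc : 0 ≤ c)
    (hsymm : ∀ u v, B u v = B v u) (h0 : ∀ u, 0 ≤ B u u) (h1 : ∀ u, B u u ≤ c * ‖u‖ ^ 2) :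
    ‖B‖ ≤ c := by
  refine ContinuousLinearMap.opNorm_le_of_unit_norm hc fun u hu => ?_
  refine ContinuousLinearMap.opNorm_le_of_unit_norm hc fun v hv => ?_
  have e1 : B (u + v) (u + v) = B u u + 2 * B u v + B v v := by
    simp only [map_add, add_apply, hsymm v u]; ring
  have e2 : B (u - v) (u - v) = B u u - 2 * B u v + B v v := by
    simp only [map_sub, sub_apply, hsymm v u]; ring
  have n1 : ‖u + v‖ ^ 2 ≤ 4 := by
    have := norm_add_le u v
    rw [hu, hv] at this
    nlinarith [norm_nonneg (u + v)]
  have n2 : ‖u - v‖ ^ 2 ≤ 4 := by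
    have := norm_sub_le u v
    rw [hu, hv] at this
    nlinarith [norm_nonneg (u - v)]
  have a1 := h1 (u + v)
  have a2 := h1 (u - v)
  have b1 := h0 (u + v)
  have b2 := h0 (u - v)
  have c1 : c * ‖u + v‖ ^ 2 ≤ c * 4 := by gcongr
  have c2 : c * ‖u - v‖ ^ 2 ≤ c * 4 := by gcongr
  rw [Real.norm_eq_abs, abs_le]
  constructor <;> linarith

theorem fderiv_stronglyMonotone {f : V → ℝ} {h₁ : ℝ} (hf : ContDiff ℝ ∞ f)
    (h : ∀ z u, h₁ * ‖u‖ ^ 2 ≤ fderiv ℝ (fderiv ℝ f) z u u) (x y : V) :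
    h₁ * ‖x - y‖ ^ 2 ≤ (fderiv ℝ f x - fderiv ℝ f y) (x - y) := by
  set d := x - y with hd
  have hf' : Differentiable ℝ (fderiv ℝ f) :=
    (hf.fderiv_right (m := ∞) (by simp)).differentiable (by simp)
  set φ : ℝ → ℝ := fun s => fderiv ℝ f (y + s • d) d - s * (h₁ * ‖d‖ ^ 2) with hφ
  have hder : ∀ s, HasDerivAt φ (fderiv ℝ (fderiv ℝ f) (y + s • d) d d - h₁ * ‖d‖ ^ 2) s := by
    intro s
    have h1 : HasDerivAt (fun s : ℝ => y + s • d) d s := by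
      simpa using ((hasDerivAt_id s).smul_const d).const_add y
    have h2 := (hf' (y + s • d)).hasFDerivAt.comp_hasDerivAt s h1
    have h3 := h2.clm_apply (hasDerivAt_const s d)
    refine (h3.sub ((hasDerivAt_id s).mul_const (h₁ * ‖d‖ ^ 2))).congr_deriv ?_
    simp
  have hmono : Monotone φ := monotone_of_deriv_nonneg (fun s => (hder s).differentiableAt)
    fun s => by rw [(hder s).deriv]; have := h (y + s • d) d; linarith
  have := hmono zero_le_one
  simp only [hφ, zero_smul, add_zero, one_smul, zero_mul, sub_zero, one_mul] at this
  rw [show y + d = x by rw [hd]; abel] at this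
  rw [sub_apply]
  linarith

theorem fderiv_lipschitz {f : V → ℝ} {h₂ : ℝ} (hf : ContDiff ℝ ∞ f) (hh : 0 ≤ h₂)
    (h0 : ∀ z u, 0 ≤ fderiv ℝ (fderiv ℝ f) z u u)
    (h : ∀ z u, fderiv ℝ (fderiv ℝ f) z u u ≤ h₂ * ‖u‖ ^ 2) (x y : V) :
    ‖fderiv ℝ f x - fderiv ℝ f y‖ ≤ h₂ * ‖x - y‖ := by
  have hf' : Differentiable ℝ (fderiv ℝ f) :=
    (hf.fderiv_right (m := ∞) (by simp)).differentiable (by simp)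
  refine (convex_univ).norm_image_sub_le_of_norm_fderiv_le (𝕜 := ℝ) (fun z _ => hf' z)
    (fun z _ => ?_) (mem_univ y) (mem_univ x)
  refine norm_le_of_bilin_le hh (fun u v => ?_) (h0 z) (h z)
  exact (hf.contDiffAt.isSymmSndFDerivAt (by
    rw [minSmoothness_of_isRCLikeNormedField]; exact (WithTop.coe_le_coe (α := ℕ∞)).2 le_top)).eq u v

end Legendre

variable {n : ℕ} {H : ℝ → PhaseSpace n → ℝ}

/-- A smooth Hamiltonian as a periodic map. -/
def IsSmoothHamiltonian.periodicMap (hH : IsSmoothHamiltonian H) :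
    PeriodicMap (PhaseSpace n) ℝ := ⟨H, hH.1, hH.2⟩

/-- The gradient of a smooth Hamiltonian as a periodic map. -/
def IsSmoothHamiltonian.gradMap (hH : IsSmoothHamiltonian H) :
    PeriodicMap (PhaseSpace n) (PhaseSpace n) where
  toFun t z := gradient (H t) z
  contDiff := ((InnerProductSpace.toDual ℝ (PhaseSpace n)).symm.toContinuousLinearEquiv
    |>.contDiff).comp hH.periodicMap.deriv₂.contDiff
  periodic t z := by rw [show H (t + 1) = H t from funext (hH.2 t)]

theorem inner_gradient (f : PhaseSpace n → ℝ) (z u : PhaseSpace n) :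
    inner ℝ (gradient f z) u = fderiv ℝ f z u := by
  rw [gradient, InnerProductSpace.toDual_symm_apply]

theorem norm_gradient_sub (f : PhaseSpace n → ℝ) (x y : PhaseSpace n) :
    ‖gradient f x - gradient f y‖ = ‖fderiv ℝ f x - fderiv ℝ f y‖ := by
  rw [gradient, gradient, ← map_sub, LinearIsometryEquiv.norm_map]

/-- Inverting the map `(t, z) ↦ (t, G_t z)` gives smoothness jointly in time and space. It must
first be a homeomorphism, which the uniform expansion bound `hlow` provides. -/
theorem exists_smooth_inverse (G : PeriodicMap (PhaseSpace n) (PhaseSpace n)) {h₁ : ℝ}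
    (h₁pos : 0 < h₁) (hbij : ∀ t, Function.Bijective (G.toFun t))
    (hlow : ∀ t x y, h₁ * ‖x - y‖ ≤ ‖G.toFun t x - G.toFun t y‖)
    (hder : ∀ t z u, h₁ * ‖u‖ ^ 2 ≤ inner ℝ (fderiv ℝ (G.toFun t) z u) u) :
    ∃ g : PeriodicMap (PhaseSpace n) (PhaseSpace n),
      (∀ t x, G.toFun t (g.toFun t x) = x) ∧ ∀ t z, g.toFun t (G.toFun t z) = z := by
  set e : ∀ t, PhaseSpace n ≃ PhaseSpace n := fun t => Equiv.ofBijective _ (hbij t) with he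
  set g : ℝ → PhaseSpace n → PhaseSpace n := fun t x => (e t).symm x with hg
  have hGg : ∀ t x, G.toFun t (g t x) = x := fun t x => (e t).apply_symm_apply x
  have hgG : ∀ t z, g t (G.toFun t z) = z := fun t z => (e t).symm_apply_apply z
  have hcont : Continuous (fun p : ℝ × PhaseSpace n => g p.1 p.2) := by
    rw [continuous_iff_continuousAt]
    rintro ⟨s, y⟩
    rw [ContinuousAt, tendsto_iff_norm_sub_tendsto_zero]
    have hc : Continuous (fun p : ℝ × PhaseSpace n => h₁⁻¹ * ‖p.2 - G.toFun p.1 (g s y)‖) := by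
      have : Continuous (fun p : ℝ × PhaseSpace n => G.toFun p.1 (g s y)) :=
        G.contDiff.continuous.comp (continuous_fst.prodMk continuous_const)
      fun_prop
    have hlim := hc.tendsto (s, y)
    simp only [hGg, sub_self, norm_zero, mul_zero] at hlim
    refine squeeze_zero (fun _ => norm_nonneg _) (fun p => ?_) hlim
    have := hlow p.1 (g p.1 p.2) (g s y)
    rw [hGg] at this
    rw [← div_eq_inv_mul, le_div_iff₀ h₁pos]
    linarith
  let Θ : (ℝ × PhaseSpace n) ≃ₜ (ℝ × PhaseSpace n) :=
    { toFun := fun p => (p.1, G.toFun p.1 p.2)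
      invFun := fun p => (p.1, g p.1 p.2)
      left_inv := fun p => by simp [hgG]
      right_inv := fun p => by simp [hGg]
      continuous_toFun := continuous_fst.prodMk G.contDiff.continuous
      continuous_invFun := continuous_fst.prodMk hcont }
  have hΘ : ContDiff ℝ ∞ (Θ : ℝ × PhaseSpace n → ℝ × PhaseSpace n) :=
    contDiff_fst.prodMk G.contDiff
  have hD : ∀ p : ℝ × PhaseSpace n, HasFDerivAt Θ ((ContinuousLinearMap.fst ℝ ℝ _).prod
      (fderiv ℝ (fun p : ℝ × PhaseSpace n => G.toFun p.1 p.2) p)) p := fun p =>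
    hasFDerivAt_fst.prodMk (G.contDiff.differentiable (by simp) p).hasFDerivAt
  -- The differential is block triangular with the identity in the time slot, so only the space
  -- block has to be injective; finite dimension then makes it invertible.
  have hinj : ∀ p : ℝ × PhaseSpace n, Function.Injective ((ContinuousLinearMap.fst ℝ ℝ _).prod
      (fderiv ℝ (fun p : ℝ × PhaseSpace n => G.toFun p.1 p.2) p)) := by
    rintro ⟨t, z⟩
    rw [injective_iff_map_eq_zero]
    rintro ⟨τ, u⟩ h
    simp only [ContinuousLinearMap.prod_apply, ContinuousLinearMap.coe_fst', Prod.mk_eq_zero] at h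
    obtain ⟨rfl, h⟩ := h
    have h1 : HasFDerivAt (fun z : PhaseSpace n => (t, z))
        (ContinuousLinearMap.inr ℝ ℝ (PhaseSpace n)) z := hasFDerivAt_prodMk_right t z
    have h2 := ((G.contDiff.differentiable (by simp) (t, z)).hasFDerivAt.comp z h1).unique
      (G.hasFDerivAt t z)
    have h3 : fderiv ℝ (G.toFun t) z u = 0 := by
      rw [← h2]; simpa using h
    have h4 := hder t z u
    rw [h3, inner_zero_left] at h4
    have : ‖u‖ ^ 2 ≤ 0 := by nlinarith
    have hu : u = 0 := by
      rw [← norm_eq_zero]; exact pow_eq_zero_iff two_ne_zero |>.1 (le_antisymm this (sq_nonneg _))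
    rw [hu]; rfl
  have hsm : ContDiff ℝ ∞ (Θ.symm : ℝ × PhaseSpace n → ℝ × PhaseSpace n) :=
    Θ.contDiff_symm (f₀' := fun p =>
      (LinearEquiv.ofInjectiveEndo _ (hinj p)).toContinuousLinearEquiv)
      (fun p => (hD p).congr_fderiv (by ext <;> rfl)) hΘ
  refine ⟨⟨g, contDiff_snd.comp hsm, fun t z => ?_⟩, hGg, hgG⟩
  refine (hbij t).1 ?_
  rw [hGg, ← G.periodic, hGg]

/-- Everything comes from the inverse `g_t` of `∇H_t`: the maximum in the Fenchel conjugate is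
attained at `g_t(x)`, and `g_t` is the gradient of the conjugate. -/
theorem IsSmoothHamiltonian.exists_legendrePair (hH : IsSmoothHamiltonian H)
    (hconv : IsQuadraticallyConvex H) : Nonempty (LegendrePair H) := by
  obtain ⟨h₁, h₂, h₁pos, h₂pos, hhess⟩ := hconv
  have hs : ∀ t, ContDiff ℝ ∞ (H t) := hH.periodicMap.contDiff_right
  have hlo : ∀ t z u, h₁ * ‖u‖ ^ 2 ≤ fderiv ℝ (fderiv ℝ (H t)) z u u := fun t z u => by
    have := (hhess t z u).1
    rwa [iteratedFDeriv_two_apply] at this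
  have hup : ∀ t z u, fderiv ℝ (fderiv ℝ (H t)) z u u ≤ h₂ * ‖u‖ ^ 2 := fun t z u => by
    have := (hhess t z u).2
    rwa [iteratedFDeriv_two_apply] at this
  have hmono := fun t => fderiv_stronglyMonotone (hs t) (hlo t)
  have hlip := fun t => fderiv_lipschitz (hs t) h₂pos.le
    (fun z u => (by positivity : 0 ≤ h₁ * ‖u‖ ^ 2).trans (hlo t z u)) (hup t)
  have hbij : ∀ t, Function.Bijective (hH.gradMap.toFun t) := fun t =>
    (InnerProductSpace.toDual ℝ (PhaseSpace n)).symm.bijective.comp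
      (bijective_of_stronglyMonotone h₁pos (hmono t) (hlip t))
  have hgmono : ∀ t x y, h₁ * ‖x - y‖ ^ 2 ≤
      inner ℝ (hH.gradMap.toFun t x - hH.gradMap.toFun t y) (x - y) := fun t x y => by
    have := hmono t x y
    rw [inner_sub_left]
    simp only [IsSmoothHamiltonian.gradMap, inner_gradient]
    simpa using this
  have hglip : ∀ t x y, ‖hH.gradMap.toFun t x - hH.gradMap.toFun t y‖ ≤ h₂ * ‖x - y‖ :=
    fun t x y => by
      simp only [IsSmoothHamiltonian.gradMap, norm_gradient_sub]
      exact hlip t x y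
  have hglow : ∀ t x y, h₁ * ‖x - y‖ ≤ ‖hH.gradMap.toFun t x - hH.gradMap.toFun t y‖ := by
    intro t x y
    have h1 := (hgmono t x y).trans (real_inner_le_norm _ _)
    rcases (norm_nonneg (x - y)).eq_or_lt with h0 | h0
    · rw [← h0, mul_zero]; exact norm_nonneg _
    · refine le_of_mul_le_mul_right ?_ h0
      linarith [h1]
  obtain ⟨g, hGg, -⟩ := exists_smooth_inverse hH.gradMap h₁pos hbij hglow (fun t z u => by
    have h1 := (hH.gradMap.hasFDerivAt t z).inner ℝ (hasFDerivAt_const u z)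
    have h2 : HasFDerivAt (fun z => inner ℝ (hH.gradMap.toFun t z) u)
        ((fderiv ℝ (fderiv ℝ (H t)) z).flip u) z := by
      have h3 := (((hs t).fderiv_right (m := ∞) (by simp)).differentiable (by simp)
        z).hasFDerivAt.clm_apply (hasFDerivAt_const u z)
      refine (h3.congr_fderiv (by ext; simp)).congr_of_eventuallyEq (.of_forall fun z => ?_)
      exact inner_gradient _ _ _
    have h4 := congrArg (fun A => A u) (h1.unique h2)
    simp only [ContinuousLinearMap.flip_apply] at h4
    refine (hlo t z u).trans_eq (h4.symm.trans ?_)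
    simp [fderivInnerCLM_apply])
  have hHder : ∀ t x, HasFDerivAt (H t) (innerSL ℝ (hH.gradMap.toFun t x)) x := fun t x =>
    (hH.periodicMap.hasFDerivAt t x).congr_fderiv (by
      ext u
      simp only [innerSL_apply_apply, IsSmoothHamiltonian.gradMap, inner_gradient]
      rfl)
  -- At `g_t(x)` the gradient of `H_t` is `x`, so convexity puts the graph of `H_t` above the affine
  -- function of slope `x` touching it there.
  have hfen : ∀ t x, fenchel H t x = inner ℝ x (g.toFun t x) - H t (g.toFun t x) := by
    intro t x
    have hle : ∀ y, inner ℝ x y - H t y ≤ inner ℝ x (g.toFun t x) - H t (g.toFun t x) := by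
      intro y
      have h := le_of_gradient_stronglyMonotone (hHder t) (hgmono t) (g.toFun t x)
        (y - g.toFun t x)
      rw [hGg, add_sub_cancel, inner_sub_right] at h
      have : 0 ≤ h₁ / 2 * ‖y - g.toFun t x‖ ^ 2 := by positivity
      linarith
    exact le_antisymm (ciSup_le hle) (le_ciSup (f := fun y => inner ℝ x y - H t y)
      ⟨_, by rintro _ ⟨y, rfl⟩; exact hle y⟩ (g.toFun t x))
  -- The terms containing the derivative of `g_t` cancel because `∇H_t(g_t(x)) = x`.
  have hKder : ∀ t x, HasFDerivAt (fun x => inner ℝ x (g.toFun t x) - H t (g.toFun t x))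
      (innerSL ℝ (g.toFun t x)) x := by
    intro t x
    have h1 := g.hasFDerivAt t x
    have h2 := (hasFDerivAt_id x).inner ℝ h1
    have h3 := (hHder t (g.toFun t x)).comp x h1
    refine (h2.sub h3).congr_fderiv ?_
    ext u
    simp [hGg, real_inner_comm]
  -- The value `h₁ / h₂²` of `lo` comes from strong monotonicity of `∇H_t` between `g_t(x)` and
  -- `g_t(y)`, combined with `|x - y| ≤ h₂ |g_t(x) - g_t(y)|`. It is not optimal, but only its
  -- positivity matters.
  refine ⟨{ grad := hH.gradMap, grad_eq := fun _ _ => rfl, dual := g, grad_dual := hGg,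
            conj := ⟨fun t x => inner ℝ x (g.toFun t x) - H t (g.toFun t x), ?_, ?_⟩,
            conj_eq := fun t x => (hfen t x).symm, lo := h₁ / h₂ ^ 2, up := h₁⁻¹, upGrad := h₂,
            lo_pos := by positivity, up_pos := by positivity, upGrad_pos := h₂pos,
            hasFDerivAt_conj := hKder, mono := ?_, lip := ?_, lip_grad := hglip }⟩
  · exact (contDiff_snd.inner ℝ g.contDiff).sub
      (hH.1.comp (contDiff_fst.prodMk g.contDiff))
  · intro t z
    rw [g.periodic, hH.2]
  · intro t x y
    have h1 := hgmono t (g.toFun t x) (g.toFun t y)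
    have h2 := hglip t (g.toFun t x) (g.toFun t y)
    rw [hGg, hGg] at h1 h2
    rw [real_inner_comm] at h1
    refine le_trans ?_ h1
    have h3 : ‖x - y‖ ^ 2 ≤ h₂ ^ 2 * ‖g.toFun t x - g.toFun t y‖ ^ 2 := by
      rw [← mul_pow]; exact pow_le_pow_left₀ (norm_nonneg _) h2 2
    rw [div_mul_eq_mul_div, div_le_iff₀ (by positivity)]
    nlinarith
  · intro t x y
    have h1 := hglow t (g.toFun t x) (g.toFun t y)
    rw [hGg, hGg] at h1
    rw [← div_eq_inv_mul, le_div_iff₀ h₁pos]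
    linarith

/-! ### The complex structure -/

section ComplexStructure

variable {n : ℕ}

@[simp]
theorem J0_J0 (z : PhaseSpace n) : J0 n (J0 n z) = -z := by
  ext i
  cases i <;> simp [J0]

theorem inner_J0_left (u w : PhaseSpace n) : inner ℝ (J0 n u) w = -inner ℝ u (J0 n w) := by
  simp [J0, PiLp.inner_apply, Fintype.sum_sum_type]

theorem inner_J0_J0 (u w : PhaseSpace n) : inner ℝ (J0 n u) (J0 n w) = inner ℝ u w := by
  rw [inner_J0_left, J0_J0, inner_neg_right, neg_neg]

theorem norm_J0 (z : PhaseSpace n) : ‖J0 n z‖ = ‖z‖ := by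
  rw [@norm_eq_sqrt_real_inner _ _ _ (J0 n z), inner_J0_J0, ← norm_eq_sqrt_real_inner]

theorem expJ0_apply (θ : ℝ) (z : PhaseSpace n) :
    expJ0 n θ z = Real.cos θ • z + Real.sin θ • J0 n z := rfl

theorem expJ0_J0 (θ : ℝ) (z : PhaseSpace n) : expJ0 n θ (J0 n z) = J0 n (expJ0 n θ z) := by
  simp [expJ0_apply]

@[simp]
theorem expJ0_zero (z : PhaseSpace n) : expJ0 n 0 z = z := by simp [expJ0_apply]

theorem expJ0_add (θ η : ℝ) (z : PhaseSpace n) :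
    expJ0 n (θ + η) z = expJ0 n θ (expJ0 n η z) := by
  simp only [expJ0_apply, Real.cos_add, Real.sin_add, map_add, map_smul, J0_J0]
  module

theorem inner_expJ0_left (θ : ℝ) (u w : PhaseSpace n) :
    inner ℝ (expJ0 n θ u) w = inner ℝ u (expJ0 n (-θ) w) := by
  simp only [expJ0_apply, Real.cos_neg, Real.sin_neg, inner_add_left, inner_add_right,
    inner_smul_left, inner_smul_right, inner_J0_left]
  simp

theorem norm_expJ0 (θ : ℝ) (z : PhaseSpace n) : ‖expJ0 n θ z‖ = ‖z‖ := by
  rw [@norm_eq_sqrt_real_inner _ _ _ (expJ0 n θ z), inner_expJ0_left, ← expJ0_add,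
    neg_add_cancel, expJ0_zero, ← norm_eq_sqrt_real_inner]

theorem hasDerivAt_expJ0 (c : ℝ) (t : ℝ) (z : PhaseSpace n) :
    HasDerivAt (fun t => expJ0 n (c * t) z) (expJ0 n (c * t) (c • J0 n z)) t := by
  have h0 : HasDerivAt (fun t : ℝ => c * t) c t := by
    simpa using (hasDerivAt_id t).const_mul c
  refine ((h0.cos.smul_const z).add (h0.sin.smul_const (J0 n z))).congr_deriv ?_
  simp only [expJ0_apply, map_smul, J0_J0]
  module

/-- The complex coordinate `q_j + i p_j`. -/
def complexCoord (j : Fin n) : PhaseSpace n →L[ℝ] ℂ :=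
  Complex.ofRealCLM.comp (EuclideanSpace.proj (Sum.inl j)) +
    Complex.I • Complex.ofRealCLM.comp (EuclideanSpace.proj (Sum.inr j))

theorem complexCoord_apply (j : Fin n) (z : PhaseSpace n) :
    complexCoord j z = (z (Sum.inl j) : ℂ) + Complex.I * (z (Sum.inr j) : ℂ) := rfl

theorem complexCoord_J0 (j : Fin n) (z : PhaseSpace n) :
    complexCoord j (J0 n z) = Complex.I * complexCoord j z := by
  simp only [complexCoord_apply, J0]
  simp
  ring_nf
  simp

theorem complexCoord_expJ0 (j : Fin n) (θ : ℝ) (z : PhaseSpace n) :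
    complexCoord j (expJ0 n θ z) = Complex.exp (θ * Complex.I) * complexCoord j z := by
  rw [expJ0_apply, map_add, map_smul, map_smul, complexCoord_J0, Complex.exp_mul_I]
  simp
  ring

theorem sum_norm_complexCoord (z : PhaseSpace n) : ∑ j, ‖complexCoord j z‖ ^ 2 = ‖z‖ ^ 2 := by
  rw [EuclideanSpace.norm_sq_eq, Fintype.sum_sum_type, ← Finset.sum_add_distrib]
  refine Finset.sum_congr rfl fun j _ => ?_
  rw [complexCoord_apply, ← Complex.normSq_eq_norm_sq, mul_comm, Complex.normSq_add_mul_I]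
  simp

end ComplexStructure

/-! ### Continuous loops and square integrable loops -/

section Loops

variable {n : ℕ}

theorem coe_volume_Ioc : (volume.restrict (Ioc (0 : ℝ) 1)) univ = 1 := by simp

instance : IsProbabilityMeasure (volume.restrict (Ioc (0 : ℝ) 1)) := ⟨coe_volume_Ioc⟩

theorem memLp_loop {F : Type*} [NormedAddCommGroup F] (f : C(UnitAddCircle, F)) :
    MemLp (fun t : ℝ => f (t : UnitAddCircle)) 2 (volume.restrict (Ioc (0 : ℝ) 1)) :=
  MemLp.of_bound (f.continuous.comp (AddCircle.continuous_mk' 1)).aestronglyMeasurable ‖f‖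
    (.of_forall fun _ => f.norm_coe_le_norm _)

/-- The inclusion of continuous loops into `L²`. -/
def loopToL2 : C(UnitAddCircle, PhaseSpace n) →L[ℝ] L2 n :=
  LinearMap.mkContinuous
    { toFun := fun f => (memLp_loop f).toLp _
      map_add' := fun _ _ => rfl
      map_smul' := fun _ _ => rfl } 1 fun f => by
    rw [one_mul]
    refine (Lp.norm_le_of_ae_bound (norm_nonneg f) (C := ‖f‖) ?_).trans ?_
    · filter_upwards [(memLp_loop f).coeFn_toLp] with t ht
      change ‖(memLp_loop f).toLp _ t‖ ≤ _
      rw [ht]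
      exact f.norm_coe_le_norm _
    · simp [measureUnivNNReal]

theorem coeFn_loopToL2 (f : C(UnitAddCircle, PhaseSpace n)) :
    loopToL2 f =ᵐ[volume.restrict (Ioc (0 : ℝ) 1)] fun t => f (t : UnitAddCircle) :=
  (memLp_loop f).coeFn_toLp

theorem loop_ext {F : Type*} {f g : UnitAddCircle → F}
    (h : ∀ t ∈ Ioc (0 : ℝ) 1, f t = g t) : f = g := by
  funext θ
  obtain ⟨t, rfl⟩ := QuotientAddGroup.mk_surjective θ
  have hper : Function.Periodic (fun t : ℝ => (t : UnitAddCircle)) 1 := fun t => by simp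
  obtain ⟨s, hs, hst⟩ := hper.exists_mem_Ioc one_pos t 0
  rw [zero_add] at hs
  have := h s hs
  rw [← hst] at this
  exact this

theorem loopToL2_injective : Function.Injective (loopToL2 (n := n)) := by
  intro f g hfg
  have h : (fun t : ℝ => f (t : UnitAddCircle)) =ᵐ[volume.restrict (Ioc (0 : ℝ) 1)]
      fun t => g (t : UnitAddCircle) := by
    refine (coeFn_loopToL2 f).symm.trans ?_
    rw [hfg]
    exact coeFn_loopToL2 g
  have h2 := Measure.eqOn_Ioc_of_ae_eq volume h
    (f.continuous.comp (AddCircle.continuous_mk' 1)).continuousOn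
    (g.continuous.comp (AddCircle.continuous_mk' 1)).continuousOn
  exact DFunLike.coe_injective (loop_ext fun t ht => h2 ht)

/-- The complex structure on `L²`. -/
def J2 : L2 n →L[ℝ] L2 n := (J0 n).compLpL 2 _

theorem coeFn_J2 (v : L2 n) :
    J2 v =ᵐ[volume.restrict (Ioc (0 : ℝ) 1)] fun t => J0 n (v t) :=
  (J0 n).coeFn_compLpL v

theorem inner_L2 (v w : L2 n) : inner ℝ v w = ∫ t in (0 : ℝ)..1, inner ℝ (v t) (w t) := by
  rw [MeasureTheory.L2.inner_def, intervalIntegral.integral_of_le zero_le_one]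

theorem L2.norm_sq (v : L2 n) : ‖v‖ ^ 2 = ∫ t in (0 : ℝ)..1, ‖v t‖ ^ 2 := by
  rw [← real_inner_self_eq_norm_sq, inner_L2]
  simp_rw [real_inner_self_eq_norm_sq]

@[simp]
theorem J2_J2 (v : L2 n) : J2 (J2 v) = -v := by
  ext1
  filter_upwards [coeFn_J2 (J2 v), coeFn_J2 v, Lp.coeFn_neg v] with t h1 h2 h3
  rw [h1, h2, h3, J0_J0]
  rfl

theorem inner_J2_left (v w : L2 n) : inner ℝ (J2 v) w = -inner ℝ v (J2 w) := by
  rw [MeasureTheory.L2.inner_def, MeasureTheory.L2.inner_def, ← integral_neg]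
  refine integral_congr_ae ?_
  filter_upwards [coeFn_J2 v, coeFn_J2 w] with t h1 h2
  rw [h1, h2, inner_J0_left]

theorem inner_J2_J2 (v w : L2 n) : inner ℝ (J2 v) (J2 w) = inner ℝ v w := by
  rw [inner_J2_left, J2_J2, inner_neg_right, neg_neg]

theorem norm_J2 (v : L2 n) : ‖J2 v‖ = ‖v‖ := by
  rw [@norm_eq_sqrt_real_inner _ _ _ (J2 v), inner_J2_J2, ← norm_eq_sqrt_real_inner]

theorem J2_loopToL2 (f : C(UnitAddCircle, PhaseSpace n)) :
    J2 (loopToL2 f) = loopToL2 ((J0 n).compLeftContinuous ℝ UnitAddCircle f) := by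
  ext1
  filter_upwards [coeFn_J2 (loopToL2 f), coeFn_loopToL2 f, coeFn_loopToL2
    ((J0 n).compLeftContinuous ℝ UnitAddCircle f)] with t h1 h2 h3
  rw [h1, h2, h3]
  rfl

/-! ### Fourier modes -/

/-- The Fourier mode `t ↦ e^{-2πkJ₀t} c` as a periodic map, linear in `c`. -/
def modeMap (k : ℤ) : PeriodicMap (PhaseSpace n) (PhaseSpace n) where
  toFun t z := expJ0 n (-(2 * Real.pi * k * t)) z
  contDiff := by
    simp only [expJ0_apply]
    fun_prop
  periodic t z := by
    have : -(2 * Real.pi * k * (t + 1)) = -(2 * Real.pi * k * t) - k * (2 * Real.pi) := by ring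
    simp only [expJ0_apply]
    rw [this, Real.cos_sub_int_mul_two_pi, Real.sin_sub_int_mul_two_pi]

/-- The Fourier mode `t ↦ e^{-2πkJ₀t} c`. -/
def modeLoop (k : ℤ) : PhaseSpace n →L[ℝ] C(UnitAddCircle, PhaseSpace n) :=
  LinearMap.toContinuousLinearMap
    { toFun := fun c => (modeMap k).superposition (ContinuousMap.const _ c)
      map_add' := fun c d => by
        ext1 θ
        obtain ⟨t, rfl⟩ := QuotientAddGroup.mk_surjective θ
        exact map_add (expJ0 n (-(2 * Real.pi * k * t))) c d
      map_smul' := fun r c => by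
        ext1 θ
        obtain ⟨t, rfl⟩ := QuotientAddGroup.mk_surjective θ
        exact map_smul (expJ0 n (-(2 * Real.pi * k * t))) r c }

theorem modeLoop_coe (k : ℤ) (c : PhaseSpace n) (t : ℝ) :
    modeLoop k c (t : UnitAddCircle) = expJ0 n (-(2 * Real.pi * k * t)) c := rfl

/-- The Fourier mode `t ↦ e^{-2πkJ₀t} c` in `L²`. -/
def mode (k : ℤ) : PhaseSpace n →L[ℝ] L2 n := loopToL2.comp (modeLoop k)

theorem coeFn_mode (k : ℤ) (c : PhaseSpace n) :
    mode k c =ᵐ[volume.restrict (Ioc (0 : ℝ) 1)]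
      fun t => expJ0 n (-(2 * Real.pi * k * t)) c :=
  coeFn_loopToL2 _

/-- The Fourier coefficient `v̂_k` of a square integrable loop. -/
def coef (k : ℤ) : L2 n →L[ℝ] PhaseSpace n := ContinuousLinearMap.adjoint (mode k)

theorem inner_coef_left (k : ℤ) (v : L2 n) (c : PhaseSpace n) :
    inner ℝ (coef k v) c = inner ℝ v (mode k c) :=
  ContinuousLinearMap.adjoint_inner_left _ _ _

theorem inner_mode_left (k : ℤ) (v : L2 n) (c : PhaseSpace n) :
    inner ℝ (mode k c) v = inner ℝ c (coef k v) := by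
  rw [real_inner_comm, ← inner_coef_left, real_inner_comm]

theorem J2_mode (k : ℤ) (c : PhaseSpace n) : J2 (mode k c) = mode k (J0 n c) := by
  ext1
  filter_upwards [coeFn_J2 (mode k c), coeFn_mode k c, coeFn_mode k (J0 n c)] with t h1 h2 h3
  rw [h1, h2, h3, expJ0_J0]

theorem coef_J2 (k : ℤ) (v : L2 n) : coef k (J2 v) = J0 n (coef k v) := by
  refine ext_inner_right ℝ fun c => ?_
  rw [inner_coef_left, inner_J2_left, J2_mode, ← inner_coef_left, inner_J0_left]

theorem integrable_expJ0 (k : ℤ) (v : L2 n) :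
    Integrable (fun t : ℝ => expJ0 n (2 * Real.pi * k * t) (v t))
      (volume.restrict (Ioc (0 : ℝ) 1)) := by
  have hv := (Lp.memLp v).integrable (by norm_num : (1 : ENNReal) ≤ 2)
  refine hv.mono ?_ (.of_forall fun t => (norm_expJ0 _ _).le)
  have hJ : AEStronglyMeasurable (fun t => J0 n (v t)) (volume.restrict (Ioc (0 : ℝ) 1)) :=
    (J0 n).continuous.comp_aestronglyMeasurable hv.1
  have c1 : Continuous fun t : ℝ => Real.cos (2 * Real.pi * k * t) := by fun_prop
  have c2 : Continuous fun t : ℝ => Real.sin (2 * Real.pi * k * t) := by fun_prop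
  exact (c1.aestronglyMeasurable.smul hv.1).add (c2.aestronglyMeasurable.smul hJ)

theorem coef_eq_integral (k : ℤ) (v : L2 n) :
    coef k v = ∫ t in (0 : ℝ)..1, expJ0 n (2 * Real.pi * k * t) (v t) := by
  refine ext_inner_left ℝ fun c => ?_
  rw [intervalIntegral.integral_of_le zero_le_one, ← integral_inner (integrable_expJ0 k v),
    real_inner_comm, inner_coef_left, real_inner_comm, MeasureTheory.L2.inner_def]
  refine integral_congr_ae ?_
  filter_upwards [coeFn_mode k c] with t h1
  rw [h1, inner_expJ0_left, neg_neg]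

theorem coef_zero_eq_integral (v : L2 n) : coef 0 v = ∫ t in (0 : ℝ)..1, v t := by
  simp [coef_eq_integral]

theorem coef_mode_self (k : ℤ) (c : PhaseSpace n) : coef k (mode k c) = c := by
  rw [coef_eq_integral, intervalIntegral.integral_of_le zero_le_one]
  have : ∀ᵐ t ∂(volume.restrict (Ioc (0 : ℝ) 1)),
      expJ0 n (2 * Real.pi * k * t) (mode k c t) = c := by
    filter_upwards [coeFn_mode k c] with t h
    rw [h, ← expJ0_add, add_neg_cancel, expJ0_zero]
  rw [integral_congr_ae this]
  simp

theorem coef_mode_of_ne {j k : ℤ} (hjk : j ≠ k) (c : PhaseSpace n) : coef j (mode k c) = 0 := by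
  have hm : (2 * Real.pi * ((j : ℝ) - k)) ≠ 0 := by
    have : (j : ℝ) - k ≠ 0 := sub_ne_zero.2 (by exact_mod_cast hjk)
    have := Real.pi_ne_zero
    positivity
  have h1 : coef j (mode k c) =
      ∫ t in (0 : ℝ)..1, expJ0 n ((2 * Real.pi * ((j : ℝ) - k)) * t) c := by
    rw [coef_eq_integral, intervalIntegral.integral_of_le zero_le_one,
      intervalIntegral.integral_of_le zero_le_one]
    refine integral_congr_ae ?_
    filter_upwards [coeFn_mode k c] with t h
    rw [h, ← expJ0_add]
    congr 2
    ring
  -- An explicit primitive, which is `1`-periodic because its frequency is an integer multiple of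
  -- `2π`.
  have h2 : ∀ t ∈ uIcc (0 : ℝ) 1, HasDerivAt
      (fun t => (2 * Real.pi * ((j : ℝ) - k))⁻¹ •
        expJ0 n ((2 * Real.pi * ((j : ℝ) - k)) * t) (-J0 n c))
      (expJ0 n ((2 * Real.pi * ((j : ℝ) - k)) * t) c) t := fun t _ => by
    refine ((hasDerivAt_expJ0 _ t (-J0 n c)).const_smul
      (2 * Real.pi * ((j : ℝ) - k))⁻¹).congr_deriv ?_
    rw [map_smul, smul_smul, inv_mul_cancel₀ hm, one_smul, map_neg, J0_J0, neg_neg]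
  rw [h1, intervalIntegral.integral_eq_sub_of_hasDerivAt h2]
  · have e : 2 * Real.pi * ((j : ℝ) - k) * 1 = 0 + ((j - k : ℤ) : ℝ) * (2 * Real.pi) := by
      push_cast; ring
    rw [mul_zero, e]
    simp only [expJ0_apply]
    rw [Real.cos_add_int_mul_two_pi, Real.sin_add_int_mul_two_pi, sub_self]
  · refine Continuous.intervalIntegrable ?_ 0 1
    simp only [expJ0_apply]
    fun_prop

theorem coef_mode (j k : ℤ) (c : PhaseSpace n) :
    coef j (mode k c) = if j = k then c else 0 := by
  split_ifs with h
  · rw [h, coef_mode_self]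
  · exact coef_mode_of_ne h c

/-- In the coordinates `q_j + i p_j` the matrix `J₀` is multiplication by `i`, so vector
coefficients become scalar ones. The index changes sign because the modes are `e^{-2πkJ₀t}`. -/
theorem complexCoord_coef (k : ℤ) (v : L2 n) (j : Fin n) :
    complexCoord j (coef k v) =
      fourierCoeffOn zero_lt_one (fun t => complexCoord j (v t)) (-k) := by
  rw [fourierCoeffOn_eq_integral, coef_eq_integral, intervalIntegral.integral_of_le zero_le_one,
    intervalIntegral.integral_of_le zero_le_one,
    ← ContinuousLinearMap.integral_comp_comm _ (integrable_expJ0 k v)]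
  simp only [sub_zero, div_one, one_smul, neg_neg]
  congr 1
  funext t
  rw [complexCoord_expJ0, fourier_coe_apply, smul_eq_mul]
  congr 2
  push_cast
  ring

/-- Parseval's identity. -/
theorem hasSum_norm_coef (v : L2 n) : HasSum (fun k : ℤ => ‖coef k v‖ ^ 2) (‖v‖ ^ 2) := by
  have hv := Lp.memLp v
  have h : ∀ j : Fin n, HasSum (fun k : ℤ => ‖complexCoord j (coef k v)‖ ^ 2)
      (∫ t in (0 : ℝ)..1, ‖complexCoord j (v t)‖ ^ 2) := by
    intro j
    have h1 := hasSum_sq_fourierCoeffOn zero_lt_one ((complexCoord j).comp_memLp' hv)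
    rw [sub_zero, inv_one, one_smul] at h1
    have h2 := (Equiv.neg ℤ).hasSum_iff.2 h1
    convert h2 using 2 with k
    · rw [complexCoord_coef]
      rfl
    · rfl
  have h3 := hasSum_sum (s := Finset.univ) fun j _ => h j
  simp only [sum_norm_complexCoord] at h3
  convert h3 using 1
  rw [L2.norm_sq, intervalIntegral.integral_of_le zero_le_one]
  simp only [intervalIntegral.integral_of_le zero_le_one]
  rw [← integral_finsetSum]
  · simp only [sum_norm_complexCoord]
  · intro j _
    exact ((complexCoord j).comp_memLp' hv).integrable_norm_pow two_ne_zero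

/-- The form in which Parseval's identity is used: it gives both the uniqueness of Fourier
coefficients and the Poincaré inequality. -/
theorem norm_le_of_norm_coef_le {v w : L2 n} (h : ∀ k, ‖coef k v‖ ≤ ‖coef k w‖) :
    ‖v‖ ≤ ‖w‖ := by
  have := hasSum_le (fun k => pow_le_pow_left₀ (norm_nonneg _) (h k) 2) (hasSum_norm_coef v)
    (hasSum_norm_coef w)
  exact le_of_sq_le_sq this (norm_nonneg _)

end Loops

/-! ### The Hilbert space `ℍ₁` -/

section Sobolev

variable {n : ℕ}

/-- The derivative as an isometry of `ℍ₁` into `L²`. -/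
def velL : H1 n →ₗᵢ[ℝ] L2 n where
  toLinearMap := H1.vel
  norm_map' _ := rfl

theorem inner_H1 (x y : H1 n) : inner ℝ x y = inner ℝ (velL x) (velL y) := rfl

theorem L2.norm_integral_le (v : L2 n) {t : ℝ} (ht : t ∈ Icc (0 : ℝ) 1) :
    ‖∫ s in (0 : ℝ)..t, v s‖ ≤ ‖v‖ := by
  have h1 : Integrable (fun t => v t) (volume.restrict (Ioc (0 : ℝ) 1)) :=
    (Lp.memLp v).integrable (by norm_num)
  have h2 : ‖∫ s in (0 : ℝ)..t, v s‖ ≤ ∫ s in Ioc (0 : ℝ) 1, ‖v s‖ := by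
    rw [intervalIntegral.integral_of_le ht.1]
    refine (norm_integral_le_integral_norm _).trans ?_
    exact setIntegral_mono_set h1.norm (.of_forall fun _ => norm_nonneg _)
      (Ioc_subset_Ioc_right ht.2).eventuallyLE
  refine h2.trans ?_
  rw [integral_norm_eq_lintegral_enorm h1.1, Lp.norm_def]
  refine ENNReal.toReal_mono (Lp.eLpNorm_ne_top v) ?_
  rw [← eLpNorm_one_eq_lintegral_enorm]
  exact eLpNorm_le_eLpNorm_of_exponent_le (by norm_num) h1.1

theorem H1.curve_one (x : H1 n) : x.curve 1 = x.curve 0 := by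
  have := x.isLoopWithVelocity.1 0
  rwa [zero_add] at this

theorem H1.curve_eq (x : H1 n) {t : ℝ} (ht : t ∈ Icc (0 : ℝ) 1) :
    x.curve t = x.curve 0 + ∫ s in (0 : ℝ)..t, velL x s :=
  x.isLoopWithVelocity.2 t ht

theorem coef_zero_velL (x : H1 n) : coef 0 (velL x) = 0 := by
  have h := x.curve_eq (right_mem_Icc.2 zero_le_one)
  rw [H1.curve_one, ← coef_zero_eq_integral] at h
  exact left_eq_add.1 h

theorem H1.continuousOn_curve (x : H1 n) : ContinuousOn x.curve (Icc 0 1) := by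
  have h := (continuousOn_const (c := x.curve 0)).add
    (intervalIntegral.continuousOn_primitive_interval' (velL x).intervalIntegrable left_mem_uIcc)
  rw [uIcc_of_le zero_le_one] at h
  exact h.congr fun t ht => x.curve_eq ht

theorem periodic_apply_Ico {F : Type*} {f : ℝ → F} (hf : Function.Periodic f 1) {P : F → Prop}
    (h : ∀ t ∈ Icc (0 : ℝ) 1, P (f t)) (t : ℝ) : P (f t) := by
  obtain ⟨s, hs, hst⟩ := hf.exists_mem_Ico₀ one_pos t
  rw [hst]
  exact h s ⟨hs.1, hs.2.le⟩

/-- Zero mean makes `x(0)` minus the mean of the primitive of `x'`, so it is at most `‖x‖`; moving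
from `0` to `t` adds at most another `‖x‖`. -/
theorem H1.norm_curve_le (x : H1 n) (t : ℝ) : ‖x.curve t‖ ≤ 2 * ‖x‖ := by
  have h0 : ‖x.curve 0‖ ≤ ‖x‖ := by
    have hc : IntervalIntegrable (fun t => ∫ s in (0 : ℝ)..t, velL x s) volume 0 1 :=
      (intervalIntegral.continuousOn_primitive_interval' (velL x).intervalIntegrable
        left_mem_uIcc).intervalIntegrable
    have hm := x.mean_eq_zero
    have e : ∫ t in (0 : ℝ)..1, x.curve t =
        ∫ t in (0 : ℝ)..1, (x.curve 0 + ∫ s in (0 : ℝ)..t, velL x s) := by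
      refine intervalIntegral.integral_congr fun t ht => ?_
      rw [uIcc_of_le zero_le_one] at ht
      exact x.curve_eq ht
    rw [e, intervalIntegral.integral_add (by simp) hc] at hm
    simp only [intervalIntegral.integral_const, sub_zero, one_smul] at hm
    rw [eq_neg_of_add_eq_zero_left hm, norm_neg]
    have := intervalIntegral.norm_integral_le_of_norm_le_const (C := ‖x‖) (a := 0) (b := 1)
      (f := fun t => ∫ s in (0 : ℝ)..t, velL x s) (fun t ht => by
        rw [uIoc_of_le zero_le_one] at ht
        exact L2.norm_integral_le _ ⟨ht.1.le, ht.2⟩)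
    simpa using this
  refine periodic_apply_Ico x.isLoopWithVelocity.1 (P := fun z => ‖z‖ ≤ 2 * ‖x‖) (fun t ht => ?_) t
  rw [x.curve_eq ht]
  have h1 : ‖∫ s in (0 : ℝ)..t, velL x s‖ ≤ ‖x‖ := L2.norm_integral_le _ ht
  linarith [norm_add_le (x.curve 0) (∫ s in (0 : ℝ)..t, velL x s)]

/-- The curve of an element of `ℍ₁` as a continuous loop. -/
def curveLoop (x : H1 n) : C(UnitAddCircle, PhaseSpace n) :=
  ⟨AddCircle.liftIco 1 0 x.curve, AddCircle.liftIco_continuous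
    (by rw [zero_add]; exact x.curve_one.symm) (by rw [zero_add]; exact x.continuousOn_curve)⟩

@[simp]
theorem curveLoop_coe (x : H1 n) (t : ℝ) : curveLoop x (t : UnitAddCircle) = x.curve t := by
  have hper : Function.Periodic (fun t : ℝ => (t : UnitAddCircle)) 1 := fun t => by simp
  have h : ∀ s ∈ Ico (0 : ℝ) 1, curveLoop x (s : UnitAddCircle) = x.curve s := fun s hs =>
    AddCircle.liftIco_coe_apply (by rwa [zero_add])
  have h2 : Function.Periodic (fun t : ℝ => (curveLoop x (t : UnitAddCircle), x.curve t)) 1 :=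
    fun t => Prod.ext (by simp) (x.isLoopWithVelocity.1 t)
  obtain ⟨s, hs, hst⟩ := h2.exists_mem_Ico₀ one_pos t
  simp only [Prod.mk.injEq] at hst
  rw [hst.1, hst.2, h s hs]

theorem H1.continuous_curve (x : H1 n) : Continuous x.curve := by
  have : x.curve = fun t : ℝ => curveLoop x (t : UnitAddCircle) := funext fun t => by simp
  rw [this]
  exact (curveLoop x).continuous.comp (AddCircle.continuous_mk' 1)

/-- The inclusion of `ℍ₁` into the continuous loops. -/
def curveC : H1 n →L[ℝ] C(UnitAddCircle, PhaseSpace n) :=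
  LinearMap.mkContinuous
    { toFun := curveLoop
      map_add' := fun x y => by
        ext1 θ
        obtain ⟨t, rfl⟩ := QuotientAddGroup.mk_surjective θ
        change curveLoop (x + y) (t : UnitAddCircle) =
          curveLoop x (t : UnitAddCircle) + curveLoop y (t : UnitAddCircle)
        simp
      map_smul' := fun r x => by
        ext1 θ
        obtain ⟨t, rfl⟩ := QuotientAddGroup.mk_surjective θ
        change curveLoop (r • x) (t : UnitAddCircle) = r • curveLoop x (t : UnitAddCircle)
        simp } 2 fun x => (ContinuousMap.norm_le _ (by positivity)).2 fun θ => by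
      obtain ⟨t, rfl⟩ := QuotientAddGroup.mk_surjective θ
      change ‖curveLoop x (t : UnitAddCircle)‖ ≤ _
      rw [curveLoop_coe]
      exact x.norm_curve_le t

theorem curveC_coe (x : H1 n) (t : ℝ) : curveC x (t : UnitAddCircle) = x.curve t :=
  curveLoop_coe x t

/-- The inclusion of `ℍ₁` into `L²`. -/
def curveL : H1 n →L[ℝ] L2 n := loopToL2.comp curveC

theorem coeFn_curveL (x : H1 n) :
    curveL x =ᵐ[volume.restrict (Ioc (0 : ℝ) 1)] x.curve := by
  refine (coeFn_loopToL2 _).trans (.of_forall fun t => ?_)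
  exact curveC_coe x t

theorem H1.ext_velL {x y : H1 n} (h : velL x = velL y) : x = y := H1.vel_injective h

/-! ### Integration by parts -/

/-- Integration by parts for absolutely continuous functions; the boundary terms cancel since both
primitives return to their initial values. -/
theorem integral_mul_eq_neg_of_primitive {v w : ℝ → ℝ} {a b : ℝ}
    (hv : IntervalIntegrable v volume 0 1) (hw : IntervalIntegrable w volume 0 1)
    (hv0 : ∫ s in (0 : ℝ)..1, v s = 0) (hw0 : ∫ s in (0 : ℝ)..1, w s = 0) :
    ∫ t in (0 : ℝ)..1, v t * (b + ∫ s in (0 : ℝ)..t, w s) =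
      -∫ t in (0 : ℝ)..1, (a + ∫ s in (0 : ℝ)..t, v s) * w t := by
  have hac : ∀ {v : ℝ → ℝ} (c : ℝ), IntervalIntegrable v volume 0 1 →
      AbsolutelyContinuousOnInterval (fun t => c + ∫ s in (0 : ℝ)..t, v s) 0 1 := by
    intro v c hv
    have h1 := hv.absolutelyContinuousOnInterval_intervalIntegral (c := 0) (by simp)
    have h2 : AbsolutelyContinuousOnInterval (fun _ : ℝ => c) 0 1 :=
      (LipschitzWith.const c).lipschitzOnWith.absolutelyContinuousOnInterval
    exact h2.fun_add h1
  have hd : ∀ {v : ℝ → ℝ} (c : ℝ), IntervalIntegrable v volume 0 1 →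
      ∀ᵐ t, t ∈ uIoc (0 : ℝ) 1 → deriv (fun t => c + ∫ s in (0 : ℝ)..t, v s) t = v t := by
    intro v c hv
    filter_upwards [hv.ae_hasDerivAt_integral] with t ht hm
    exact ((ht (uIoc_subset_uIcc hm) 0 (by simp)).const_add c).deriv
  have h := (hac a hv).integral_mul_deriv_eq_deriv_mul (hac b hw)
  have e1 : ∫ t in (0 : ℝ)..1, (a + ∫ s in (0 : ℝ)..t, v s) *
      deriv (fun t => b + ∫ s in (0 : ℝ)..t, w s) t =
      ∫ t in (0 : ℝ)..1, (a + ∫ s in (0 : ℝ)..t, v s) * w t := by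
    refine intervalIntegral.integral_congr_ae ?_
    filter_upwards [hd b hw] with t ht hm
    rw [ht hm]
  have e2 : ∫ t in (0 : ℝ)..1, deriv (fun t => a + ∫ s in (0 : ℝ)..t, v s) t *
      (b + ∫ s in (0 : ℝ)..t, w s) =
      ∫ t in (0 : ℝ)..1, v t * (b + ∫ s in (0 : ℝ)..t, w s) := by
    refine intervalIntegral.integral_congr_ae ?_
    filter_upwards [hd a hv] with t ht hm
    rw [ht hm]
  rw [e1, e2, hv0, hw0] at h
  simp only [intervalIntegral.integral_same, add_zero, sub_self, zero_sub] at h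
  rw [h, neg_neg]

theorem inner_velL_curveL (x y : H1 n) :
    inner ℝ (velL x) (curveL y) = -inner ℝ (curveL x) (velL y) := by
  have hcomp : ∀ (v : L2 n) (i : Fin n ⊕ Fin n),
      IntervalIntegrable (fun t => v t i) volume 0 1 := fun v i =>
    ⟨(EuclideanSpace.proj (𝕜 := ℝ) i).integrable_comp v.intervalIntegrable.1,
      (EuclideanSpace.proj (𝕜 := ℝ) i).integrable_comp v.intervalIntegrable.2⟩
  have hint : ∀ (v : L2 n) (i : Fin n ⊕ Fin n) {t : ℝ}, t ∈ Icc (0 : ℝ) 1 →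
      (∫ s in (0 : ℝ)..t, v s) i = ∫ s in (0 : ℝ)..t, v s i := fun v i t ht =>
    ((EuclideanSpace.proj (𝕜 := ℝ) i).intervalIntegral_comp_comm
      (v.intervalIntegrable.mono_set (by
        rw [uIcc_of_le ht.1, uIcc_of_le zero_le_one]
        exact Icc_subset_Icc_right ht.2))).symm
  have hzero : ∀ (z : H1 n) (i : Fin n ⊕ Fin n), ∫ s in (0 : ℝ)..1, velL z s i = 0 := fun z i => by
    rw [← hint _ _ (right_mem_Icc.2 zero_le_one), ← coef_zero_eq_integral, coef_zero_velL]
    rfl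
  have hcurve : ∀ (z : H1 n) (i : Fin n ⊕ Fin n) {t : ℝ}, t ∈ Icc (0 : ℝ) 1 →
      z.curve t i = z.curve 0 i + ∫ s in (0 : ℝ)..t, velL z s i := fun z i t ht => by
    rw [z.curve_eq ht, PiLp.add_apply, hint _ _ ht]
  have hccont : ∀ (z : H1 n) (i : Fin n ⊕ Fin n), Continuous fun t => z.curve t i := fun z i =>
    (EuclideanSpace.proj (𝕜 := ℝ) i).continuous.comp z.continuous_curve
  have e1 : inner ℝ (velL x) (curveL y) =
      ∑ i, ∫ t in (0 : ℝ)..1, velL x t i * y.curve t i := by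
    rw [← intervalIntegral.integral_finsetSum fun i _ =>
      (hcomp _ i).mul_continuousOn (hccont y i).continuousOn, inner_L2]
    simp only [intervalIntegral.integral_of_le zero_le_one]
    refine integral_congr_ae ?_
    filter_upwards [coeFn_curveL y] with t ht
    rw [ht, PiLp.inner_apply]
    refine Finset.sum_congr rfl fun i _ => ?_
    simp [mul_comm]
  have e2 : inner ℝ (curveL x) (velL y) =
      ∑ i, ∫ t in (0 : ℝ)..1, x.curve t i * velL y t i := by
    rw [← intervalIntegral.integral_finsetSum fun i _ =>
      (hcomp _ i).continuousOn_mul (hccont x i).continuousOn, inner_L2]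
    simp only [intervalIntegral.integral_of_le zero_le_one]
    refine integral_congr_ae ?_
    filter_upwards [coeFn_curveL x] with t ht
    rw [ht, PiLp.inner_apply]
    refine Finset.sum_congr rfl fun i _ => ?_
    simp [mul_comm]
  rw [e1, e2, ← Finset.sum_neg_distrib]
  refine Finset.sum_congr rfl fun i _ => ?_
  have h := integral_mul_eq_neg_of_primitive (a := x.curve 0 i) (b := y.curve 0 i)
    (hcomp (velL x) i) (hcomp (velL y) i) (hzero x i) (hzero y i)
  have c1 : ∫ t in (0 : ℝ)..1, velL x t i * y.curve t i =
      ∫ t in (0 : ℝ)..1, velL x t i * (y.curve 0 i + ∫ s in (0 : ℝ)..t, velL y s i) := by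
    refine intervalIntegral.integral_congr fun t ht => ?_
    rw [uIcc_of_le zero_le_one] at ht
    simp only
    rw [hcurve y i ht]
  have c2 : ∫ t in (0 : ℝ)..1, x.curve t i * velL y t i =
      ∫ t in (0 : ℝ)..1, (x.curve 0 i + ∫ s in (0 : ℝ)..t, velL x s i) * velL y t i := by
    refine intervalIntegral.integral_congr fun t ht => ?_
    rw [uIcc_of_le zero_le_one] at ht
    simp only
    rw [hcurve x i ht]
  rw [c1, c2, h]

/-! ### Primitives -/

theorem exists_velL_eq (v : L2 n) (hv : coef 0 v = 0) : ∃ x : H1 n, velL x = v := by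
  rw [coef_zero_eq_integral] at hv
  set p : ℝ → PhaseSpace n := fun t => ∫ s in (0 : ℝ)..t, v s with hp
  set c : PhaseSpace n := -∫ t in (0 : ℝ)..1, p t with hc
  -- The zero mean of `v` makes the primitive agree at `0` and `1`, so this periodic extension is
  -- still the primitive at the endpoint `t = 1`.
  set x : ℝ → PhaseSpace n := fun t => c + p (Int.fract t) with hx
  have hx1 : ∀ t ∈ Icc (0 : ℝ) 1, x t = c + p t := by
    intro t ht
    rcases ht.2.lt_or_eq with h | rfl
    · rw [hx]; simp only; rw [Int.fract_eq_self.2 ⟨ht.1, h⟩]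
    · simp only [hx, Int.fract_one, hp, hv, intervalIntegral.integral_same]
  have hpi : IntervalIntegrable p volume 0 1 :=
    (intervalIntegral.continuousOn_primitive_interval' v.intervalIntegrable
      left_mem_uIcc).intervalIntegrable
  have hloop : IsLoopWithVelocity x v := by
    refine ⟨fun t => by simp [hx, Int.fract_add_one], fun t ht => ?_⟩
    rw [hx1 t ht, hx1 0 (left_mem_Icc.2 zero_le_one)]
    simp [hp]
  have hmean : ∫ t in (0 : ℝ)..1, x t = 0 := by
    have : ∫ t in (0 : ℝ)..1, x t = ∫ t in (0 : ℝ)..1, (c + p t) :=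
      intervalIntegral.integral_congr fun t ht => hx1 t (by rwa [uIcc_of_le zero_le_one] at ht)
    rw [this, intervalIntegral.integral_add (by simp) hpi]
    simp [hc]
  exact ⟨(⟨(x, v), hloop, hmean⟩ : h1Submodule n), rfl⟩

theorem exists_velL_eq_sub_mean (v : L2 n) :
    ∃ x : H1 n, velL x = v - mode 0 (coef 0 v) :=
  exists_velL_eq _ (by rw [map_sub, coef_mode_self, sub_self])

/-- The zero mean primitive of `v` minus its mean. -/
def primitive : L2 n →L[ℝ] H1 n :=
  LinearMap.mkContinuous
    { toFun := fun v => (exists_velL_eq_sub_mean v).choose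
      map_add' := fun v w => H1.ext_velL <| by
        rw [velL.map_add, (exists_velL_eq_sub_mean v).choose_spec,
          (exists_velL_eq_sub_mean w).choose_spec, (exists_velL_eq_sub_mean (v + w)).choose_spec,
          map_add, map_add]
        abel
      map_smul' := fun r v => H1.ext_velL <| by
        rw [RingHom.id_apply, velL.map_smul, (exists_velL_eq_sub_mean v).choose_spec,
          (exists_velL_eq_sub_mean (r • v)).choose_spec, map_smul, map_smul, smul_sub] } (1 + ‖(mode 0).comp (coef (n := n) 0)‖) fun v => by
    rw [← velL.norm_map]
    change ‖velL (exists_velL_eq_sub_mean v).choose‖ ≤ _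
    rw [(exists_velL_eq_sub_mean v).choose_spec]
    refine (norm_sub_le _ _).trans ?_
    rw [add_mul, one_mul]
    gcongr
    exact ((mode 0).comp (coef (n := n) 0)).le_opNorm v

theorem velL_primitive (v : L2 n) : velL (primitive v) = v - mode 0 (coef 0 v) :=
  (exists_velL_eq_sub_mean v).choose_spec

theorem primitive_velL (x : H1 n) : primitive (velL x) = x :=
  H1.ext_velL (by rw [velL_primitive, coef_zero_velL, map_zero, sub_zero])

/-- The velocity identifies `ℍ₁` isometrically with the closed subspace of `L²` of loops with zero
mean. -/
instance : CompleteSpace (H1 n) := by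
  rw [completeSpace_iff_isComplete_range (velL (n := n)).isometry.isUniformInducing]
  have : range (velL (n := n)) = {v | coef 0 v = 0} := by
    ext v
    constructor
    · rintro ⟨x, rfl⟩
      exact coef_zero_velL x
    · exact fun h => exists_velL_eq v h
  rw [this]
  exact (isClosed_eq (coef 0).continuous continuous_const).isComplete

theorem coef_zero_curveL (x : H1 n) : coef 0 (curveL x) = 0 := by
  rw [coef_zero_eq_integral, ← x.mean_eq_zero, intervalIntegral.integral_of_le zero_le_one,
    intervalIntegral.integral_of_le zero_le_one]
  exact integral_congr_ae (coeFn_curveL x)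

/-- Two loops with the same velocity differ by a constant, which the zero means force to vanish. -/
theorem H1.ext_of_hasDerivAt {x : H1 n} {y : ℝ → PhaseSpace n} {v : C(UnitAddCircle, PhaseSpace n)}
    (hy : ∀ t : ℝ, HasDerivAt y (v t) t) (hper : Function.Periodic y 1)
    (hmean : ∫ t in (0 : ℝ)..1, y t = 0) (hx : velL x = loopToL2 v) : x.curve = y := by
  have hint : ∀ t ∈ Icc (0 : ℝ) 1, ∫ s in (0 : ℝ)..t, velL x s = y t - y 0 := by
    intro t ht
    have h1 : ∫ s in (0 : ℝ)..t, velL x s = ∫ s in (0 : ℝ)..t, v (s : UnitAddCircle) := by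
      rw [hx, intervalIntegral.integral_of_le ht.1, intervalIntegral.integral_of_le ht.1]
      exact integral_congr_ae (ae_restrict_of_ae_restrict_of_subset (Ioc_subset_Ioc_right ht.2)
        (coeFn_loopToL2 v))
    rw [h1]
    exact intervalIntegral.integral_eq_sub_of_hasDerivAt (fun s _ => hy s)
      ((v.continuous.comp (AddCircle.continuous_mk' 1)).intervalIntegrable 0 t)
  have hd : ∀ t ∈ Icc (0 : ℝ) 1, x.curve t = y t + (x.curve 0 - y 0) := fun t ht => by
    rw [x.curve_eq ht, hint t ht]; abel
  have hyc : Continuous y := continuous_iff_continuousAt.2 fun t => (hy t).continuousAt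
  have hm := x.mean_eq_zero
  have e : ∫ t in (0 : ℝ)..1, x.curve t = ∫ t in (0 : ℝ)..1, (y t + (x.curve 0 - y 0)) :=
    intervalIntegral.integral_congr fun t ht => hd t (by rwa [uIcc_of_le zero_le_one] at ht)
  rw [e, intervalIntegral.integral_add (hyc.intervalIntegrable 0 1) (by simp), hmean] at hm
  simp only [intervalIntegral.integral_const, sub_zero, one_smul, zero_add] at hm
  funext t
  have h2 : Function.Periodic (fun t : ℝ => (x.curve t, y t)) 1 :=
    fun t => Prod.ext (x.isLoopWithVelocity.1 t) (hper t)
  refine periodic_apply_Ico h2 (P := fun p => p.1 = p.2) (fun t ht => ?_) t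
  simp only
  rw [hd t ht, hm, add_zero]

/-- The curve of an element with continuous velocity is differentiable. -/
theorem H1.hasDerivAt_curve {x : H1 n} {v : C(UnitAddCircle, PhaseSpace n)}
    (hx : velL x = loopToL2 v) (t : ℝ) : HasDerivAt x.curve (v t) t := by
  have hvc : Continuous fun s : ℝ => v (s : UnitAddCircle) :=
    v.continuous.comp (AddCircle.continuous_mk' 1)
  set q : ℝ → PhaseSpace n := fun t => ∫ s in (0 : ℝ)..t, v (s : UnitAddCircle) with hq
  have hqd : ∀ t : ℝ, HasDerivAt q (v (t : UnitAddCircle)) t := fun t =>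
    intervalIntegral.integral_hasDerivAt_right (hvc.intervalIntegrable 0 t)
      hvc.stronglyMeasurable.stronglyMeasurableAtFilter hvc.continuousAt
  have hq1 : q 1 = 0 := by
    have h := coef_zero_velL x
    rw [hx, coef_zero_eq_integral, intervalIntegral.integral_of_le zero_le_one,
      integral_congr_ae (coeFn_loopToL2 v), ← intervalIntegral.integral_of_le zero_le_one] at h
    exact h
  have hper : Function.Periodic q 1 := by
    intro t
    have hp : Function.Periodic (fun s : ℝ => v (s : UnitAddCircle)) 1 := fun s => by simp
    have := hp.intervalIntegral_add_eq 0 t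
    rw [zero_add] at this
    rw [hq]
    simp only
    rw [← intervalIntegral.integral_add_adjacent_intervals (hvc.intervalIntegrable 0 t)
      (hvc.intervalIntegrable t (t + 1)), ← this]
    change _ + q 1 = _
    rw [hq1, add_zero]
  have hqc : Continuous q := continuous_iff_continuousAt.2 fun t => (hqd t).continuousAt
  set m := ∫ t in (0 : ℝ)..1, q t with hm
  have h := H1.ext_of_hasDerivAt (x := x) (y := fun t => q t - m) (v := v)
    (fun t => (hqd t).sub_const m) (fun t => by simp only; rw [hper t]) (by
      rw [intervalIntegral.integral_sub (hqc.intervalIntegrable 0 1) (by simp)]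
      simp [hm]) hx
  rw [h]
  exact (hqd t).sub_const m

end Sobolev

/-! ### The Fourier splitting of `ℍ₁` -/

section Splitting

variable {n : ℕ}

/-- The Fourier mode `t ↦ e^{-2πkJ₀t} c` as an element of `ℍ₁`, for `k ≠ 0`. -/
def modeH (k : ℤ) : PhaseSpace n →L[ℝ] H1 n :=
  (primitive.comp (mode k)).comp (-(2 * Real.pi * k) • J0 n)

theorem velL_modeH {k : ℤ} (hk : k ≠ 0) (c : PhaseSpace n) :
    velL (modeH k c) = mode k (-(2 * Real.pi * k) • J0 n c) := by
  change velL (primitive (mode k (-(2 * Real.pi * k) • J0 n c))) = _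
  rw [velL_primitive, coef_mode_of_ne hk.symm, map_zero, sub_zero]

theorem hasDerivAt_mode (k : ℤ) (c : PhaseSpace n) (t : ℝ) :
    HasDerivAt (fun t => expJ0 n (-(2 * Real.pi * k * t)) c)
      (modeLoop k (-(2 * Real.pi * k) • J0 n c) (t : UnitAddCircle)) t := by
  have h := hasDerivAt_expJ0 (-(2 * Real.pi * k)) t c
  simp only [neg_mul] at h
  rw [modeLoop_coe]
  exact h

theorem modeMap_periodic (k : ℤ) (c : PhaseSpace n) :
    Function.Periodic (fun t => expJ0 n (-(2 * Real.pi * k * t)) c) 1 :=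
  fun t => (modeMap k).periodic t c

theorem curve_modeH {k : ℤ} (hk : k ≠ 0) (c : PhaseSpace n) (t : ℝ) :
    (modeH k c).curve t = expJ0 n (-(2 * Real.pi * k * t)) c := by
  have h := H1.ext_of_hasDerivAt (x := modeH k c) (hasDerivAt_mode k c) (modeMap_periodic k c)
    (by
      have h0 := coef_mode_of_ne hk.symm c
      rw [coef_zero_eq_integral, intervalIntegral.integral_of_le zero_le_one,
        integral_congr_ae (coeFn_mode k c), ← intervalIntegral.integral_of_le zero_le_one] at h0
      exact h0) (velL_modeH hk c)
  exact congrFun h t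

theorem curveC_modeH {k : ℤ} (hk : k ≠ 0) (c : PhaseSpace n) :
    curveC (modeH k c) = modeLoop k c := by
  ext1 θ
  obtain ⟨t, rfl⟩ := QuotientAddGroup.mk_surjective θ
  rw [curveC_coe, curve_modeH hk, modeLoop_coe]

theorem curveL_modeH {k : ℤ} (hk : k ≠ 0) (c : PhaseSpace n) :
    curveL (modeH k c) = mode k c := by
  change loopToL2 (curveC (modeH k c)) = _
  rw [curveC_modeH hk]
  rfl

/-- The derivative is moved onto the test mode by integration by parts. As a consequence `J₀ d/dt`
is diagonal, with eigenvalue `2πk` on the mode `k`. -/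
theorem coef_velL (k : ℤ) (x : H1 n) :
    coef k (velL x) = -(2 * Real.pi * k) • J0 n (coef k (curveL x)) := by
  rcases eq_or_ne k 0 with rfl | hk
  · simp [coef_zero_velL]
  · refine ext_inner_right ℝ fun c => ?_
    rw [inner_coef_left, ← curveL_modeH hk, inner_velL_curveL, velL_modeH hk, ← inner_coef_left,
      inner_smul_left, inner_smul_right, inner_J0_left]
    simp

theorem fourierCoef_curve (k : ℤ) (x : H1 n) : fourierCoef k x.curve = coef k (curveL x) := by
  rw [fourierCoef, coef_eq_integral, intervalIntegral.integral_of_le zero_le_one,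
    intervalIntegral.integral_of_le zero_le_one]
  refine integral_congr_ae ?_
  filter_upwards [coeFn_curveL x] with t ht
  rw [ht]

theorem coef_velL_eq_zero_iff {k : ℤ} (hk : k ≠ 0) (x : H1 n) :
    coef k (velL x) = 0 ↔ coef k (curveL x) = 0 := by
  have h2 : -(2 * Real.pi * k) ≠ 0 := by
    have : (k : ℝ) ≠ 0 := by exact_mod_cast hk
    have := Real.pi_ne_zero
    simp_all
  rw [coef_velL, smul_eq_zero_iff_right h2]
  constructor
  · intro h
    rw [← norm_eq_zero, ← norm_J0, h, norm_zero]
  · intro h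
    rw [h, map_zero]

theorem mem_highModes_iff {N : ℕ} (x : H1 n) :
    x ∈ highModes n N ↔ ∀ k : ℤ, 0 ≤ k → k ≤ N → coef k (curveL x) = 0 := by
  simp_rw [← fourierCoef_curve]
  rfl

theorem mem_highModes_iff_velL {N : ℕ} (x : H1 n) :
    x ∈ highModes n N ↔ ∀ k : ℤ, 0 ≤ k → k ≤ N → coef k (velL x) = 0 := by
  rw [mem_highModes_iff]
  refine forall_congr' fun k => forall_congr' fun _ => forall_congr' fun _ => ?_
  rcases eq_or_ne k 0 with rfl | hk
  · simp [coef_zero_velL, coef_zero_curveL]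
  · exact (coef_velL_eq_zero_iff hk x).symm

/-- The parametrization of `ℍ₁^{N,+}` by Fourier coefficients. -/
def lowParam (n N : ℕ) : (Finset.Icc 1 N → PhaseSpace n) →ₗ[ℝ] H1 n :=
  ∑ k : Finset.Icc 1 N, (modeH (n := n) ((k : ℕ) : ℤ)).toLinearMap ∘ₗ LinearMap.proj k

theorem lowParam_apply {N : ℕ} (c : Finset.Icc 1 N → PhaseSpace n) :
    lowParam n N c = ∑ k : Finset.Icc 1 N, modeH ((k : ℕ) : ℤ) (c k) := by
  simp [lowParam]

theorem ne_zero_of_mem_Icc {N : ℕ} (k : Finset.Icc 1 N) : ((k : ℕ) : ℤ) ≠ 0 := by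
  have := (Finset.mem_Icc.1 k.2).1
  omega

theorem range_lowParam (N : ℕ) : LinearMap.range (lowParam n N) = lowModes n N := by
  ext x
  constructor
  · rintro ⟨c, rfl⟩
    refine ⟨fun k => if h : k ∈ Finset.Icc 1 N then c ⟨k, h⟩ else 0, fun t => ?_⟩
    rw [lowParam_apply, map_sum, Finset.sum_apply]
    refine Eq.trans ?_ (Finset.sum_coe_sort (Finset.Icc 1 N) _)
    refine Finset.sum_congr rfl fun k _ => ?_
    rw [curve_modeH (ne_zero_of_mem_Icc k)]
    simp
  · rintro ⟨c, hc⟩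
    refine ⟨fun k => c k, ?_⟩
    have h : curveC (lowParam n N fun k => c k) = curveC x := by
      ext1 θ
      obtain ⟨t, rfl⟩ := QuotientAddGroup.mk_surjective θ
      rw [curveC_coe, curveC_coe, hc, lowParam_apply, map_sum, Finset.sum_apply]
      refine Eq.trans ?_ (Finset.sum_coe_sort (Finset.Icc 1 N) _)
      refine Finset.sum_congr rfl fun k _ => ?_
      rw [curve_modeH (ne_zero_of_mem_Icc k)]
      simp
    refine H1.ext_velL ?_
    have h2 : ∀ k : ℤ, coef k (velL (lowParam n N (fun k => c k)) - velL x) = 0 := fun k => by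
      rw [map_sub, coef_velL, coef_velL]
      change _ - -(2 * Real.pi * k) • J0 n (coef k (loopToL2 (curveC x))) = 0
      rw [← h]
      exact sub_self _
    have h3 := norm_le_of_norm_coef_le
      (v := velL (lowParam n N (fun k => c k)) - velL x) (w := 0) (fun k => by simp [h2 k])
    rw [norm_zero, norm_le_zero_iff] at h3
    exact sub_eq_zero.1 h3

theorem coef_curveL_lowParam {N : ℕ} (c : Finset.Icc 1 N → PhaseSpace n) (k : Finset.Icc 1 N) :
    coef ((k : ℕ) : ℤ) (curveL (lowParam n N c)) = c k := by
  rw [lowParam_apply, map_sum, map_sum]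
  simp_rw [fun j : Finset.Icc 1 N => curveL_modeH (ne_zero_of_mem_Icc j) (c j), coef_mode]
  rw [Finset.sum_eq_single k]
  · simp
  · intro j _ hj
    rw [if_neg]
    intro h
    exact hj (Subtype.ext (by exact_mod_cast h.symm))
  · simp

theorem lowParam_injective (N : ℕ) : Function.Injective (lowParam n N) := by
  intro c d h
  funext k
  rw [← coef_curveL_lowParam c k, h, coef_curveL_lowParam]

instance finiteDimensional_lowModes (N : ℕ) : FiniteDimensional ℝ (lowModes n N) := by
  rw [← range_lowParam]
  infer_instance

theorem finrank_lowModes (N : ℕ) : Module.finrank ℝ (lowModes n N) = 2 * n * N := by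
  rw [← range_lowParam, LinearMap.finrank_range_of_inj (lowParam_injective N),
    Module.finrank_pi_fintype]
  simp
  ring

/-- Distinct modes are orthogonal also for the inner product of velocities. Hence the high modes are
closed and the orthogonal projection supplies the low component of a loop. -/
theorem highModes_eq_orthogonal (N : ℕ) : highModes n N = (lowModes n N)ᗮ := by
  ext x
  rw [mem_highModes_iff_velL, Submodule.mem_orthogonal, ← range_lowParam]
  have hinner : ∀ {k : ℤ}, k ≠ 0 → ∀ c, inner ℝ (modeH k c) x =
      inner ℝ (-(2 * Real.pi * k) • J0 n c) (coef k (velL x)) := fun {k} hk c => by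
    rw [inner_H1, velL_modeH hk, inner_mode_left]
  constructor
  · rintro h _ ⟨c, rfl⟩
    rw [lowParam_apply, sum_inner]
    refine Finset.sum_eq_zero fun k _ => ?_
    have := Finset.mem_Icc.1 k.2
    rw [hinner (ne_zero_of_mem_Icc k), h _ (by omega) (by omega), inner_zero_right]
  · intro h k hk0 hkN
    rcases eq_or_ne k 0 with rfl | hk
    · exact coef_zero_velL x
    obtain ⟨m, rfl⟩ := Int.eq_ofNat_of_zero_le hk0
    have hm : m ∈ Finset.Icc 1 N := Finset.mem_Icc.2 ⟨by omega, by omega⟩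
    have h2 : -(2 * Real.pi * ((m : ℤ) : ℝ)) ≠ 0 := by
      have : ((m : ℤ) : ℝ) ≠ 0 := by exact_mod_cast hk
      have := Real.pi_ne_zero
      simp_all
    refine ext_inner_left ℝ fun c => ?_
    -- The test coefficient inverts `-2πmJ₀`, so that the velocity of the test mode has coefficient
    -- exactly `c`.
    have h3 := h _ ⟨Pi.single ⟨m, hm⟩ ((-(2 * Real.pi * ((m : ℤ) : ℝ)))⁻¹ • -J0 n c), rfl⟩
    rw [lowParam_apply, Finset.sum_eq_single ⟨m, hm⟩] at h3
    · rw [Pi.single_eq_same] at h3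
      have h4 := (hinner hk _).symm.trans h3
      rw [map_smul, smul_smul, mul_inv_cancel₀ h2, one_smul, map_neg, J0_J0, neg_neg] at h4
      rw [inner_zero_right]
      exact h4
    · intro j _ hj
      rw [Pi.single_eq_of_ne hj, map_zero]
    · simp

/-! ### The Poincaré inequality on the complement -/

/-- The eigenvalues `λ = 2πk` of `J₀ d/dt` on the high modes satisfy `λ ≤ 0` or `λ ≥ M`, where `M =
2π(N+1)`, hence `Mλ ≤ λ²`. The proof completes the square and compares norms mode by mode. -/
theorem inner_J2_velL_curveL_le {N : ℕ} {u : H1 n} (hu : u ∈ highModes n N) :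
    inner ℝ (J2 (velL u)) (curveL u) ≤ (2 * Real.pi * (N + 1))⁻¹ * ‖u‖ ^ 2 := by
  have hpi := Real.pi_pos
  set M : ℝ := 2 * Real.pi * (N + 1) with hM
  have hMpos : 0 < M := by positivity
  -- On the mode `k` this is `M/2 ≤ |λ - M/2|`, and squaring the resulting inequality of norms
  -- cancels the terms `(M/2)² ‖u‖²_{L²}`.
  have h := norm_le_of_norm_coef_le (v := (M / 2) • curveL u)
    (w := J2 (velL u) - (M / 2) • curveL u) (fun k => by
      by_cases hk : 0 ≤ k ∧ k ≤ N
      · have h0 := (mem_highModes_iff u).1 hu k hk.1 hk.2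
        simp [h0]
      · have e : coef k (J2 (velL u) - (M / 2) • curveL u) =
            (2 * Real.pi * k - M / 2) • coef k (curveL u) := by
          rw [map_sub, map_smul, coef_J2, coef_velL, map_smul, J0_J0]
          module
        rw [e, map_smul, norm_smul, norm_smul]
        gcongr
        rw [Real.norm_of_nonneg (by positivity), Real.norm_eq_abs, le_abs]
        rcases not_and_or.1 hk with hk | hk
        · right
          have : (k : ℝ) ≤ 0 := by exact_mod_cast (not_le.1 hk).le
          nlinarith
        · left
          have : (N : ℝ) + 1 ≤ k := by exact_mod_cast (not_le.1 hk)
          have : M ≤ 2 * Real.pi * k := by rw [hM]; gcongr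
          linarith)
  have h2 := pow_le_pow_left₀ (norm_nonneg _) h 2
  rw [norm_sub_sq_real, norm_J2, inner_smul_right] at h2
  have h3 : M * inner ℝ (J2 (velL u)) (curveL u) ≤ ‖u‖ ^ 2 := by
    have : ‖velL u‖ = ‖u‖ := velL.norm_map u
    rw [this] at h2
    linarith
  rw [← div_eq_inv_mul, le_div_iff₀ hMpos]
  linarith

/-! ### Projections onto low modes -/

/-- The projection of a square integrable loop onto the Fourier modes `0 ≤ k ≤ N`. -/
def lowPart (N : ℕ) : L2 n →L[ℝ] C(UnitAddCircle, PhaseSpace n) :=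
  ∑ k ∈ Finset.range (N + 1), (modeLoop (k : ℤ)).comp (coef (k : ℤ))

theorem lowPart_apply (N : ℕ) (v : L2 n) :
    lowPart N v = ∑ k ∈ Finset.range (N + 1), modeLoop (k : ℤ) (coef (k : ℤ) v) := by
  simp [lowPart, sum_apply]

theorem loopToL2_lowPart (N : ℕ) (v : L2 n) :
    loopToL2 (lowPart N v) = ∑ k ∈ Finset.range (N + 1), mode (k : ℤ) (coef (k : ℤ) v) := by
  rw [lowPart_apply, map_sum]
  rfl

theorem coef_lowPart {N : ℕ} {k : ℤ} (h0 : 0 ≤ k) (hk : k ≤ N) (v : L2 n) :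
    coef k (loopToL2 (lowPart N v)) = coef k v := by
  obtain ⟨m, rfl⟩ := Int.eq_ofNat_of_zero_le h0
  rw [loopToL2_lowPart, map_sum, Finset.sum_eq_single m]
  · rw [coef_mode_self]
  · intro j _ hj
    exact coef_mode_of_ne (by exact_mod_cast hj.symm) _
  · intro h
    exact absurd (Finset.mem_range.2 (by omega)) h

theorem lowPart_eq_zero {N : ℕ} {v : L2 n} (h : ∀ k : ℤ, 0 ≤ k → k ≤ N → coef k v = 0) :
    lowPart N v = 0 := by
  rw [lowPart_apply]
  refine Finset.sum_eq_zero fun k hk => ?_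
  have := Finset.mem_range.1 hk
  rw [h k (by omega) (by omega), map_zero]

theorem lowPart_congr {N : ℕ} {v w : L2 n} (h : ∀ k : ℤ, 0 ≤ k → k ≤ N → coef k v = coef k w) :
    lowPart N v = lowPart N w := by
  rw [← sub_eq_zero, ← map_sub]
  exact lowPart_eq_zero fun k h0 hk => by rw [map_sub, h k h0 hk, sub_self]

theorem lowPart_lowPart (N : ℕ) (v : L2 n) :
    lowPart N (loopToL2 (lowPart N v)) = lowPart N v :=
  lowPart_congr fun _ h0 hk => coef_lowPart h0 hk v

/-- Although `ℍ₁^{N,+}` starts at the mode `1`, the projection `lowPart` includes the mode `0`: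
velocities have no such mode, so including it adds no condition. -/
theorem mem_highModes_iff_lowPart {N : ℕ} (x : H1 n) :
    x ∈ highModes n N ↔ lowPart N (velL x) = 0 := by
  rw [mem_highModes_iff_velL]
  refine ⟨lowPart_eq_zero, fun h k h0 hk => ?_⟩
  rw [← coef_lowPart h0 hk, h, map_zero, map_zero]

theorem inner_lowPart_eq_zero {N : ℕ} {w : L2 n} (v : L2 n)
    (h : ∀ k : ℤ, 0 ≤ k → k ≤ N → coef k w = 0) : inner ℝ (loopToL2 (lowPart N v)) w = 0 := by
  rw [loopToL2_lowPart, sum_inner]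
  refine Finset.sum_eq_zero fun k hk => ?_
  have := Finset.mem_range.1 hk
  rw [inner_mode_left, h k (by omega) (by omega), inner_zero_right]

theorem exists_highModes_of_lowPart {N : ℕ} {r : L2 n}
    (h : ∀ k : ℤ, 0 ≤ k → k ≤ N → coef k r = 0) :
    ∃ u ∈ highModes n N, J2 (velL u) = r := by
  obtain ⟨u, hu⟩ := exists_velL_eq (-J2 r) (by
    rw [map_neg, coef_J2, h 0 le_rfl (by positivity), map_zero, neg_zero])
  refine ⟨u, (mem_highModes_iff_velL u).2 fun k h0 hk => ?_, ?_⟩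
  · rw [hu, map_neg, coef_J2, h k h0 hk, map_zero, neg_zero]
  · rw [hu, map_neg, J2_J2, neg_neg]

/-- A square integrable loop which annihilates `J₀` times the derivatives of the high modes
only contains the modes `0 ≤ k ≤ N`. -/
theorem eq_lowPart_of_forall_inner_eq_zero {N : ℕ} {w : L2 n}
    (h : ∀ u ∈ highModes n N, inner ℝ w (J2 (velL u)) = 0) : w = loopToL2 (lowPart N w) := by
  set r := w - loopToL2 (lowPart N w) with hr
  have hcr : ∀ k : ℤ, 0 ≤ k → k ≤ N → coef k r = 0 := fun k h0 hk => by
    rw [hr, map_sub, coef_lowPart h0 hk, sub_self]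
  -- The remainder `r` has no modes `0, …, N`, so it is itself of the form `J₀ u'` with `u` high and
  -- may be used as a test function.
  obtain ⟨u, hu, hur⟩ := exists_highModes_of_lowPart hcr
  have h1 := h u hu
  rw [hur] at h1
  have h2 := inner_lowPart_eq_zero w hcr
  have h3 : inner ℝ r r = 0 := by
    nth_rewrite 1 [hr]
    rw [inner_sub_left, h1, h2, sub_zero]
  exact sub_eq_zero.1 (inner_self_eq_zero.1 h3)

theorem inner_loopToL2_lowPart_J2_velL {N : ℕ} (w : L2 n) {u : H1 n} (hu : u ∈ highModes n N) :
    inner ℝ (loopToL2 (lowPart N w)) (J2 (velL u)) = 0 :=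
  inner_lowPart_eq_zero w fun k h0 hk => by
    rw [coef_J2, (mem_highModes_iff_velL u).1 hu k h0 hk, map_zero]

end Splitting

/-! ### Superposition operators on `L²` -/

section SuperpositionL2

variable {n : ℕ}

theorem PeriodicMap.norm_apply_zero_le {F F' : Type} [NormedAddCommGroup F] [NormedSpace ℝ F]
    [NormedAddCommGroup F'] [NormedSpace ℝ F'] (f : PeriodicMap F F') (t : ℝ) :
    ‖f.toFun t 0‖ ≤ ‖f.superposition 0‖ := by
  have := (f.superposition 0).norm_coe_le_norm (t : UnitAddCircle)
  rwa [f.superposition_coe] at this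

theorem PeriodicMap.aestronglyMeasurable {F' : Type} [NormedAddCommGroup F'] [NormedSpace ℝ F']
    (f : PeriodicMap (PhaseSpace n) F') (w : L2 n) :
    AEStronglyMeasurable (fun t => f.toFun t (w t)) (volume.restrict (Ioc (0 : ℝ) 1)) :=
  f.contDiff.continuous.comp_aestronglyMeasurable
    (aestronglyMeasurable_id.prodMk (Lp.aestronglyMeasurable w))

theorem PeriodicMap.memLp (f : PeriodicMap (PhaseSpace n) (PhaseSpace n)) {C : ℝ}
    (hf : ∀ t x y, ‖f.toFun t x - f.toFun t y‖ ≤ C * ‖x - y‖) (w : L2 n) :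
    MemLp (fun t => f.toFun t (w t)) 2 (volume.restrict (Ioc (0 : ℝ) 1)) := by
  obtain ⟨c, hc⟩ : ∃ c, ∀ t, ‖f.toFun t 0‖ ≤ c := ⟨_, f.norm_apply_zero_le⟩
  have h0 : MemLp (fun _ : ℝ => c) 2 (volume.restrict (Ioc (0 : ℝ) 1)) := memLp_const c
  have h1 : MemLp (fun t => c + C * ‖w t‖) 2 (volume.restrict (Ioc (0 : ℝ) 1)) :=
    h0.add ((Lp.memLp w).norm.const_mul C)
  refine h1.mono (f.aestronglyMeasurable w) (.of_forall fun t => ?_)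
  have h2 := norm_sub_norm_le (f.toFun t (w t)) (f.toFun t 0)
  have h3 := hf t (w t) 0
  rw [sub_zero] at h3
  refine le_trans ?_ (le_abs_self _)
  linarith [hc t]

/-- The superposition operator `w ↦ f(t, w(t))` on `L²` induced by a Lipschitz map. -/
def PeriodicMap.superL2 (f : PeriodicMap (PhaseSpace n) (PhaseSpace n)) {C : ℝ}
    (hf : ∀ t x y, ‖f.toFun t x - f.toFun t y‖ ≤ C * ‖x - y‖) (w : L2 n) : L2 n :=
  (f.memLp hf w).toLp _

theorem PeriodicMap.coeFn_superL2 (f : PeriodicMap (PhaseSpace n) (PhaseSpace n)) {C : ℝ}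
    (hf : ∀ t x y, ‖f.toFun t x - f.toFun t y‖ ≤ C * ‖x - y‖) (w : L2 n) :
    f.superL2 hf w =ᵐ[volume.restrict (Ioc (0 : ℝ) 1)] fun t => f.toFun t (w t) :=
  (f.memLp hf w).coeFn_toLp

theorem PeriodicMap.superL2_loopToL2 (f : PeriodicMap (PhaseSpace n) (PhaseSpace n)) {C : ℝ}
    (hf : ∀ t x y, ‖f.toFun t x - f.toFun t y‖ ≤ C * ‖x - y‖)
    (v : C(UnitAddCircle, PhaseSpace n)) :
    f.superL2 hf (loopToL2 v) = loopToL2 (f.superposition v) := by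
  ext1
  filter_upwards [f.coeFn_superL2 hf (loopToL2 v), coeFn_loopToL2 v,
    coeFn_loopToL2 (f.superposition v)] with t h1 h2 h3
  rw [h1, h2, h3, f.superposition_coe]

theorem PeriodicMap.norm_superL2_sub_le (f : PeriodicMap (PhaseSpace n) (PhaseSpace n)) {C : ℝ}
    (hf : ∀ t x y, ‖f.toFun t x - f.toFun t y‖ ≤ C * ‖x - y‖) (v w : L2 n) :
    ‖f.superL2 hf v - f.superL2 hf w‖ ≤ C * ‖v - w‖ := by
  refine Lp.norm_le_mul_norm_of_ae_le_mul ?_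
  filter_upwards [f.coeFn_superL2 hf v, f.coeFn_superL2 hf w, Lp.coeFn_sub v w,
    Lp.coeFn_sub (f.superL2 hf v) (f.superL2 hf w)] with t h1 h2 h3 h4
  rw [h3, h4, Pi.sub_apply, Pi.sub_apply, h1, h2]
  exact hf t _ _

theorem integrable_norm_sq (w : L2 n) :
    Integrable (fun t => ‖w t‖ ^ 2) (volume.restrict (Ioc (0 : ℝ) 1)) :=
  (Lp.memLp w).integrable_norm_pow two_ne_zero

end SuperpositionL2

/-! ### The dual action functional -/

namespace LegendrePair

variable {n : ℕ} {H : ℝ → PhaseSpace n → ℝ} (L : LegendrePair H)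

/-- The superposition operator of `∇H*`. -/
def dualL2 : L2 n → L2 n := L.dual.superL2 L.lip

theorem coeFn_dualL2 (w : L2 n) :
    L.dualL2 w =ᵐ[volume.restrict (Ioc (0 : ℝ) 1)] fun t => L.dual.toFun t (w t) :=
  L.dual.coeFn_superL2 L.lip w

theorem norm_dualL2_sub_le (v w : L2 n) : ‖L.dualL2 v - L.dualL2 w‖ ≤ L.up * ‖v - w‖ :=
  L.dual.norm_superL2_sub_le L.lip v w

theorem dualL2_mono (v w : L2 n) :
    L.lo * ‖v - w‖ ^ 2 ≤ inner ℝ (L.dualL2 v - L.dualL2 w) (v - w) := by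
  rw [L2.norm_sq, intervalIntegral.integral_of_le zero_le_one, ← integral_const_mul,
    MeasureTheory.L2.inner_def]
  refine integral_mono_ae ((integrable_norm_sq _).const_mul _)
    (MeasureTheory.L2.integrable_inner _ _) ?_
  filter_upwards [L.coeFn_dualL2 v, L.coeFn_dualL2 w, Lp.coeFn_sub v w,
    Lp.coeFn_sub (L.dualL2 v) (L.dualL2 w)] with t h1 h2 h3 h4
  rw [h3, h4, Pi.sub_apply, Pi.sub_apply, h1, h2]
  exact L.mono t _ _

theorem conj_lower (t : ℝ) (x h : PhaseSpace n) :
    L.conj.toFun t x + inner ℝ (L.dual.toFun t x) h + L.lo / 2 * ‖h‖ ^ 2 ≤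
      L.conj.toFun t (x + h) :=
  le_of_gradient_stronglyMonotone (L.hasFDerivAt_conj t) (L.mono t) x h

theorem conj_upper (t : ℝ) (x h : PhaseSpace n) :
    L.conj.toFun t (x + h) ≤
      L.conj.toFun t x + inner ℝ (L.dual.toFun t x) h + L.up / 2 * ‖h‖ ^ 2 :=
  le_of_gradient_lipschitz (L.hasFDerivAt_conj t) (L.lip t) x h

theorem integrable_conj (w : L2 n) :
    Integrable (fun t => L.conj.toFun t (w t)) (volume.restrict (Ioc (0 : ℝ) 1)) := by
  have hw : Integrable (fun t => w t) (volume.restrict (Ioc (0 : ℝ) 1)) :=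
    (Lp.memLp w).integrable (by norm_num)
  have hb : Integrable (fun t => ‖L.conj.superposition 0‖ + ‖L.dual.superposition 0‖ * ‖w t‖ +
      L.up / 2 * ‖w t‖ ^ 2) (volume.restrict (Ioc (0 : ℝ) 1)) :=
    ((integrable_const _).add (hw.norm.const_mul _)).add ((integrable_norm_sq w).const_mul _)
  refine hb.mono' (L.conj.aestronglyMeasurable w) (.of_forall fun t => ?_)
  have h1 := L.conj_lower t 0 (w t)
  have h2 := L.conj_upper t 0 (w t)
  rw [zero_add] at h1 h2
  have h3 := L.conj.norm_apply_zero_le t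
  have h4 := (abs_real_inner_le_norm (L.dual.toFun t 0) (w t)).trans
    (mul_le_mul_of_nonneg_right (L.dual.norm_apply_zero_le t) (norm_nonneg _))
  have h5 : 0 ≤ L.lo / 2 * ‖w t‖ ^ 2 := by have := L.lo_pos; positivity
  have h6 : 0 ≤ L.up / 2 * ‖w t‖ ^ 2 := by have := L.up_pos; positivity
  rw [Real.norm_eq_abs, abs_le] at h3
  rw [abs_le] at h4
  rw [Real.norm_eq_abs, abs_le]
  constructor <;> linarith [h3.1, h3.2, h4.1, h4.2]

theorem integrable_conj_add_inner (w h : L2 n) :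
    Integrable (fun t => L.conj.toFun t (w t) + inner ℝ (L.dualL2 w t) (h t))
      (volume.restrict (Ioc (0 : ℝ) 1)) :=
  (L.integrable_conj w).add (MeasureTheory.L2.integrable_inner _ _)

/-- The functional `w ↦ ∫ H*_t(w) dt` on `L²`. -/
def conjInt (w : L2 n) : ℝ := ∫ t in Ioc (0 : ℝ) 1, L.conj.toFun t (w t)

theorem conjInt_lower (w h : L2 n) :
    L.conjInt w + inner ℝ (L.dualL2 w) h + L.lo / 2 * ‖h‖ ^ 2 ≤ L.conjInt (w + h) := by
  rw [conjInt, conjInt, MeasureTheory.L2.inner_def, L2.norm_sq,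
    intervalIntegral.integral_of_le zero_le_one, ← integral_const_mul,
    ← integral_add (L.integrable_conj w) (MeasureTheory.L2.integrable_inner _ _),
    ← integral_add (L.integrable_conj_add_inner w h)
      ((integrable_norm_sq _).const_mul _)]
  refine integral_mono_ae ((L.integrable_conj_add_inner w h).add
      ((integrable_norm_sq _).const_mul _)) (L.integrable_conj _) ?_
  filter_upwards [L.coeFn_dualL2 w, Lp.coeFn_add w h] with t h1 h2
  simp only [Pi.add_apply] at h2 ⊢
  rw [h1, h2]
  exact L.conj_lower t _ _

theorem conjInt_upper (w h : L2 n) :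
    L.conjInt (w + h) ≤ L.conjInt w + inner ℝ (L.dualL2 w) h + L.up / 2 * ‖h‖ ^ 2 := by
  rw [conjInt, conjInt, MeasureTheory.L2.inner_def, L2.norm_sq,
    intervalIntegral.integral_of_le zero_le_one, ← integral_const_mul,
    ← integral_add (L.integrable_conj w) (MeasureTheory.L2.integrable_inner _ _),
    ← integral_add (L.integrable_conj_add_inner w h)
      ((integrable_norm_sq _).const_mul _)]
  refine integral_mono_ae (L.integrable_conj _)
    ((L.integrable_conj_add_inner w h).add
      ((integrable_norm_sq _).const_mul _)) ?_
  filter_upwards [L.coeFn_dualL2 w, Lp.coeFn_add w h] with t h1 h2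
  simp only [Pi.add_apply] at h2 ⊢
  rw [h1, h2]
  exact L.conj_upper t _ _

theorem dualAction_eq (x : H1 n) : dualAction H x =
    -(1 / 2) * inner ℝ (J2 (velL x)) (curveL x) + L.conjInt (J2 (velL x)) := by
  rw [dualAction, conjInt, MeasureTheory.L2.inner_def,
    intervalIntegral.integral_of_le zero_le_one, intervalIntegral.integral_of_le zero_le_one]
  congr 1
  · congr 1
    refine integral_congr_ae ?_
    filter_upwards [coeFn_J2 (velL x), coeFn_curveL x] with t h1 h2
    rw [h1, h2]
    rfl
  · refine integral_congr_ae ?_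
    filter_upwards [coeFn_J2 (velL x)] with t h1
    rw [h1, L.conj_eq]
    rfl

end LegendrePair

/-! ### Symmetry of the quadratic part and functionals on `ℍ₁` represented by `L²` loops -/

section Pairing

variable {n : ℕ}

theorem eq_of_coef_eq {v w : L2 n} (h : ∀ k, coef k v = coef k w) : v = w := by
  have h3 := norm_le_of_norm_coef_le (v := v - w) (w := 0)
    (fun k => by rw [map_sub, h k, sub_self, map_zero])
  rw [norm_zero, norm_le_zero_iff] at h3
  exact sub_eq_zero.1 h3

/-- Multiplication by `J₀` commutes with taking the zero mean primitive, as the Fourier coefficients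
show. -/
theorem curveL_primitive_J2 (x : H1 n) : curveL (primitive (J2 (velL x))) = J2 (curveL x) := by
  have hv : velL (primitive (J2 (velL x))) = J2 (velL x) := by
    rw [velL_primitive, coef_J2, coef_zero_velL, map_zero, map_zero, sub_zero]
  refine eq_of_coef_eq fun k => ?_
  rcases eq_or_ne k 0 with rfl | hk
  · rw [coef_J2, coef_zero_curveL, coef_zero_curveL, map_zero]
  · have h2 : -(2 * Real.pi * k) ≠ 0 := by
      have : (k : ℝ) ≠ 0 := by exact_mod_cast hk
      have := Real.pi_ne_zero
      simp_all
    have h := coef_velL k (primitive (J2 (velL x)))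
    rw [hv, coef_J2, coef_velL, map_smul] at h
    have h3 := congrArg (J0 n) (smul_right_injective _ h2 h)
    rw [J0_J0, J0_J0, neg_inj] at h3
    rw [coef_J2, h3]

/-- `J₀` and `d/dt` are both skew and commute, so their product is symmetric. -/
theorem inner_J2_velL_curveL_symm (x h : H1 n) :
    inner ℝ (J2 (velL x)) (curveL h) = inner ℝ (J2 (velL h)) (curveL x) := by
  have hv : velL (primitive (J2 (velL h))) = J2 (velL h) := by
    rw [velL_primitive, coef_J2, coef_zero_velL, map_zero, map_zero, sub_zero]
  rw [inner_J2_left, ← curveL_primitive_J2, inner_velL_curveL, neg_neg, hv, real_inner_comm]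

/-- The inner product as a continuous bilinear map over `ℝ`. -/
def innerR (V : Type*) [NormedAddCommGroup V] [InnerProductSpace ℝ V] : V →L[ℝ] V →L[ℝ] ℝ :=
  LinearMap.mkContinuous₂ (innerₗ V) 1 fun x y => by
    rw [one_mul]
    exact norm_inner_le_norm x y

theorem innerR_apply {V : Type*} [NormedAddCommGroup V] [InnerProductSpace ℝ V] (x y : V) :
    innerR V x y = inner ℝ x y := rfl

/-- The functional `u ↦ ⟨w, J₀ u'⟩` on `ℍ₁`. -/
def pairing : L2 n →L[ℝ] H1 n →L[ℝ] ℝ :=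
  ((innerR (L2 n)).flip.comp (J2.comp velL.toContinuousLinearMap)).flip

theorem pairing_apply (w : L2 n) (u : H1 n) : pairing w u = inner ℝ w (J2 (velL u)) := rfl

theorem norm_pairing_le (w : L2 n) : ‖pairing w‖ ≤ ‖w‖ := by
  refine ContinuousLinearMap.opNorm_le_bound _ (norm_nonneg _) fun u => ?_
  rw [pairing_apply]
  have h := norm_inner_le_norm (𝕜 := ℝ) w (J2 (velL u))
  rwa [norm_J2, velL.norm_map] at h

theorem hasDerivAt_clm_comp {V W : Type*} [NormedAddCommGroup V] [NormedSpace ℝ V]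
    [NormedAddCommGroup W] [NormedSpace ℝ W] (A : V →L[ℝ] W) {f : ℝ → V} {f' : V} {x : ℝ}
    (h : HasDerivAt f f' x) : HasDerivAt (fun s => A (f s)) (A f') x :=
  A.hasFDerivAt.comp_hasDerivAt x h

theorem hasFDerivAt_of_norm_sub_le {V : Type*} [NormedAddCommGroup V] [NormedSpace ℝ V]
    {f : V → ℝ} {f' : V →L[ℝ] ℝ} {x : V} {C : ℝ}
    (h : ∀ u, |f (x + u) - f x - f' u| ≤ C * ‖u‖ ^ 2) : HasFDerivAt f f' x := by
  rw [hasFDerivAt_iff_isLittleO_nhds_zero]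
  have h1 : (fun u => f (x + u) - f x - f' u) =O[𝓝 0] fun u => ‖u‖ ^ 2 :=
    Asymptotics.IsBigO.of_bound C (.of_forall fun u => by
      rw [Real.norm_eq_abs, Real.norm_of_nonneg (by positivity)]
      exact h u)
  exact h1.trans_isLittleO (Asymptotics.isLittleO_norm_pow_id one_lt_two)

end Pairing

/-! ### The differential of the dual action and its convexity along the high modes -/

namespace LegendrePair

variable {n : ℕ} {H : ℝ → PhaseSpace n → ℝ} (L : LegendrePair H)

/-- The `L²` representative of the differential of the dual action. -/
def grad2 (x : H1 n) : L2 n := L.dualL2 (J2 (velL x)) - curveL x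

/-- The differential of the dual action. -/
def dAction (x : H1 n) : H1 n →L[ℝ] ℝ := pairing (L.grad2 x)

theorem dAction_apply (x u : H1 n) :
    L.dAction x u = inner ℝ (L.dualL2 (J2 (velL x)) - curveL x) (J2 (velL u)) := rfl

/-- The exact first order remainder: the quadratic part at `u` plus the convexity remainder of `∫
H*`. Two-sided bounds on it give differentiability, and the lower bound on high modes gives strong
convexity. -/
theorem dualAction_add_sub (x u : H1 n) :
    dualAction H (x + u) - dualAction H x - L.dAction x u =
      -(1 / 2) * inner ℝ (J2 (velL u)) (curveL u) +
        (L.conjInt (J2 (velL x) + J2 (velL u)) - L.conjInt (J2 (velL x)) -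
          inner ℝ (L.dualL2 (J2 (velL x))) (J2 (velL u))) := by
  rw [L.dualAction_eq, L.dualAction_eq, dAction_apply, map_add, map_add, map_add,
    inner_add_left, inner_add_right, inner_add_right, inner_J2_velL_curveL_symm x u,
    inner_sub_left, real_inner_comm (J2 (velL u)) (curveL x)]
  ring

theorem hasFDerivAt_dualAction (x : H1 n) : HasFDerivAt (dualAction H) (L.dAction x) x := by
  refine hasFDerivAt_of_norm_sub_le (C := 1 / 2 * ‖curveL (n := n)‖ + L.up / 2) fun u => ?_
  rw [L.dualAction_add_sub]
  have h1 := L.conjInt_lower (J2 (velL x)) (J2 (velL u))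
  have h2 := L.conjInt_upper (J2 (velL x)) (J2 (velL u))
  have h3 := abs_real_inner_le_norm (J2 (velL u)) (curveL u)
  have h4 := curveL.le_opNorm u
  have h5 := L.lo_pos
  have hn : ‖velL u‖ = ‖u‖ := velL.norm_map u
  rw [norm_J2, hn] at h1 h2 h3
  have h6 : ‖u‖ * ‖curveL u‖ ≤ ‖curveL (n := n)‖ * ‖u‖ ^ 2 := by
    nlinarith [norm_nonneg u]
  have h7 : 0 ≤ L.lo / 2 * ‖u‖ ^ 2 := by positivity
  rw [abs_le] at h3 ⊢
  have h8 := L.up_pos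
  have h9 : 0 ≤ L.up / 2 * ‖u‖ ^ 2 := by positivity
  constructor <;> linarith [h3.1, h3.2]

theorem fderiv_dualAction : fderiv ℝ (dualAction H) = L.dAction :=
  funext fun x => (L.hasFDerivAt_dualAction x).fderiv

/-- The constant of strong convexity of the dual action along the high modes. -/
def convexity (N : ℕ) : ℝ := L.lo - (2 * Real.pi * (N + 1))⁻¹

/-- This is the only condition that determines the threshold `N₀` of the theorem; any integer above
`lo⁻¹` will do. -/
theorem exists_convexity_pos : ∃ N₀ : ℕ, ∀ N, N₀ ≤ N → 0 < L.convexity N := by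
  obtain ⟨N₀, hN₀⟩ := exists_nat_gt L.lo⁻¹
  refine ⟨N₀, fun N hN => ?_⟩
  have h1 : L.lo⁻¹ < 2 * Real.pi * (N + 1) := by
    have h2 : (N₀ : ℝ) ≤ N := by exact_mod_cast hN
    have := Real.pi_gt_three
    have h3 : (0 : ℝ) ≤ N := by positivity
    nlinarith
  rw [convexity, sub_pos]
  exact inv_lt_of_inv_lt₀ L.lo_pos h1

theorem le_dualAction_add {N : ℕ} (x : H1 n) {u : H1 n} (hu : u ∈ highModes n N) :
    dualAction H x + L.dAction x u + L.convexity N / 2 * ‖u‖ ^ 2 ≤ dualAction H (x + u) := by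
  have h := L.dualAction_add_sub x u
  have h1 := L.conjInt_lower (J2 (velL x)) (J2 (velL u))
  have h2 := inner_J2_velL_curveL_le hu
  have hn : ‖velL u‖ = ‖u‖ := velL.norm_map u
  rw [norm_J2, hn] at h1
  rw [convexity]
  linarith

theorem dAction_mono {N : ℕ} (x y : H1 n) (hu : x - y ∈ highModes n N) :
    L.convexity N * ‖x - y‖ ^ 2 ≤ (L.dAction x - L.dAction y) (x - y) := by
  rw [sub_apply, dAction_apply, dAction_apply, ← inner_sub_left]
  have h1 := L.dualL2_mono (J2 (velL x)) (J2 (velL y))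
  have h2 := inner_J2_velL_curveL_le hu
  rw [← map_sub J2, ← map_sub velL, norm_J2, velL.norm_map] at h1
  have e : L.dualL2 (J2 (velL x)) - curveL x - (L.dualL2 (J2 (velL y)) - curveL y) =
      (L.dualL2 (J2 (velL x)) - L.dualL2 (J2 (velL y))) - curveL (x - y) := by
    rw [map_sub]; abel
  rw [e, inner_sub_left, convexity, real_inner_comm _ (curveL (x - y))]
  linarith

/-- A Lipschitz constant of the differential of the dual action. -/
def lipConst : ℝ := L.up + ‖curveL (n := n)‖

theorem lipConst_pos : 0 < L.lipConst := by
  have := L.up_pos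
  have h := norm_nonneg (curveL (n := n))
  rw [lipConst]
  linarith

theorem norm_dAction_sub_le (x y : H1 n) :
    ‖L.dAction x - L.dAction y‖ ≤ L.lipConst * ‖x - y‖ := by
  rw [dAction, dAction, ← map_sub]
  refine (norm_pairing_le _).trans ?_
  have e : L.grad2 x - L.grad2 y =
      (L.dualL2 (J2 (velL x)) - L.dualL2 (J2 (velL y))) - curveL (x - y) := by
    rw [map_sub, grad2, grad2]; abel
  rw [e, lipConst, add_mul]
  refine (norm_sub_le _ _).trans (add_le_add ?_ (curveL.le_opNorm _))
  have := L.norm_dualL2_sub_le (J2 (velL x)) (J2 (velL y))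
  rwa [← map_sub J2, ← map_sub velL, norm_J2, velL.norm_map] at this

/-! ### The second Gateaux differential -/

theorem norm_fderiv_dual_le (t : ℝ) (x : PhaseSpace n) : ‖fderiv ℝ (L.dual.toFun t) x‖ ≤ L.up :=
  norm_fderiv_le_of_lip' ℝ L.up_pos.le (.of_forall fun y => L.lip t y x)

/-- The derivative of `∇H*_t` is the Hessian of `H*_t`, hence symmetric. -/
theorem inner_fderiv_dual_symm (t : ℝ) (x u v : PhaseSpace n) :
    inner ℝ (fderiv ℝ (L.dual.toFun t) x u) v = inner ℝ (fderiv ℝ (L.dual.toFun t) x v) u := by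
  have h : HasFDerivAt (fun y => innerR (PhaseSpace n) (L.dual.toFun t y))
      ((innerR (PhaseSpace n)).comp (fderiv ℝ (L.dual.toFun t) x)) x :=
    (innerR (PhaseSpace n)).hasFDerivAt.comp x (L.dual.hasFDerivAt t x)
  exact second_derivative_symmetric (fun y => L.hasFDerivAt_conj t y) h u v

theorem memLp_fderiv_dual (w h : L2 n) :
    MemLp (fun t => fderiv ℝ (L.dual.toFun t) (w t) (h t)) 2
      (volume.restrict (Ioc (0 : ℝ) 1)) := by
  refine ((Lp.memLp h).norm.const_mul L.up).mono ?_ (.of_forall fun t => ?_)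
  · exact (isBoundedBilinearMap_apply (𝕜 := ℝ) (E := PhaseSpace n)
      (F := PhaseSpace n)).continuous.comp_aestronglyMeasurable
        ((L.dual.deriv₂.aestronglyMeasurable w).prodMk (Lp.aestronglyMeasurable h))
  · refine le_trans ?_ (le_abs_self _)
    exact (ContinuousLinearMap.le_opNorm _ _).trans
      (mul_le_mul_of_nonneg_right (L.norm_fderiv_dual_le t _) (norm_nonneg _))

/-- The Gateaux derivative of the superposition operator of `∇H*`. -/
def dDualL2 (w : L2 n) : L2 n →L[ℝ] L2 n :=
  LinearMap.mkContinuous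
    { toFun := fun h => (L.memLp_fderiv_dual w h).toLp _
      map_add' := fun h k => by
        ext1
        filter_upwards [(L.memLp_fderiv_dual w h).coeFn_toLp, (L.memLp_fderiv_dual w k).coeFn_toLp,
          (L.memLp_fderiv_dual w (h + k)).coeFn_toLp, Lp.coeFn_add h k,
          Lp.coeFn_add ((L.memLp_fderiv_dual w h).toLp _) ((L.memLp_fderiv_dual w k).toLp _)]
          with t h1 h2 h3 h4 h5
        rw [h3, h5, Pi.add_apply, h1, h2, h4, Pi.add_apply, map_add]
      map_smul' := fun r h => by
        ext1
        filter_upwards [(L.memLp_fderiv_dual w h).coeFn_toLp,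
          (L.memLp_fderiv_dual w (r • h)).coeFn_toLp, Lp.coeFn_smul r h,
          Lp.coeFn_smul r ((L.memLp_fderiv_dual w h).toLp _)] with t h1 h2 h3 h4
        rw [RingHom.id_apply, h4, h2, h3, Pi.smul_apply, Pi.smul_apply, h1, map_smul] }
    L.up fun h => by
      refine Lp.norm_le_mul_norm_of_ae_le_mul ?_
      filter_upwards [(L.memLp_fderiv_dual w h).coeFn_toLp] with t h1
      change ‖(L.memLp_fderiv_dual w h).toLp _ t‖ ≤ _
      rw [h1]
      exact (ContinuousLinearMap.le_opNorm _ _).trans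
        (mul_le_mul_of_nonneg_right (L.norm_fderiv_dual_le t _) (norm_nonneg _))

theorem coeFn_dDualL2 (w h : L2 n) : L.dDualL2 w h =ᵐ[volume.restrict (Ioc (0 : ℝ) 1)]
    fun t => fderiv ℝ (L.dual.toFun t) (w t) (h t) :=
  (L.memLp_fderiv_dual w h).coeFn_toLp

theorem inner_dDualL2_symm (w h k : L2 n) :
    inner ℝ (L.dDualL2 w h) k = inner ℝ (L.dDualL2 w k) h := by
  rw [MeasureTheory.L2.inner_def, MeasureTheory.L2.inner_def]
  refine integral_congr_ae ?_
  filter_upwards [L.coeFn_dDualL2 w h, L.coeFn_dDualL2 w k] with t h1 h2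
  rw [h1, h2]
  exact L.inner_fderiv_dual_symm t _ _ _

/-- For a fixed direction the difference quotients converge pointwise, and their error is dominated
by `2 up |h(t)|`, so dominated convergence applies. Nothing here is uniform in `h`, so the
derivative is only a Gateaux derivative. -/
theorem hasDerivAt_dualL2 (w h : L2 n) :
    HasDerivAt (fun s : ℝ => L.dualL2 (w + s • h)) (L.dDualL2 w h) 0 := by
  rw [hasDerivAt_iff_tendsto_slope_zero, tendsto_iff_norm_sub_tendsto_zero]
  simp only [zero_add, zero_smul, add_zero]
  have hae : ∀ s : ℝ, (s⁻¹ • (L.dualL2 (w + s • h) - L.dualL2 w) - L.dDualL2 w h : L2 n)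
      =ᵐ[volume.restrict (Ioc (0 : ℝ) 1)] fun t =>
        s⁻¹ • (L.dual.toFun t (w t + s • h t) - L.dual.toFun t (w t)) -
          fderiv ℝ (L.dual.toFun t) (w t) (h t) := by
    intro s
    filter_upwards [L.coeFn_dualL2 (w + s • h), L.coeFn_dualL2 w, L.coeFn_dDualL2 w h,
      Lp.coeFn_sub (s⁻¹ • (L.dualL2 (w + s • h) - L.dualL2 w)) (L.dDualL2 w h),
      Lp.coeFn_smul s⁻¹ (L.dualL2 (w + s • h) - L.dualL2 w),
      Lp.coeFn_sub (L.dualL2 (w + s • h)) (L.dualL2 w), Lp.coeFn_add w (s • h),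
      Lp.coeFn_smul s h] with t h1 h2 h3 h4 h5 h6 h7 h8
    rw [h4, Pi.sub_apply, h5, Pi.smul_apply, h6, Pi.sub_apply, h1, h2, h3, h7, Pi.add_apply, h8,
      Pi.smul_apply]
  have hsq : Tendsto (fun s : ℝ =>
      ‖s⁻¹ • (L.dualL2 (w + s • h) - L.dualL2 w) - L.dDualL2 w h‖ ^ 2) (𝓝[≠] 0) (𝓝 0) := by
    have e : ∀ s : ℝ, ‖s⁻¹ • (L.dualL2 (w + s • h) - L.dualL2 w) - L.dDualL2 w h‖ ^ 2 =
        ∫ t in Ioc (0 : ℝ) 1,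
          ‖s⁻¹ • (L.dual.toFun t (w t + s • h t) - L.dual.toFun t (w t)) -
            fderiv ℝ (L.dual.toFun t) (w t) (h t)‖ ^ 2 := fun s => by
      rw [L2.norm_sq, intervalIntegral.integral_of_le zero_le_one]
      refine integral_congr_ae ?_
      filter_upwards [hae s] with t ht
      rw [ht]
    simp_rw [e]
    have e0 : 𝓝 (0 : ℝ) = 𝓝 (∫ _ in Ioc (0 : ℝ) 1, (0 : ℝ)) := by rw [integral_zero]
    rw [e0]
    refine tendsto_integral_filter_of_dominated_convergence
      (fun t => (2 * L.up) ^ 2 * ‖h t‖ ^ 2) ?_ ?_ ((integrable_norm_sq h).const_mul _) ?_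
    · refine .of_forall fun s => ?_
      exact (((Lp.aestronglyMeasurable _).congr (hae s)).norm.pow 2)
    · filter_upwards [self_mem_nhdsWithin] with s hs
      refine .of_forall fun t => ?_
      rw [Real.norm_of_nonneg (by positivity), ← mul_pow]
      refine pow_le_pow_left₀ (norm_nonneg _) ?_ 2
      refine (norm_sub_le _ _).trans ?_
      have h1 := L.lip t (w t + s • h t) (w t)
      rw [add_sub_cancel_left, norm_smul] at h1
      have h2 : ‖s⁻¹ • (L.dual.toFun t (w t + s • h t) - L.dual.toFun t (w t))‖ ≤
          L.up * ‖h t‖ := by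
        rw [norm_smul, norm_inv, ← div_eq_inv_mul, div_le_iff₀ (norm_pos_iff.2 hs)]
        linarith
      have h3 : ‖fderiv ℝ (L.dual.toFun t) (w t) (h t)‖ ≤ L.up * ‖h t‖ :=
        (ContinuousLinearMap.le_opNorm _ _).trans
          (mul_le_mul_of_nonneg_right (L.norm_fderiv_dual_le t _) (norm_nonneg _))
      linarith
    · refine .of_forall fun t => ?_
      have h1 : HasDerivAt (fun s : ℝ => L.dual.toFun t (w t + s • h t))
          (fderiv ℝ (L.dual.toFun t) (w t) (h t)) 0 :=
        (L.dual.hasFDerivAt t (w t)).hasLineDerivAt (h t)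
      rw [hasDerivAt_iff_tendsto_slope_zero, tendsto_iff_norm_sub_tendsto_zero] at h1
      simp only [zero_add, zero_smul, add_zero] at h1
      simpa using h1.pow 2
  have := hsq.sqrt
  simpa [Real.sqrt_sq (norm_nonneg _)] using this

/-- Strong monotonicity of `dualL2`, divided by `s²`, passes to the limit of difference quotients.
-/
theorem dDualL2_lower (w h : L2 n) : L.lo * ‖h‖ ^ 2 ≤ inner ℝ (L.dDualL2 w h) h := by
  have h1 := L.hasDerivAt_dualL2 w h
  rw [hasDerivAt_iff_tendsto_slope_zero] at h1
  simp only [zero_add, zero_smul, add_zero] at h1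
  refine ge_of_tendsto (h1.inner (tendsto_const_nhds (x := h))) ?_
  filter_upwards [self_mem_nhdsWithin] with s hs
  have h2 := L.dualL2_mono (w + s • h) w
  rw [add_sub_cancel_left, norm_smul, inner_smul_right, mul_pow, Real.norm_eq_abs, sq_abs] at h2
  rw [inner_smul_left]
  have hs' : 0 < s ^ 2 := by have : s ≠ 0 := hs; positivity
  refine le_of_mul_le_mul_left ?_ hs'
  have e : s ^ 2 * ((starRingEnd ℝ) s⁻¹ * inner ℝ (L.dualL2 (w + s • h) - L.dualL2 w) h) =
      s * inner ℝ (L.dualL2 (w + s • h) - L.dualL2 w) h := by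
    have : s ≠ 0 := hs
    simp only [conj_trivial]
    field_simp
  rw [e]
  linarith

/-- The second Gateaux differential of the dual action. -/
def hess (z : H1 n) : H1 n →L[ℝ] H1 n →L[ℝ] ℝ :=
  pairing.comp ((L.dDualL2 (J2 (velL z))).comp (J2.comp velL.toContinuousLinearMap) - curveL)

theorem hess_apply (z u v : H1 n) :
    L.hess z u v = inner ℝ (L.dDualL2 (J2 (velL z)) (J2 (velL u)) - curveL u) (J2 (velL v)) := rfl

theorem hess_symm (z u v : H1 n) : L.hess z u v = L.hess z v u := by
  rw [hess_apply, hess_apply, inner_sub_left, inner_sub_left, L.inner_dDualL2_symm,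
    real_inner_comm _ (curveL u), real_inner_comm _ (curveL v), inner_J2_velL_curveL_symm]

theorem hess_lower {N : ℕ} (z : H1 n) {u : H1 n} (hu : u ∈ highModes n N) :
    L.convexity N * ‖u‖ ^ 2 ≤ L.hess z u u := by
  rw [hess_apply, inner_sub_left, real_inner_comm _ (curveL u), convexity]
  have h1 := L.dDualL2_lower (J2 (velL z)) (J2 (velL u))
  have h2 := inner_J2_velL_curveL_le hu
  rw [norm_J2, velL.norm_map] at h1
  linarith

theorem hasLineDerivAt_dAction (z u : H1 n) : HasLineDerivAt ℝ L.dAction (L.hess z u) z u := by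
  have h1 := L.hasDerivAt_dualL2 (J2 (velL z)) (J2 (velL u))
  have h2 : HasDerivAt (fun s : ℝ => curveL (z + s • u)) (curveL u) 0 := by
    have h3 : HasDerivAt (fun s : ℝ => z + s • u) u 0 := by
      simpa using ((hasDerivAt_id (0 : ℝ)).smul_const u).const_add z
    exact curveL.hasFDerivAt.comp_hasDerivAt _ h3
  have h4 := hasDerivAt_clm_comp (W := H1 n →L[ℝ] ℝ) pairing (h1.sub h2)
  refine h4.congr_of_eventuallyEq (.of_forall fun s => ?_)
  simp only [dAction, grad2, map_add, map_smul, Pi.sub_apply]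

theorem secondDiff_dualAction (z u : H1 n) : secondDiff (dualAction H) z u = L.hess z u := by
  rw [secondDiff, L.fderiv_dualAction]
  exact (L.hasLineDerivAt_dAction z u).lineDeriv

end LegendrePair

/-! ### Minimization along the high modes -/

section Slices

variable {n : ℕ}

theorem isClosed_highModes (N : ℕ) : IsClosed (highModes n N : Set (H1 n)) := by
  rw [highModes_eq_orthogonal]
  exact Submodule.isClosed_orthogonal _

instance (N : ℕ) : CompleteSpace (highModes n N) :=
  (isClosed_highModes N).completeSpace_coe

end Slices

theorem hasDerivAt_comp_clm {V W : Type*} [NormedAddCommGroup V] [NormedSpace ℝ V]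
    [NormedAddCommGroup W] [NormedSpace ℝ W] {f : ℝ → V →L[ℝ] ℝ} {f' : V →L[ℝ] ℝ} {t : ℝ}
    (h : HasDerivAt f f' t) (B : W →L[ℝ] V) :
    HasDerivAt (fun s => (f s).comp B) (f'.comp B) t := by
  have := h.clm_comp (hasDerivAt_const t B)
  simpa using this

namespace LegendrePair

variable {n : ℕ} {H : ℝ → PhaseSpace n → ℝ} (L : LegendrePair H)

theorem hasFDerivAt_slice {N : ℕ} (x : H1 n) (y : highModes n N) :
    HasFDerivAt (fun y' : highModes n N => dualAction H (x + (y' : H1 n)))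
      ((L.dAction (x + (y : H1 n))).comp (highModes n N).subtypeL) y := by
  have h1 : HasFDerivAt (fun y' : highModes n N => x + (y' : H1 n))
      (highModes n N).subtypeL y :=
    ((highModes n N).subtypeL.hasFDerivAt).const_add x
  exact (L.hasFDerivAt_dualAction _).comp y h1

theorem isCritical_slice_iff {N : ℕ} (x : H1 n) (y : highModes n N) :
    IsCritical (fun y' : highModes n N => dualAction H (x + (y' : H1 n))) y ↔
      (L.dAction (x + (y : H1 n))).comp (highModes n N).subtypeL = 0 := by
  constructor
  · intro h
    exact (L.hasFDerivAt_slice x y).unique h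
  · intro h
    have h2 := L.hasFDerivAt_slice x y
    rw [h] at h2
    exact h2

/-- Along a slice the differential is strongly monotone with constant `convexity N`, and Lipschitz;
the value `0` is therefore taken exactly once. -/
theorem bijective_dAction_slice {N : ℕ} (hN : 0 < L.convexity N) (x : H1 n) :
    Function.Bijective fun y : highModes n N =>
      (L.dAction (x + (y : H1 n))).comp (highModes n N).subtypeL := by
  refine bijective_of_stronglyMonotone (L := L.lipConst) hN (fun y z => ?_) (fun y z => ?_)
  · have h := L.dAction_mono (N := N) (x + y) (x + z) (by
      rw [add_sub_add_left_eq_sub]; exact (y - z).2)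
    rw [add_sub_add_left_eq_sub] at h
    exact h
  · rw [← ContinuousLinearMap.sub_comp]
    refine (ContinuousLinearMap.opNorm_comp_le _ _).trans ?_
    have h1 := L.norm_dAction_sub_le (x + y) (x + z)
    rw [add_sub_add_left_eq_sub] at h1
    have h2 := (highModes n N).norm_subtypeL_le
    calc _ ≤ ‖L.dAction (x + y) - L.dAction (x + z)‖ * 1 := by gcongr
      _ ≤ L.lipConst * ‖y - z‖ := by rw [mul_one]; exact h1

/-- The critical point of the dual action along the high modes through `x`. -/
def graphMap {N : ℕ} (hN : 0 < L.convexity N) (x : H1 n) : highModes n N :=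
  ((L.bijective_dAction_slice hN x).2 0).choose

theorem dAction_graphMap_comp {N : ℕ} (hN : 0 < L.convexity N) (x : H1 n) :
    (L.dAction (x + (L.graphMap hN x : H1 n))).comp (highModes n N).subtypeL = 0 :=
  ((L.bijective_dAction_slice hN x).2 0).choose_spec

theorem dAction_graphMap {N : ℕ} (hN : 0 < L.convexity N) (x : H1 n) {u : H1 n}
    (hu : u ∈ highModes n N) : L.dAction (x + (L.graphMap hN x : H1 n)) u = 0 :=
  congrArg (fun A => A (⟨u, hu⟩ : highModes n N)) (L.dAction_graphMap_comp hN x)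

theorem eq_graphMap {N : ℕ} (hN : 0 < L.convexity N) {x : H1 n} {y : highModes n N}
    (h : ∀ u ∈ highModes n N, L.dAction (x + (y : H1 n)) u = 0) : y = L.graphMap hN x := by
  refine (L.bijective_dAction_slice hN x).1 ?_
  simp only
  rw [L.dAction_graphMap_comp hN x]
  ext u
  exact h u u.2

theorem isCritical_slice_iff_eq {N : ℕ} (hN : 0 < L.convexity N) (x : H1 n) (y : highModes n N) :
    IsCritical (fun y' : highModes n N => dualAction H (x + (y' : H1 n))) y ↔
      y = L.graphMap hN x := by
  rw [L.isCritical_slice_iff]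
  constructor
  · exact fun h => L.eq_graphMap hN fun u hu =>
      congrArg (fun A => A (⟨u, hu⟩ : highModes n N)) h
  · rintro rfl
    exact L.dAction_graphMap_comp hN x

theorem dualAction_graphMap_le {N : ℕ} (hN : 0 < L.convexity N) (x : H1 n) (y : highModes n N) :
    dualAction H (x + (L.graphMap hN x : H1 n)) ≤ dualAction H (x + (y : H1 n)) := by
  have h := L.le_dualAction_add (x + (L.graphMap hN x : H1 n)) (y - L.graphMap hN x).2
  rw [L.dAction_graphMap hN x (y - L.graphMap hN x).2, Submodule.coe_sub, add_add_sub_cancel,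
    add_zero] at h
  have h2 : 0 ≤ L.convexity N / 2 * ‖(y : H1 n) - (L.graphMap hN x : H1 n)‖ ^ 2 := by positivity
  linarith

theorem exists_norm_hess_le (z : H1 n) : ∃ C, ∀ u, ‖L.hess z u‖ ≤ C * ‖u‖ :=
  ⟨_, fun u => (norm_pairing_le _).trans
    (((L.dDualL2 (J2 (velL z))).comp (J2.comp velL.toContinuousLinearMap) - curveL).le_opNorm u)⟩

/-- The Lax–Milgram theorem, as the linear case of the result on monotone operators. It yields
non-degeneracy of the minimizer and also weak solutions of the linearized Euler equation. -/
theorem bijective_hess_slice {N : ℕ} (hN : 0 < L.convexity N) (z : H1 n) :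
    Function.Bijective fun u : highModes n N =>
      (L.hess z (u : H1 n)).comp (highModes n N).subtypeL := by
  obtain ⟨C, hC⟩ := L.exists_norm_hess_le z
  refine bijective_of_stronglyMonotone (L := C) hN (fun u v => ?_) (fun u v => ?_)
  · have h := L.hess_lower z (u - v).2
    rw [← ContinuousLinearMap.sub_comp, ← map_sub]
    exact h
  · rw [← ContinuousLinearMap.sub_comp, ← map_sub]
    refine (ContinuousLinearMap.opNorm_comp_le _ _).trans ?_
    have h1 := hC ((u : H1 n) - (v : H1 n))
    have h2 := (highModes n N).norm_subtypeL_le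
    calc _ ≤ ‖L.hess z ((u : H1 n) - (v : H1 n))‖ * 1 := by gcongr
      _ ≤ C * ‖u - v‖ := by rw [mul_one]; exact h1

theorem secondDiff_slice {N : ℕ} (x : H1 n) (y u : highModes n N) :
    secondDiff (fun y' : highModes n N => dualAction H (x + (y' : H1 n))) y u =
      (L.hess (x + (y : H1 n)) (u : H1 n)).comp (highModes n N).subtypeL := by
  have h1 : fderiv ℝ (fun y' : highModes n N => dualAction H (x + (y' : H1 n))) =
      fun y : highModes n N => (L.dAction (x + (y : H1 n))).comp (highModes n N).subtypeL :=
    funext fun y => (L.hasFDerivAt_slice x y).fderiv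
  rw [secondDiff, h1]
  refine HasLineDerivAt.lineDeriv ?_
  have h2 := L.hasLineDerivAt_dAction (x + (y : H1 n)) (u : H1 n)
  have h3 := hasDerivAt_comp_clm h2 (highModes n N).subtypeL
  refine h3.congr_of_eventuallyEq (.of_forall fun s => ?_)
  simp [add_assoc]

theorem isNondegenerateAt_slice {N : ℕ} (hN : 0 < L.convexity N) (x : H1 n)
    (y : highModes n N) :
    IsNondegenerateAt (fun y' : highModes n N => dualAction H (x + (y' : H1 n))) y := by
  have := L.bijective_hess_slice hN (x + (y : H1 n))
  rw [IsNondegenerateAt]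
  convert this using 1
  exact funext fun u => L.secondDiff_slice x y u

/-- The difference of the two critical points is used as a test vector: strong monotonicity within
the slice is set against the Lipschitz dependence of the differential on the base point. -/
theorem norm_graphMap_sub_le {N : ℕ} (hN : 0 < L.convexity N) (x x' : H1 n) :
    ‖L.graphMap hN x - L.graphMap hN x'‖ ≤ L.lipConst / L.convexity N * ‖x - x'‖ := by
  set y := L.graphMap hN x
  set y' := L.graphMap hN x'
  have h1 := L.dAction_mono (N := N) (x + y) (x + y') (by
      rw [add_sub_add_left_eq_sub]; exact (y - y').2)
  rw [add_sub_add_left_eq_sub] at h1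
  have h2 : (L.dAction (x + y) - L.dAction (x + y')) ((y : H1 n) - y') =
      (L.dAction (x' + y') - L.dAction (x + y')) ((y : H1 n) - y') := by
    rw [sub_apply, sub_apply]
    have e1 := L.dAction_graphMap hN x (y - y').2
    have e2 := L.dAction_graphMap hN x' (y - y').2
    rw [Submodule.coe_sub] at e1 e2
    rw [e1, e2]
  have h3 := (L.dAction (x' + y') - L.dAction (x + y')).le_opNorm ((y : H1 n) - y')
  have h4 := L.norm_dAction_sub_le (x' + y') (x + y')
  rw [add_sub_add_right_eq_sub, norm_sub_rev x' x] at h4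
  have h5 : L.convexity N * ‖(y : H1 n) - y'‖ ^ 2 ≤
      L.lipConst * ‖x - x'‖ * ‖(y : H1 n) - y'‖ := by
    rw [h2] at h1
    refine h1.trans ((le_abs_self _).trans (h3.trans ?_))
    gcongr
  change ‖(y : H1 n) - y'‖ ≤ _
  rcases (norm_nonneg ((y : H1 n) - y')).eq_or_lt with h0 | h0
  · rw [← h0]
    have := L.lipConst_pos
    positivity
  · rw [div_mul_eq_mul_div, le_div_iff₀ hN]
    refine le_of_mul_le_mul_right ?_ h0
    linarith

/-! ### Regularity of the critical points -/

/-- The Hamiltonian vector field as a periodic map. -/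
def hamMap : PeriodicMap (PhaseSpace n) (PhaseSpace n) where
  toFun t z := -J0 n (L.grad.toFun t z)
  contDiff := ((J0 n).contDiff.comp L.grad.contDiff).neg
  periodic t z := by rw [L.grad.periodic]

/-- Criticality along the high modes forces `∇H*(J₀z') - z` to be its own low part `p`. Applying
`∇H_t` to `∇H*_t(J₀z') = z + p` gives `z' = X_H(t, z + p)`, whose right-hand side is continuous. -/
theorem velL_eq_of_dAction_eq_zero {N : ℕ} {z : H1 n}
    (h : ∀ u ∈ highModes n N, L.dAction z u = 0) :
    velL z = loopToL2 (L.hamMap.superposition (curveC z + lowPart N (L.grad2 z))) := by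
  have h1 : L.grad2 z = loopToL2 (lowPart N (L.grad2 z)) :=
    eq_lowPart_of_forall_inner_eq_zero h
  have h2 : L.dualL2 (J2 (velL z)) = loopToL2 (curveC z + lowPart N (L.grad2 z)) := by
    rw [map_add, ← h1, grad2]
    change _ = curveL z + _
    abel
  set w := curveC z + lowPart N (L.grad2 z)
  ext1
  have h3 : L.dualL2 (J2 (velL z)) =ᵐ[volume.restrict (Ioc (0 : ℝ) 1)] fun t => w t := by
    rw [h2]
    exact coeFn_loopToL2 w
  filter_upwards [h3, L.coeFn_dualL2 (J2 (velL z)), coeFn_J2 (velL z),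
    coeFn_loopToL2 (L.hamMap.superposition w)] with t e1 e2 e3 e4
  rw [e4, PeriodicMap.superposition_coe]
  change _ = -J0 n (L.grad.toFun t (w t))
  rw [← e1, e2, L.grad_dual, e3, J0_J0, neg_neg]

end LegendrePair

/-! ### The Euler equation as an equation between continuous loops -/

section LoopOperators

variable {n : ℕ}

/-- The zero mean primitive as an operator on continuous loops. -/
def primitiveC : C(UnitAddCircle, PhaseSpace n) →L[ℝ] C(UnitAddCircle, PhaseSpace n) :=
  curveC.comp (primitive.comp loopToL2)

/-- The complex structure as an operator on continuous loops. -/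
def JC : C(UnitAddCircle, PhaseSpace n) →L[ℝ] C(UnitAddCircle, PhaseSpace n) :=
  (J0 n).compLeftContinuous ℝ UnitAddCircle

theorem JC_apply (v : C(UnitAddCircle, PhaseSpace n)) (θ : UnitAddCircle) :
    JC v θ = J0 n (v θ) := rfl

/-- The projection onto the modes `0, …, N` as an operator on continuous loops. -/
def lowC (N : ℕ) : C(UnitAddCircle, PhaseSpace n) →L[ℝ] C(UnitAddCircle, PhaseSpace n) :=
  (lowPart N).comp loopToL2

theorem lowC_apply (N : ℕ) (v : C(UnitAddCircle, PhaseSpace n)) :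
    lowC N v = lowPart N (loopToL2 v) := rfl

theorem lowC_lowC (N : ℕ) (v : C(UnitAddCircle, PhaseSpace n)) : lowC N (lowC N v) = lowC N v :=
  lowPart_lowPart N _

/-- A continuous loop is a velocity as soon as its mean vanishes, and the mean is visible in the low
part. -/
theorem velL_primitive_loop {N : ℕ} {v : C(UnitAddCircle, PhaseSpace n)} {w : L2 n}
    (h : lowC N v = lowPart N w) (hw : coef 0 w = 0) :
    velL (primitive (loopToL2 v)) = loopToL2 v := by
  have h0 : coef 0 (loopToL2 v) = 0 := by
    rw [← coef_lowPart (N := N) le_rfl (by positivity), ← lowC_apply, h,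
      coef_lowPart le_rfl (by positivity), hw]
  rw [velL_primitive, h0, map_zero, sub_zero]

theorem primitiveC_eq {z : H1 n} {v : C(UnitAddCircle, PhaseSpace n)}
    (h : velL z = loopToL2 v) : primitiveC v = curveC z := by
  change curveC (primitive (loopToL2 v)) = _
  rw [← h, primitive_velL]

end LoopOperators

namespace LegendrePair

variable {n : ℕ} {H : ℝ → PhaseSpace n → ℝ} (L : LegendrePair H)

/-- The `L²` gradient of the dual action on continuous velocities. -/
def gradC (v : C(UnitAddCircle, PhaseSpace n)) : C(UnitAddCircle, PhaseSpace n) :=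
  L.dual.superposition (JC v) - primitiveC v

theorem loopToL2_gradC {z : H1 n} {v : C(UnitAddCircle, PhaseSpace n)}
    (h : velL z = loopToL2 v) : loopToL2 (L.gradC v) = L.grad2 z := by
  rw [gradC, map_sub, primitiveC_eq h, grad2, h, J2_loopToL2, dualL2,
    PeriodicMap.superL2_loopToL2]
  rfl

/-- The differential of `gradC`. -/
def dGradC (v : C(UnitAddCircle, PhaseSpace n)) :
    C(UnitAddCircle, PhaseSpace n) →L[ℝ] C(UnitAddCircle, PhaseSpace n) :=
  (PeriodicMap.applyLoop (L.dual.deriv₂.superposition (JC v))).comp JC - primitiveC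

theorem contDiff_gradC : ContDiff ℝ ∞ L.gradC :=
  (L.dual.contDiff_superposition.comp JC.contDiff).sub primitiveC.contDiff

theorem hasFDerivAt_gradC (v : C(UnitAddCircle, PhaseSpace n)) :
    HasFDerivAt L.gradC (L.dGradC v) v :=
  ((L.dual.hasFDerivAt_superposition (JC v)).comp v JC.hasFDerivAt).sub primitiveC.hasFDerivAt

theorem loopToL2_applyLoop_dual (w h : C(UnitAddCircle, PhaseSpace n)) :
    loopToL2 (PeriodicMap.applyLoop (L.dual.deriv₂.superposition w) h) =
      L.dDualL2 (loopToL2 w) (loopToL2 h) := by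
  ext1
  filter_upwards [coeFn_loopToL2 (PeriodicMap.applyLoop (L.dual.deriv₂.superposition w) h),
    coeFn_loopToL2 w, coeFn_loopToL2 h, L.coeFn_dDualL2 (loopToL2 w) (loopToL2 h)]
    with t h1 h2 h3 h4
  rw [h1, h4, h2, h3, PeriodicMap.applyLoop_apply, PeriodicMap.superposition_coe]
  rfl

theorem loopToL2_dGradC {v h : C(UnitAddCircle, PhaseSpace n)} {z u : H1 n}
    (hz : velL z = loopToL2 v) (hu : velL u = loopToL2 h) :
    loopToL2 (L.dGradC v h) = L.dDualL2 (J2 (velL z)) (J2 (velL u)) - curveL u := by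
  rw [dGradC, sub_apply, map_sub, primitiveC_eq hu, ContinuousLinearMap.comp_apply,
    loopToL2_applyLoop_dual, hz, hu, J2_loopToL2, J2_loopToL2]
  rfl

/-- Outside the modes `0, …, N` this is the `L²` gradient of the dual action, on the modes
`0, …, N` it is the identity. -/
def eulerMap (N : ℕ) (v : C(UnitAddCircle, PhaseSpace n)) : C(UnitAddCircle, PhaseSpace n) :=
  L.gradC v - lowC N (L.gradC v) + lowC N v

/-- The differential of `eulerMap`. -/
def dEulerMap (N : ℕ) (v : C(UnitAddCircle, PhaseSpace n)) :
    C(UnitAddCircle, PhaseSpace n) →L[ℝ] C(UnitAddCircle, PhaseSpace n) :=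
  L.dGradC v - (lowC N).comp (L.dGradC v) + lowC N

theorem dEulerMap_apply (N : ℕ) (v h : C(UnitAddCircle, PhaseSpace n)) :
    L.dEulerMap N v h = L.dGradC v h - lowC N (L.dGradC v h) + lowC N h := rfl

theorem contDiff_eulerMap (N : ℕ) : ContDiff ℝ ∞ (L.eulerMap N) :=
  (L.contDiff_gradC.sub ((lowC N).contDiff.comp L.contDiff_gradC)).add (lowC N).contDiff

theorem hasFDerivAt_eulerMap (N : ℕ) (v : C(UnitAddCircle, PhaseSpace n)) :
    HasFDerivAt (L.eulerMap N) (L.dEulerMap N v) v :=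
  ((L.hasFDerivAt_gradC v).sub ((lowC N).hasFDerivAt.comp v (L.hasFDerivAt_gradC v))).add
    (lowC N).hasFDerivAt

theorem fderiv_grad_fderiv_dual (t : ℝ) (x h : PhaseSpace n) :
    fderiv ℝ (L.grad.toFun t) (L.dual.toFun t x) (fderiv ℝ (L.dual.toFun t) x h) = h := by
  have h1 := (L.grad.hasFDerivAt t (L.dual.toFun t x)).comp x (L.dual.hasFDerivAt t x)
  have h2 : L.grad.toFun t ∘ L.dual.toFun t = id := funext fun x => L.grad_dual t x
  rw [h2] at h1
  exact congrArg (fun A => A h) (h1.unique (hasFDerivAt_id x))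

/-- If the image of `k` under the differential of the dual gradient at a continuous loop is
continuous, then so is `k`. -/
theorem exists_loop_of_dDualL2_eq {w q : C(UnitAddCircle, PhaseSpace n)} {k : L2 n}
    (h : L.dDualL2 (loopToL2 w) k = loopToL2 q) : ∃ p, k = loopToL2 p := by
  refine ⟨PeriodicMap.applyLoop (L.grad.deriv₂.superposition (L.dual.superposition w)) q, ?_⟩
  ext1
  have h0 : L.dDualL2 (loopToL2 w) k =ᵐ[volume.restrict (Ioc (0 : ℝ) 1)] fun t => q t := by
    rw [h]
    exact coeFn_loopToL2 q
  filter_upwards [h0, coeFn_loopToL2 w, L.coeFn_dDualL2 (loopToL2 w) k, coeFn_loopToL2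
    (PeriodicMap.applyLoop (L.grad.deriv₂.superposition (L.dual.superposition w)) q)]
    with t h1 h2 h3 h4
  rw [h4, PeriodicMap.applyLoop_apply, ← h1, h3, h2, PeriodicMap.superposition_coe,
    PeriodicMap.superposition_coe]
  exact (L.fderiv_grad_fderiv_dual t _ _).symm

/-- The low part of the equation gives `lowC N h = 0`, so `h` is the velocity of a high `u`; the
rest says that `dGradC v h` is low, hence pairs to zero with `J₀u'`. Thus the second differential
vanishes at `(u, u)`, and coercivity gives `u = 0`. -/
theorem dEulerMap_injective {N : ℕ} (hN : 0 < L.convexity N) {z : H1 n}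
    {v : C(UnitAddCircle, PhaseSpace n)} (hz : velL z = loopToL2 v) :
    Function.Injective (L.dEulerMap N v) := by
  refine (injective_iff_map_eq_zero _).2 fun h hh => ?_
  rw [dEulerMap_apply] at hh
  have h1 : lowC N h = 0 := by
    have := congrArg (lowC N) hh
    rwa [map_add, map_sub, lowC_lowC, lowC_lowC, sub_self, zero_add, map_zero] at this
  have h2 : L.dGradC v h = lowC N (L.dGradC v h) := by
    rwa [h1, add_zero, sub_eq_zero] at hh
  have hu := velL_primitive_loop (N := N) (v := h) (w := 0) (by rw [h1, map_zero]) (map_zero _)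
  set u := primitive (loopToL2 h)
  have hmem : u ∈ highModes n N := by
    rw [mem_highModes_iff_lowPart, hu]
    exact h1
  have h3 := L.hess_lower z hmem
  rw [hess_apply, ← L.loopToL2_dGradC hz hu, h2, lowC_apply,
    inner_loopToL2_lowPart_J2_velL _ hmem] at h3
  have h4 : ‖u‖ = 0 := by
    have : ‖u‖ ^ 2 ≤ 0 := by
      by_contra hc
      push Not at hc
      nlinarith
    nlinarith [norm_nonneg u]
  rw [norm_eq_zero] at h4
  rw [h4, map_zero] at hu
  exact loopToL2_injective (by rw [← hu, map_zero])

/-- The high part of the solution is first found weakly in `ℍ₁` and then shown to have a continuous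
velocity. -/
theorem dEulerMap_surjective {N : ℕ} (hN : 0 < L.convexity N) {z : H1 n}
    {v : C(UnitAddCircle, PhaseSpace n)} (hz : velL z = loopToL2 v) :
    Function.Surjective (L.dEulerMap N v) := by
  intro f
  -- The low part of the solution is forced, because `lowC N` applied to `dEulerMap N v h` is `lowC
  -- N h`.
  set h₀ := lowC N f with hh₀
  set f₁ := f - L.dGradC v h₀ with hf₁
  obtain ⟨u, hu⟩ := (L.bijective_hess_slice hN z).2
    ((pairing (loopToL2 f₁)).comp (highModes n N).subtypeL)
  set r := L.dDualL2 (J2 (velL z)) (J2 (velL (u : H1 n))) - curveL (u : H1 n) - loopToL2 f₁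
    with hr
  have hr0 : r = loopToL2 (lowPart N r) := by
    refine eq_lowPart_of_forall_inner_eq_zero fun w hw => ?_
    rw [hr, inner_sub_left, sub_eq_zero]
    exact congrArg (fun A => A (⟨w, hw⟩ : highModes n N)) hu
  -- The residual `r` of the weak solution is a trigonometric polynomial, so every term on the right
  -- is continuous; the derivative of `∇H_t` then inverts that of `∇H*_t` and makes `u'` continuous.
  have hq : L.dDualL2 (loopToL2 (JC v)) (J2 (velL (u : H1 n))) =
      loopToL2 (lowPart N r + curveC (u : H1 n) + f₁) := by
    have e : loopToL2 (JC v) = J2 (velL z) := by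
      rw [hz, J2_loopToL2]
      rfl
    rw [map_add, map_add, ← hr0, e, hr]
    change _ = _ + curveL (u : H1 n) + _
    abel
  obtain ⟨p, hp⟩ := L.exists_loop_of_dDualL2_eq hq
  set h₁ := -JC p with hh₁
  have hu₁ : velL (u : H1 n) = loopToL2 h₁ := by
    have := congrArg J2 hp
    rw [J2_J2, J2_loopToL2] at this
    rw [hh₁, map_neg, ← neg_eq_iff_eq_neg]
    exact this
  have hlow : lowC N h₁ = 0 := by
    rw [lowC_apply, ← hu₁]
    exact (mem_highModes_iff_lowPart _).1 u.2
  have hd : L.dGradC v h₁ = lowPart N r + f₁ := by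
    apply loopToL2_injective
    rw [L.loopToL2_dGradC hz hu₁, map_add, ← hr0, hr]
    abel
  refine ⟨h₀ + h₁, ?_⟩
  have hd' : L.dGradC v (h₀ + h₁) = f + lowPart N r := by
    rw [map_add, hd, hf₁]
    abel
  have hll : lowC N (lowPart N r) = lowPart N r := lowPart_lowPart N r
  rw [dEulerMap_apply, hd', map_add, map_add, hlow, hll, hh₀, lowC_lowC]
  abel

/-- The velocity of the point of the graph over `x`, as a continuous loop. -/
def velC {N : ℕ} (hN : 0 < L.convexity N) (x : H1 n) : C(UnitAddCircle, PhaseSpace n) :=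
  L.hamMap.superposition (curveC (x + (L.graphMap hN x : H1 n)) +
    lowPart N (L.grad2 (x + (L.graphMap hN x : H1 n))))

theorem velL_graph {N : ℕ} (hN : 0 < L.convexity N) (x : H1 n) :
    velL (x + (L.graphMap hN x : H1 n)) = loopToL2 (L.velC hN x) :=
  L.velL_eq_of_dAction_eq_zero fun _ hu => L.dAction_graphMap hN x hu

theorem eulerMap_velC {N : ℕ} (hN : 0 < L.convexity N) (x : H1 n) :
    L.eulerMap N (L.velC hN x) = lowPart N (velL x) := by
  have h1 := L.velL_graph hN x
  have h2 : L.gradC (L.velC hN x) = lowC N (L.gradC (L.velC hN x)) := by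
    apply loopToL2_injective
    rw [lowC_apply, L.loopToL2_gradC h1]
    exact eq_lowPart_of_forall_inner_eq_zero fun _ hu => L.dAction_graphMap hN x hu
  rw [eulerMap, ← h2, sub_self, zero_add, lowC_apply, ← h1, map_add, map_add,
    (mem_highModes_iff_lowPart _).1 (L.graphMap hN x).2, add_zero]

/-- Together with `eulerMap_velC` this characterizes `velC` globally as the only solution of the
Euler equation whose low part is that of `x'`. -/
theorem eq_velC {N : ℕ} (hN : 0 < L.convexity N) {x : H1 n} {v : C(UnitAddCircle, PhaseSpace n)}
    (h : L.eulerMap N v = lowPart N (velL x)) : v = L.velC hN x := by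
  have h1 : lowC N v = lowPart N (velL x) := by
    have := congrArg (lowC N) h
    rw [eulerMap, map_add, map_sub, lowC_lowC, lowC_lowC, sub_self, zero_add] at this
    rw [this]
    exact lowPart_lowPart N _
  have h2 : L.gradC v = lowC N (L.gradC v) := by
    rwa [eulerMap, h1, add_eq_right, sub_eq_zero] at h
  have hz := velL_primitive_loop h1 (coef_zero_velL x)
  set z := primitive (loopToL2 v)
  have hmem : z - x ∈ highModes n N := by
    rw [mem_highModes_iff_lowPart, map_sub, map_sub, hz, sub_eq_zero]
    exact h1
  have h3 := L.eq_graphMap hN (x := x) (y := ⟨z - x, hmem⟩) fun u hu => by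
    rw [add_sub_cancel, dAction, pairing_apply, ← L.loopToL2_gradC hz, h2, lowC_apply,
      inner_loopToL2_lowPart_J2_velL _ hu]
  apply loopToL2_injective
  rw [← L.velL_graph, ← hz, ← h3, add_sub_cancel]

/-- Near `x` the velocity is the local inverse of `eulerMap` applied to the low part of `x'`. Since
uniqueness in `eq_velC` is global, no prior continuity of `velC` into `C⁰` is needed to identify the
two. -/
theorem contDiff_velC {N : ℕ} (hN : 0 < L.convexity N) : ContDiff ℝ ∞ (L.velC hN) := by
  rw [contDiff_iff_contDiffAt]
  intro x
  set v := L.velC hN x with hv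
  have hz := L.velL_graph hN x
  let e : C(UnitAddCircle, PhaseSpace n) ≃L[ℝ] C(UnitAddCircle, PhaseSpace n) :=
    ContinuousLinearEquiv.ofBijective (L.dEulerMap N v)
      (LinearMap.ker_eq_bot.2 (L.dEulerMap_injective hN hz))
      (LinearMap.range_eq_top.2 (L.dEulerMap_surjective hN hz))
  have hc : ContDiffAt ℝ ∞ (L.eulerMap N) v := (L.contDiff_eulerMap N).contDiffAt
  have hd : HasFDerivAt (L.eulerMap N)
      (e : C(UnitAddCircle, PhaseSpace n) →L[ℝ] C(UnitAddCircle, PhaseSpace n)) v :=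
    L.hasFDerivAt_eulerMap N v
  have hn : (∞ : WithTop ℕ∞) ≠ 0 := by simp
  obtain ⟨g, hinv, hright⟩ : ∃ g, ContDiffAt ℝ ∞ g (L.eulerMap N v) ∧
      ∀ᶠ w in 𝓝 (L.eulerMap N v), L.eulerMap N (g w) = w :=
    ⟨_, hc.to_localInverse hd hn, (hc.hasStrictFDerivAt' hd hn).eventually_right_inverse⟩
  have hlow : ContDiff ℝ ∞ fun x : H1 n => lowPart N (velL x) :=
    ((lowPart N).comp (velL (n := n)).toContinuousLinearMap).contDiff
  rw [hv, L.eulerMap_velC hN] at hinv hright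
  refine (hinv.comp x hlow.contDiffAt).congr_of_eventuallyEq ?_
  filter_upwards [hlow.continuous.continuousAt.eventually hright] with x' hx'
  exact (L.eq_velC hN hx').symm

theorem graph_eq_primitive {N : ℕ} (hN : 0 < L.convexity N) (x : H1 n) :
    x + (L.graphMap hN x : H1 n) = primitive (loopToL2 (L.velC hN x)) := by
  rw [← L.velL_graph, primitive_velL]

theorem contDiff_graph {N : ℕ} (hN : 0 < L.convexity N) :
    ContDiff ℝ ∞ fun x : H1 n => x + (L.graphMap hN x : H1 n) := by
  rw [funext (L.graph_eq_primitive hN)]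
  exact (primitive.comp loopToL2).contDiff.comp (L.contDiff_velC hN)

end LegendrePair

/-! ### Smooth families of loops -/

section SmoothFamily

/-- The total time derivative `(t, z, z') ↦ d/dt f(t, z(t))`. -/
def PeriodicMap.total {F F' : Type} [NormedAddCommGroup F] [NormedSpace ℝ F]
    [NormedAddCommGroup F'] [NormedSpace ℝ F'] (f : PeriodicMap F F') :
    PeriodicMap (F × F) F' where
  toFun t p := fderiv ℝ (fun q : ℝ × F => f.toFun q.1 q.2) (t, p.1) (1, p.2)
  contDiff := by
    have h : ContDiff ℝ ∞ (fderiv ℝ (fun q : ℝ × F => f.toFun q.1 q.2)) :=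
      f.contDiff.fderiv_right (by simp)
    exact (h.comp (contDiff_fst.prodMk (contDiff_fst.comp contDiff_snd))).clm_apply
      (contDiff_const.prodMk (contDiff_snd.comp contDiff_snd))
  periodic t p := by
    have h : (fun q : ℝ × F => f.toFun (q + (1, 0)).1 (q + (1, 0)).2) =
        fun q : ℝ × F => f.toFun q.1 q.2 := funext fun q => by
      simp [f.periodic]
    have h2 := fderiv_comp_add_right (𝕜 := ℝ) (f := fun q : ℝ × F => f.toFun q.1 q.2)
      (x := (t, p.1)) (1, 0)
    rw [h] at h2
    rw [h2]
    simp

variable {X : Type*} [NormedAddCommGroup X] [NormedSpace ℝ X]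

/-- Families of loops that depend smoothly on the parameter, together with their first `k`
time derivatives. -/
def IsSmoothFamily {F : Type} [NormedAddCommGroup F] [NormedSpace ℝ F] :
    ℕ → (X → C(UnitAddCircle, F)) → Prop
  | 0, q => ContDiff ℝ ∞ q
  | k + 1, q => ContDiff ℝ ∞ q ∧ ∃ q' : X → C(UnitAddCircle, F), IsSmoothFamily k q' ∧
      ∀ x (t : ℝ), HasDerivAt (fun s : ℝ => q x (s : UnitAddCircle)) (q' x (t : UnitAddCircle)) t

namespace IsSmoothFamily

variable {F F' : Type} [NormedAddCommGroup F] [NormedSpace ℝ F]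
  [NormedAddCommGroup F'] [NormedSpace ℝ F']

theorem contDiff {k : ℕ} {q : X → C(UnitAddCircle, F)} (h : IsSmoothFamily k q) :
    ContDiff ℝ ∞ q := by
  cases k with
  | zero => exact h
  | succ k => exact h.1

theorem of_succ {k : ℕ} {q : X → C(UnitAddCircle, F)} (h : IsSmoothFamily (k + 1) q) :
    IsSmoothFamily k q := by
  induction k generalizing q with
  | zero => exact h.1
  | succ k ih =>
    obtain ⟨h1, q', h2, h3⟩ := h
    exact ⟨h1, q', ih h2, h3⟩

theorem add {k : ℕ} {p q : X → C(UnitAddCircle, F)} (hp : IsSmoothFamily k p)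
    (hq : IsSmoothFamily k q) : IsSmoothFamily k (fun x => p x + q x) := by
  induction k generalizing p q with
  | zero => exact ContDiff.add hp hq
  | succ k ih =>
    obtain ⟨h1, p', h2, h3⟩ := hp
    obtain ⟨h1', q', h2', h3'⟩ := hq
    exact ⟨h1.add h1', fun x => p' x + q' x, ih h2 h2', fun x t => (h3 x t).add (h3' x t)⟩

theorem zero (k : ℕ) : IsSmoothFamily k (fun _ : X => (0 : C(UnitAddCircle, F))) := by
  induction k with
  | zero => exact contDiff_const
  | succ k ih => exact ⟨contDiff_const, _, ih, fun x t => hasDerivAt_const t (0 : F)⟩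

theorem sum {ι : Type*} {k : ℕ} {q : ι → X → C(UnitAddCircle, F)} (s : Finset ι)
    (hq : ∀ i ∈ s, IsSmoothFamily k (q i)) : IsSmoothFamily k (fun x => ∑ i ∈ s, q i x) := by
  classical
  induction s using Finset.induction_on with
  | empty => simpa using zero k
  | insert i s hi ih =>
    simp_rw [Finset.sum_insert hi]
    exact (hq i (Finset.mem_insert_self i s)).add
      (ih fun j hj => hq j (Finset.mem_insert_of_mem hj))

theorem clm_comp {k : ℕ} {q : X → C(UnitAddCircle, F)} (A : F →L[ℝ] F')
    (hq : IsSmoothFamily k q) :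
    IsSmoothFamily k (fun x => A.compLeftContinuous ℝ UnitAddCircle (q x)) := by
  induction k generalizing q with
  | zero => exact (A.compLeftContinuous ℝ UnitAddCircle).contDiff.comp hq
  | succ k ih =>
    obtain ⟨h1, q', h2, h3⟩ := hq
    exact ⟨(A.compLeftContinuous ℝ UnitAddCircle).contDiff.comp h1, _, ih h2,
      fun x t => A.hasFDerivAt.comp_hasDerivAt t (h3 x t)⟩

/-- The time derivative of `f(t, q(t))` is the superposition of `f.total` with the pair `(q, q')`,
which has one time derivative less; the induction lets both spaces vary for this reason. -/
theorem superposition {k : ℕ} {q : X → C(UnitAddCircle, F)} (hq : IsSmoothFamily k q)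
    (f : PeriodicMap F F') : IsSmoothFamily k (fun x => f.superposition (q x)) := by
  induction k generalizing F F' q with
  | zero => exact f.contDiff_superposition.comp hq
  | succ k ih =>
    have hq0 := hq.of_succ
    obtain ⟨h1, q', h2, h3⟩ := hq
    have h4 := (hq0.clm_comp (ContinuousLinearMap.inl ℝ F F)).add
      (h2.clm_comp (ContinuousLinearMap.inr ℝ F F))
    refine ⟨f.contDiff_superposition.comp h1, _, ih h4 f.total, fun x t => ?_⟩
    have h5 := (f.contDiff.differentiable (by simp)
      (t, q x (t : UnitAddCircle))).hasFDerivAt.comp_hasDerivAt t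
        ((hasDerivAt_id t).prodMk (h3 x t))
    refine h5.congr_deriv ?_
    rw [PeriodicMap.superposition_coe]
    simp [PeriodicMap.total]

theorem comp_right {Z : Type*} [NormedAddCommGroup Z] [NormedSpace ℝ Z]
    {k : ℕ} {q : X → C(UnitAddCircle, F)} (hq : IsSmoothFamily k q) (A : Z →L[ℝ] X) :
    IsSmoothFamily k (fun z => q (A z)) := by
  induction k generalizing q with
  | zero => exact ContDiff.comp hq A.contDiff
  | succ k ih =>
    obtain ⟨h1, q', h2, h3⟩ := hq
    exact ⟨h1.comp A.contDiff, _, ih h2, fun z => h3 (A z)⟩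

end IsSmoothFamily

variable {n : ℕ}

theorem isSmoothFamily_modeLoop (j : ℤ) {k : ℕ} {c : X → PhaseSpace n} (hc : ContDiff ℝ ∞ c) :
    IsSmoothFamily k (fun x => modeLoop j (c x)) := by
  induction k generalizing c with
  | zero => exact (modeLoop j).contDiff.comp hc
  | succ k ih =>
    refine ⟨(modeLoop j).contDiff.comp hc, _,
      ih (c := fun x => -(2 * Real.pi * j) • J0 n (c x)) ?_, fun x t => ?_⟩
    · exact (-(2 * Real.pi * j) • J0 n).contDiff.comp hc
    · refine (hasDerivAt_mode j (c x) t).congr_of_eventuallyEq (.of_forall fun s => ?_)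
      exact modeLoop_coe j (c x) s

theorem isSmoothFamily_lowPart {N k : ℕ} {w : X → L2 n}
    (hw : ∀ j : ℤ, ContDiff ℝ ∞ fun x => coef j (w x)) :
    IsSmoothFamily k (fun x => lowPart N (w x)) := by
  simp_rw [lowPart_apply]
  exact IsSmoothFamily.sum _ fun j _ => isSmoothFamily_modeLoop _ (hw j)

/-- Integration gains one time derivative, which drives the bootstrap. -/
theorem isSmoothFamily_curveC {k : ℕ} {z : X → H1 n} {v : X → C(UnitAddCircle, PhaseSpace n)}
    (hv : IsSmoothFamily k v) (h : ∀ x, velL (z x) = loopToL2 (v x)) :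
    IsSmoothFamily (k + 1) fun x => curveC (z x) := by
  refine ⟨?_, v, hv, fun x t => ?_⟩
  · have e : (fun x => curveC (z x)) = fun x => primitiveC (v x) :=
      funext fun x => (primitiveC_eq (h x)).symm
    rw [e]
    exact primitiveC.contDiff.comp hv.contDiff
  · simp_rw [curveC_coe]
    exact H1.hasDerivAt_curve (h x) t

/-- A low loop is recovered from finitely many Fourier coefficients, so all its time derivatives
depend linearly and continuously on it. -/
theorem lowPart_curveL {N : ℕ} (x : lowModes n N) :
    lowPart N (curveL (x : H1 n)) = curveC (x : H1 n) := by
  obtain ⟨c, hc⟩ : (x : H1 n) ∈ LinearMap.range (lowParam n N) := by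
    rw [range_lowParam]
    exact x.2
  rw [← hc, lowParam_apply, map_sum, map_sum, map_sum]
  refine Finset.sum_congr rfl fun k _ => ?_
  rw [curveL_modeH (ne_zero_of_mem_Icc k), curveC_modeH (ne_zero_of_mem_Icc k), lowPart_apply,
    Finset.sum_eq_single (k : ℕ)]
  · rw [coef_mode_self]
  · intro j _ hj
    rw [coef_mode_of_ne (by exact_mod_cast hj), map_zero]
  · intro hk
    have := (Finset.mem_Icc.1 k.2).2
    exact absurd (Finset.mem_range.2 (by omega)) hk

theorem isSmoothFamily_curveC_lowModes (N k : ℕ) :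
    IsSmoothFamily k fun x : lowModes n N => curveC (x : H1 n) := by
  simp_rw [← lowPart_curveL]
  exact isSmoothFamily_lowPart fun j =>
    ((coef j).comp (curveL.comp (lowModes n N).subtypeL)).contDiff

end SmoothFamily

/-! ### Maps into `C^k(𝕋)` -/

namespace CkLoop

variable {n k : ℕ}

theorem norm_iteratedDeriv_le (f : CkLoop n k) {j : ℕ} (hj : j ≤ k) (t : ℝ) :
    ‖iteratedDeriv j (curve f) t‖ ≤ ‖f‖ :=
  ((jet f ⟨j, Nat.lt_succ_of_le hj⟩).norm_coe_le_norm t).trans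
    (norm_le_pi_norm (jet f) ⟨j, Nat.lt_succ_of_le hj⟩)

theorem norm_le {f : CkLoop n k} {C : ℝ} (hC : 0 ≤ C)
    (h : ∀ j ≤ k, ∀ t, ‖iteratedDeriv j (curve f) t‖ ≤ C) : ‖f‖ ≤ C :=
  (pi_norm_le_iff_of_nonneg hC).2 fun j =>
    (BoundedContinuousFunction.norm_le hC).2 fun t => h j (Nat.lt_succ_iff.1 j.2) t

theorem ext_curve {f g : CkLoop n k} (h : ∀ t, curve f t = curve g t) : f = g :=
  Subtype.ext (funext h)

/-- Continuous loops as elements of `C⁰(𝕋)`. -/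
def ofLoop : C(UnitAddCircle, PhaseSpace n) →L[ℝ] CkLoop n 0 :=
  LinearMap.mkContinuous
    { toFun := fun v => ⟨fun t => v (t : UnitAddCircle), fun t => by simp,
        contDiff_zero.2 (v.continuous.comp (AddCircle.continuous_mk' 1))⟩
      map_add' := fun _ _ => rfl
      map_smul' := fun _ _ => rfl } 1 fun v => by
    rw [one_mul]
    refine norm_le (norm_nonneg _) fun j hj t => ?_
    obtain rfl : j = 0 := by omega
    rw [iteratedDeriv_zero]
    exact v.norm_coe_le_norm _

/-- Constant loops. -/
def const : PhaseSpace n →L[ℝ] CkLoop n k :=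
  LinearMap.mkContinuous
    { toFun := fun c => ⟨fun _ => c, fun _ => rfl, contDiff_const⟩
      map_add' := fun _ _ => rfl
      map_smul' := fun _ _ => rfl } 1 fun c => by
    rw [one_mul]
    refine norm_le (norm_nonneg _) fun j _ t => ?_
    change ‖iteratedDeriv j (fun _ => c) t‖ ≤ _
    rw [iteratedDeriv_const]
    split_ifs
    · exact le_rfl
    · simp

theorem curve_const (c : PhaseSpace n) (t : ℝ) : curve (const c : CkLoop n k) t = c := rfl

theorem intervalIntegrable (f : CkLoop n k) (a b : ℝ) :
    IntervalIntegrable (curve f) volume a b :=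
  f.contDiff.continuous.intervalIntegrable a b

/-- The mean of a loop. -/
def mean : CkLoop n k →L[ℝ] PhaseSpace n :=
  LinearMap.mkContinuous
    { toFun := fun f => ∫ t in (0 : ℝ)..1, curve f t
      map_add' := fun f g => by
        simp only [map_add, Pi.add_apply]
        exact intervalIntegral.integral_add (f.intervalIntegrable 0 1) (g.intervalIntegrable 0 1)
      map_smul' := fun r f => by
        simp only [map_smul, Pi.smul_apply, RingHom.id_apply]
        exact intervalIntegral.integral_smul _ _ } 1 fun f => by
    rw [one_mul]
    change ‖∫ t in (0 : ℝ)..1, curve f t‖ ≤ _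
    have := intervalIntegral.norm_integral_le_of_norm_le_const (a := 0) (b := 1) (f := curve f)
      (C := ‖f‖) fun t _ => by simpa using f.norm_iteratedDeriv_le (Nat.zero_le k) t
    simpa using this

theorem mean_apply (f : CkLoop n k) : mean f = ∫ t in (0 : ℝ)..1, curve f t := rfl

theorem hasDerivAt_integral (f : CkLoop n k) (t : ℝ) :
    HasDerivAt (fun t => ∫ s in (0 : ℝ)..t, curve f s) (curve f t) t :=
  intervalIntegral.integral_hasDerivAt_right (f.intervalIntegrable 0 t)
    (f.contDiff.continuous.stronglyMeasurableAtFilter _ _) f.contDiff.continuous.continuousAt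

theorem contDiff_integral (f : CkLoop n k) :
    ContDiff ℝ (k + 1 : ℕ) (fun t => ∫ s in (0 : ℝ)..t, curve f s) := by
  push_cast
  rw [contDiff_succ_iff_deriv]
  refine ⟨fun t => (f.hasDerivAt_integral t).differentiableAt, by simp, ?_⟩
  rw [funext fun t => (f.hasDerivAt_integral t).deriv]
  exact f.contDiff

theorem periodic_integral {f : CkLoop n k} (hf : mean f = 0) :
    Function.Periodic (fun t => ∫ s in (0 : ℝ)..t, curve f s) 1 := by
  intro t
  dsimp only
  rw [← intervalIntegral.integral_add_adjacent_intervals (f.intervalIntegrable 0 t)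
    (f.intervalIntegrable t (t + 1)), f.periodic.intervalIntegral_add_eq t 0, zero_add,
    ← mean_apply, hf, add_zero]

/-- `f` minus its mean. -/
def center : CkLoop n k →L[ℝ] CkLoop n k := ContinuousLinearMap.id ℝ _ - const.comp mean

theorem center_apply (f : CkLoop n k) : center f = f - const (mean f) := rfl

theorem mean_center (f : CkLoop n k) : mean (center f) = 0 := by
  have : mean (const (mean f) : CkLoop n k) = mean f := by
    rw [mean_apply (const _)]
    simp [curve_const]
  rw [center_apply, map_sub, this, sub_self]

/-- The primitive of `f` minus its mean that vanishes at `0`. -/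
def integral : CkLoop n k →L[ℝ] CkLoop n (k + 1) :=
  LinearMap.mkContinuous
    { toFun := fun f => ⟨fun t => ∫ s in (0 : ℝ)..t, curve (center f) s,
        periodic_integral (mean_center f), contDiff_integral _⟩
      map_add' := fun f g => ext_curve fun t => by
        simp only [map_add, Pi.add_apply]
        exact intervalIntegral.integral_add ((center f).intervalIntegrable 0 t)
          ((center g).intervalIntegrable 0 t)
      map_smul' := fun r f => ext_curve fun t => by
        simp only [map_smul, Pi.smul_apply, RingHom.id_apply]
        exact intervalIntegral.integral_smul _ _ } ‖center (n := n) (k := k)‖ fun f => by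
    refine (norm_le (norm_nonneg (center f)) fun j hj t => ?_).trans (center.le_opNorm f)
    change ‖iteratedDeriv j (fun t => ∫ s in (0 : ℝ)..t, curve (center f) s) t‖ ≤ _
    cases j with
    | zero =>
      rw [iteratedDeriv_zero]
      refine periodic_apply_Ico (P := fun y => ‖y‖ ≤ ‖center f‖)
        (periodic_integral (mean_center f)) (fun t ht => ?_) t
      have := intervalIntegral.norm_integral_le_of_norm_le_const (a := 0) (b := t)
        (f := curve (center f)) (C := ‖center f‖)
        fun t _ => by simpa using (center f).norm_iteratedDeriv_le (Nat.zero_le k) t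
      rw [sub_zero, abs_of_nonneg ht.1] at this
      exact this.trans (mul_le_of_le_one_right (norm_nonneg _) ht.2)
    | succ j =>
      rw [iteratedDeriv_succ', funext fun t => ((center f).hasDerivAt_integral t).deriv]
      exact (center f).norm_iteratedDeriv_le (by omega) t

theorem curve_integral (f : CkLoop n k) (t : ℝ) :
    curve (integral f) t = ∫ s in (0 : ℝ)..t, curve (center f) s := rfl

end CkLoop

/-- By induction `Q` is the constant `q(0)` plus the primitive of the `C^k` lift of `q'`. Both are
bounded linear operators applied to smooth data, so the smoothness transfers without further
estimates. -/
theorem IsSmoothFamily.exists_contDiff_ckLoop {X : Type*} [NormedAddCommGroup X]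
    [NormedSpace ℝ X] {n k : ℕ} {q : X → C(UnitAddCircle, PhaseSpace n)}
    (hq : IsSmoothFamily k q) :
    ∃ Q : X → CkLoop n k, (∀ x (t : ℝ), (Q x).curve t = q x (t : UnitAddCircle)) ∧
      ContDiff ℝ ∞ Q := by
  induction k generalizing q with
  | zero => exact ⟨fun x => CkLoop.ofLoop (q x), fun _ _ => rfl, CkLoop.ofLoop.contDiff.comp hq⟩
  | succ k ih =>
    obtain ⟨h1, q', h2, h3⟩ := hq
    obtain ⟨Q', h4, h5⟩ := ih h2
    have hint : ∀ x (t : ℝ), ∫ s in (0 : ℝ)..t, (Q' x).curve s =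
        q x (t : UnitAddCircle) - q x ((0 : ℝ) : UnitAddCircle) := fun x t => by
      rw [funext (h4 x)]
      refine intervalIntegral.integral_eq_sub_of_hasDerivAt (fun s _ => h3 x s) ?_
      rw [← funext (h4 x)]
      exact (Q' x).intervalIntegrable 0 t
    have hmean : ∀ x, CkLoop.mean (Q' x) = 0 := fun x => by
      rw [CkLoop.mean_apply, hint, AddCircle.coe_period, AddCircle.coe_zero, sub_self]
    refine ⟨fun x => CkLoop.const (q x ((0 : ℝ) : UnitAddCircle)) + CkLoop.integral (Q' x),
      fun x t => ?_, ?_⟩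
    · rw [map_add, Pi.add_apply, CkLoop.curve_const, CkLoop.curve_integral, CkLoop.center_apply,
        hmean, map_zero, sub_zero, hint, add_sub_cancel]
    · refine ContDiff.add (CkLoop.const.contDiff.comp ?_) (CkLoop.integral.contDiff.comp h5)
      exact (ContinuousMap.evalCLM ℝ ((0 : ℝ) : UnitAddCircle)).contDiff.comp h1

theorem isSmoothLoop_curve {n : ℕ} {x : H1 n}
    (h : ∀ k, ∃ f : CkLoop n k, f.curve = x.curve) : IsSmoothLoop x.curve := by
  refine ⟨contDiff_infty.2 fun k => ?_, x.isLoopWithVelocity.1⟩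
  obtain ⟨f, hf⟩ := h k
  rw [← hf]
  exact f.contDiff

/-! ### Bootstrapping the smoothness of the graph to all `C^k` -/

namespace LegendrePair

variable {n : ℕ} {H : ℝ → PhaseSpace n → ℝ} (L : LegendrePair H)

theorem velC_eq {N : ℕ} (hN : 0 < L.convexity N) (x : H1 n) :
    L.velC hN x = L.hamMap.superposition (curveC (x + (L.graphMap hN x : H1 n)) +
      lowPart N (loopToL2 (L.gradC (L.velC hN x)))) := by
  rw [L.loopToL2_gradC (L.velL_graph hN x)]
  rfl

/-- In `velC_eq` the right-hand side contains the velocity only through its primitive and through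
finitely many Fourier coefficients of its gradient, so it has one more time derivative than the
velocity is known to have. -/
theorem isSmoothFamily_velC {N : ℕ} (hN : 0 < L.convexity N) (k : ℕ) :
    IsSmoothFamily k (L.velC hN) := by
  induction k with
  | zero => exact L.contDiff_velC hN
  | succ k ih =>
    rw [funext (L.velC_eq hN)]
    refine IsSmoothFamily.superposition (IsSmoothFamily.add
      (isSmoothFamily_curveC ih (L.velL_graph hN)) (isSmoothFamily_lowPart fun j => ?_)) _
    exact ((coef j).comp loopToL2).contDiff.comp (L.contDiff_gradC.comp (L.contDiff_velC hN))

theorem isSmoothFamily_graph {N : ℕ} (hN : 0 < L.convexity N) (k : ℕ) :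
    IsSmoothFamily k fun x : H1 n => curveC (x + (L.graphMap hN x : H1 n)) :=
  (isSmoothFamily_curveC (L.isSmoothFamily_velC hN k) (L.velL_graph hN)).of_succ

theorem exists_contDiff_graphMap_ckLoop {N : ℕ} (hN : 0 < L.convexity N) (k : ℕ) :
    ∃ Yk : lowModes n N → CkLoop n k,
      (∀ x : lowModes n N, (Yk x).curve = (L.graphMap hN (x : H1 n) : H1 n).curve) ∧
        ContDiff ℝ ∞ Yk := by
  have h1 := IsSmoothFamily.comp_right (L.isSmoothFamily_graph hN k) (lowModes n N).subtypeL
  have h2 := (isSmoothFamily_curveC_lowModes (n := n) N k).clm_comp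
    (-ContinuousLinearMap.id ℝ (PhaseSpace n))
  obtain ⟨Q, h3, h4⟩ := (h1.add h2).exists_contDiff_ckLoop
  refine ⟨Q, fun x => funext fun t => ?_, h4⟩
  rw [h3]
  simp [curveC_coe]

theorem isSmoothLoop_graph {N : ℕ} (hN : 0 < L.convexity N) (x : H1 n) :
    IsSmoothLoop (x + (L.graphMap hN x : H1 n)).curve :=
  isSmoothLoop_curve fun k => by
    obtain ⟨Q, h, -⟩ := (L.isSmoothFamily_graph hN k).exists_contDiff_ckLoop
    exact ⟨Q x, funext fun t => (h x t).trans (curveC_coe _ t)⟩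

theorem isSmoothLoop_graphMap {N : ℕ} (hN : 0 < L.convexity N) (x : lowModes n N) :
    IsSmoothLoop (L.graphMap hN (x : H1 n) : H1 n).curve :=
  isSmoothLoop_curve fun k => by
    obtain ⟨Yk, h, -⟩ := L.exists_contDiff_graphMap_ckLoop hN k
    exact ⟨Yk x, h x⟩

end LegendrePair

/-! ### Submanifolds covered by one graph chart -/

/-- A smooth parametrization of a subset of a normed space by a Euclidean space, inverted by the
restriction of a linear projection. -/
structure SmoothGraph {V : Type} [NormedAddCommGroup V] [NormedSpace ℝ V] (d : ℕ) (S : Set V) where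
  param : EuclideanSpace ℝ (Fin d) → V
  contDiff : ContDiff ℝ ∞ param
  proj : V →L[ℝ] EuclideanSpace ℝ (Fin d)
  incl : EuclideanSpace ℝ (Fin d) →L[ℝ] V
  proj_param : ∀ ξ, proj (param ξ) = ξ
  proj_incl : ∀ ξ, proj (incl ξ) = ξ
  range_param : range param = S

namespace SmoothGraph

variable {V : Type} [NormedAddCommGroup V] [NormedSpace ℝ V] {d : ℕ} {S : Set V}
  (G : SmoothGraph d S)

theorem param_proj {z : V} (hz : z ∈ S) : G.param (G.proj z) = z := by
  rw [← G.range_param] at hz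
  obtain ⟨ξ, rfl⟩ := hz
  rw [G.proj_param]

/-- The parametrization as a map into the subset. -/
def point (ξ : EuclideanSpace ℝ (Fin d)) : S := 
  ⟨G.param ξ, G.range_param.subset (mem_range_self ξ)⟩

theorem point_proj (z : S) : G.point (G.proj z) = z := Subtype.ext (G.param_proj z.2)

/-- The global chart. -/
def homeo : S ≃ₜ EuclideanSpace ℝ (Fin d) where
  toFun z := G.proj z
  invFun := G.point
  left_inv := G.point_proj
  right_inv := G.proj_param
  continuous_toFun := G.proj.continuous.comp continuous_subtype_val
  continuous_invFun := G.contDiff.continuous.subtype_mk _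

/-- The manifold structure given by the global chart. -/
@[reducible]
def chartedSpace : ChartedSpace (EuclideanSpace ℝ (Fin d)) S :=
  G.homeo.toOpenPartialHomeomorph.singletonChartedSpace rfl

theorem isManifold :
    letI := G.chartedSpace
    IsManifold (𝓡 d) ∞ S :=
  OpenPartialHomeomorph.isManifold_singleton _ rfl

/-- The diffeomorphism of the ambient space that straightens the graph. -/
def straighten : V ≃ₜ V where
  toFun h := h - G.param (G.proj h) + G.incl (G.proj h)
  invFun h := h + G.param (G.proj h) - G.incl (G.proj h)
  left_inv h := by
    simp only [map_add, map_sub, G.proj_param, G.proj_incl, sub_self, zero_add]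
    abel
  right_inv h := by
    simp only [map_add, map_sub, G.proj_param, G.proj_incl, add_sub_cancel_right]
    abel
  continuous_toFun := by
    have := G.contDiff.continuous
    fun_prop
  continuous_invFun := by
    have := G.contDiff.continuous
    fun_prop

theorem contDiff_straighten : ContDiff ℝ ∞ G.straighten :=
  (contDiff_id.sub (G.contDiff.comp G.proj.contDiff)).add (G.incl.comp G.proj).contDiff

theorem contDiff_straighten_symm : ContDiff ℝ ∞ G.straighten.symm :=
  (contDiff_id.add (G.contDiff.comp G.proj.contDiff)).sub (G.incl.comp G.proj).contDiff

theorem straighten_param (ξ : EuclideanSpace ℝ (Fin d)) : G.straighten (G.param ξ) = G.incl ξ := by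
  change G.param ξ - G.param (G.proj (G.param ξ)) + G.incl (G.proj (G.param ξ)) = _
  rw [G.proj_param]
  simp

theorem toOpenPartialHomeomorph_mem_maximalAtlas {W : Type*} [NormedAddCommGroup W]
    [NormedSpace ℝ W] (e : W ≃ₜ W) (he : ContDiff ℝ ∞ e) (he' : ContDiff ℝ ∞ e.symm) :
    e.toOpenPartialHomeomorph ∈ IsManifold.maximalAtlas 𝓘(ℝ, W) ∞ W := by
  have h : e.toOpenPartialHomeomorph ∈ contDiffGroupoid ∞ 𝓘(ℝ, W) := by
    rw [contDiffGroupoid, mem_groupoid_of_pregroupoid]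
    exact ⟨he.contDiffOn, he'.contDiffOn⟩
  exact StructureGroupoid.mem_maximalAtlas_of_mem_groupoid _ h

/-- The splitting of the ambient space that belongs to the linear projection. -/
def splitting : (EuclideanSpace ℝ (Fin d) × LinearMap.ker G.proj.toLinearMap) ≃L[ℝ] V :=
  (ContinuousLinearEquiv.equivOfRightInverse G.proj G.incl G.proj_incl).symm

theorem splitting_apply_zero (ξ : EuclideanSpace ℝ (Fin d)) :
    G.splitting (ξ, 0) = G.incl ξ := by
  simp [splitting]

/-- In the global chart of `S` and the straightening chart of the ambient space the inclusion is `ξ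
↦ incl ξ`, the first factor of `splitting`. -/
theorem isSmoothEmbedding :
    letI := G.chartedSpace
    Manifold.IsSmoothEmbedding (𝓡 d) 𝓘(ℝ, V) ∞ (Subtype.val : S → V) := by
  let := G.chartedSpace
  have := G.isManifold
  refine ⟨Manifold.IsImmersionOfComplement.isImmersion
    (F := LinearMap.ker G.proj.toLinearMap) fun z => ?_, Topology.IsEmbedding.subtypeVal⟩
  refine Manifold.IsImmersionAtOfComplement.mk_of_charts G.splitting
    G.homeo.toOpenPartialHomeomorph G.straighten.toOpenPartialHomeomorph (mem_univ _)
    (mem_univ _) ?_ (toOpenPartialHomeomorph_mem_maximalAtlas _ G.contDiff_straighten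
      G.contDiff_straighten_symm) (fun _ _ => mem_univ _) fun ξ _ => ?_
  · exact IsManifold.chart_mem_maximalAtlas (I := 𝓡 d) (n := ∞) z
  · rw [Function.comp_apply (f := G.splitting), G.splitting_apply_zero, ← G.straighten_param]
    rfl

variable {W : Type*} [NormedAddCommGroup W] [NormedSpace ℝ W]

theorem contMDiff_of_comp {f : S → W} (hf : ContDiff ℝ ∞ (f ∘ G.point)) :
    letI := G.chartedSpace
    ContMDiff (𝓡 d) 𝓘(ℝ, W) ∞ f := by
  let := G.chartedSpace
  have := G.isManifold
  rw [contMDiff_iff]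
  refine ⟨?_, fun x y => ?_⟩
  · have : f = (f ∘ G.point) ∘ G.homeo := funext fun z => by
      change f z = f (G.point (G.proj z))
      rw [G.point_proj]
    rw [this]
    exact hf.continuous.comp G.homeo.continuous
  · exact hf.contDiffOn

theorem hasMFDerivAt_iff {f : S → W} {z : S} {f' : EuclideanSpace ℝ (Fin d) →L[ℝ] W} :
    letI := G.chartedSpace
    HasMFDerivAt (𝓡 d) 𝓘(ℝ, W) f z f' ↔ HasFDerivAt (f ∘ G.point) f' (G.proj z) := by
  let := G.chartedSpace
  -- The chart is the same at every point and is global, so the manifold derivative unfolds to the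
  -- derivative of `f ∘ point`.
  have h : HasMFDerivAt (𝓡 d) 𝓘(ℝ, W) f z f' ↔ ContinuousAt f z ∧
      HasFDerivWithinAt (f ∘ G.point) f' (range id) (G.proj z) := Iff.rfl
  rw [h, range_id, hasFDerivWithinAt_univ]
  refine ⟨fun h => h.2, fun h => ⟨?_, h⟩⟩
  have e : f = (f ∘ G.point) ∘ G.homeo := funext fun z => by
    change f z = f (G.point (G.proj z))
    rw [G.point_proj]
  rw [e]
  exact ContinuousAt.comp (x := z) h.continuousAt G.homeo.continuous.continuousAt

theorem mfderiv_eq {f : S → W} (hf : ContDiff ℝ ∞ (f ∘ G.point)) (z : S) :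
    letI := G.chartedSpace
    mfderiv (𝓡 d) 𝓘(ℝ, W) f z = fderiv ℝ (f ∘ G.point) (G.proj z) := by
  let := G.chartedSpace
  exact (G.hasMFDerivAt_iff.2 (hf.differentiable (by simp) _).hasFDerivAt).mfderiv

end SmoothGraph

/-! ### Index and nullity of a reduced functional -/

section Reduction

variable {V E : Type} [NormedAddCommGroup V] [NormedSpace ℝ V] [NormedAddCommGroup E]
  [NormedSpace ℝ E]

theorem hasDerivAt_line {W : Type*} [NormedAddCommGroup W] [NormedSpace ℝ W]
    {f : E → V →L[ℝ] W} {x : E} (hf : DifferentiableAt ℝ f x) (u : E) :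
    HasDerivAt (fun s : ℝ => f (x + s • u)) (fderiv ℝ f x u) 0 :=
  hf.hasFDerivAt.hasLineDerivAt u

/-- A chain rule along curves without Fréchet differentiability: replacing the curve by its tangent
line changes a Lipschitz map by only `o(s)`. -/
theorem hasDerivAt_comp_of_hasLineDerivAt {W : Type*} [NormedAddCommGroup W] [NormedSpace ℝ W]
    {A : V → W} {C : ℝ} (hC : ∀ x y, ‖A x - A y‖ ≤ C * ‖x - y‖) {z v : V} {a : W}
    (hA : HasLineDerivAt ℝ A a z v) {γ : ℝ → V} (hγ : HasDerivAt γ v 0) (h0 : γ 0 = z) :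
    HasDerivAt (fun s => A (γ s)) a 0 := by
  have h1 : HasDerivAt (fun s : ℝ => A (z + s • v)) a 0 := hA
  rw [hasDerivAt_iff_isLittleO_nhds_zero] at h1 hγ ⊢
  simp only [zero_add, zero_smul, add_zero, h0] at h1 hγ ⊢
  have h2 : (fun s : ℝ => A (γ s) - A (z + s • v)) =o[𝓝 0] fun s : ℝ => s := by
    refine Asymptotics.IsBigO.trans_isLittleO (Asymptotics.IsBigO.of_bound C ?_) hγ
    refine .of_forall fun s => (hC _ _).trans_eq ?_
    rw [sub_sub]
  refine (h2.add h1).congr_left fun s => ?_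
  abel

/-- The second differential of `f` at `z` splits as the sum of a positive form and of the second
differential of `g` at `ξ`. -/
structure IsReductionAt (f : V → ℝ) (z : V) (g : E → ℝ) (ξ : E) (Q : V →L[ℝ] V →L[ℝ] ℝ)
    (T : E →L[ℝ] V) (p : V →L[ℝ] E) : Prop where
  left_inv : ∀ u, p (T u) = u
  secondDiff_eq : ∀ v, secondDiff f z v = Q v
  secondDiff_comp : ∀ u, secondDiff g ξ u = (Q (T u)).comp T
  symm : ∀ u v, Q u v = Q v u
  apply_ker : ∀ u h, p h = 0 → Q (T u) h = 0
  pos : ∀ h, p h = 0 → h ≠ 0 → 0 < Q h h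

namespace IsReductionAt

variable {f : V → ℝ} {z : V} {g : E → ℝ} {ξ : E} {Q : V →L[ℝ] V →L[ℝ] ℝ} {T : E →L[ℝ] V}
  {p : V →L[ℝ] E} (R : IsReductionAt f z g ξ Q T p)

include R

theorem injective : Function.Injective T := Function.LeftInverse.injective R.left_inv

theorem map_sub_eq_zero (v : V) : p (v - T (p v)) = 0 := by rw [map_sub, R.left_inv, sub_self]

/-- Pythagoras for `Q`: the range of `T` and the kernel of `p` are complementary and `Q`-orthogonal.
-/
theorem apply_self (v : V) : Q v v = Q (T (p v)) (T (p v)) + Q (v - T (p v)) (v - T (p v)) := by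
  have h1 := R.apply_ker (p v) _ (R.map_sub_eq_zero v)
  have h2 := h1
  rw [R.symm] at h2
  simp only [map_sub, sub_apply] at h1 h2 ⊢
  linarith

theorem nonneg {h : V} (hh : p h = 0) : 0 ≤ Q h h := by
  rcases eq_or_ne h 0 with rfl | h0
  · simp
  · exact (R.pos h hh h0).le

/-- On a negative subspace `p` is injective, since `Q` is nonnegative on its kernel, and dropping
the kernel component only lowers `Q`; conversely `T` carries negative subspaces to negative
subspaces. -/
theorem morseIndex_eq : morseIndex f z = morseIndex g ξ := by
  refine le_antisymm ?_ ?_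
  · refine iSup₂_le fun W hW => ?_
    obtain ⟨hfd, hneg⟩ := hW
    set B := p.toLinearMap.domRestrict W with hB
    have hinj : Function.Injective B := by
      refine (injective_iff_map_eq_zero B).2 fun w hw => ?_
      by_contra h0
      have h1 := hneg w w.2 (by simpa using h0)
      rw [R.secondDiff_eq] at h1
      exact absurd (R.nonneg (h := (w : V)) hw) h1.not_ge
    rw [← LinearMap.finrank_range_of_inj hinj]
    refine le_iSup₂_of_le (LinearMap.range B) ⟨inferInstance, ?_⟩ le_rfl
    rintro _ ⟨w, rfl⟩ h0
    have hw0 : (w : V) ≠ 0 := by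
      rintro h
      exact h0 (by rw [(Subtype.ext h : w = 0), map_zero])
    have h1 := hneg w w.2 hw0
    rw [R.secondDiff_eq, R.apply_self] at h1
    have h2 := R.nonneg (R.map_sub_eq_zero (w : V))
    rw [R.secondDiff_comp]
    change Q (T (p w)) (T (p w)) < 0
    linarith
  · refine iSup₂_le fun W hW => ?_
    obtain ⟨hfd, hneg⟩ := hW
    rw [LinearEquiv.finrank_eq (Submodule.equivMapOfInjective T.toLinearMap R.injective W)]
    refine le_iSup₂_of_le (W.map T.toLinearMap) ⟨inferInstance, ?_⟩ le_rfl
    rintro _ ⟨w, hw, rfl⟩ h0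
    have h1 := hneg w hw (by rintro rfl; exact h0 (map_zero _))
    rw [R.secondDiff_comp] at h1
    rw [R.secondDiff_eq]
    exact h1

/-- A null vector has no component in the kernel of `p`, because `Q` is positive there and
orthogonal to the range of `T`. So `T` maps one kernel onto the other. -/
theorem nullity_eq : nullity f z = nullity g ξ := by
  have hset : {v : V | secondDiff f z v = 0} = T '' {u : E | secondDiff g ξ u = 0} := by
    ext v
    simp only [mem_ofPred_eq, mem_image, R.secondDiff_eq, R.secondDiff_comp]
    constructor
    · intro hv
      have h0 := R.map_sub_eq_zero v
      have h1 : v - T (p v) = 0 := by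
        by_contra hne
        have h2 := R.pos _ h0 hne
        have h3 := R.apply_ker (p v) _ h0
        rw [map_sub Q, sub_apply, hv, h3] at h2
        simp at h2
      rw [sub_eq_zero] at h1
      exact ⟨p v, by rw [← h1, hv, ContinuousLinearMap.zero_comp], h1.symm⟩
    · rintro ⟨u, hu, rfl⟩
      ext v
      have h1 := R.apply_ker u _ (R.map_sub_eq_zero v)
      rw [map_sub, sub_eq_zero] at h1
      rw [h1]
      exact congrArg (fun A => A (p v)) hu
  rw [nullity, nullity, hset]
  congr 1
  have h : Submodule.span ℝ (T '' {u : E | secondDiff g ξ u = 0}) =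
      (Submodule.span ℝ {u : E | secondDiff g ξ u = 0}).map T.toLinearMap :=
    Submodule.span_image T.toLinearMap
  rw [h]
  exact (LinearEquiv.rank_eq (Submodule.equivMapOfInjective T.toLinearMap R.injective _)).symm

end IsReductionAt

end Reduction

/-! ### The reduced dual action -/

/-- The integral of a continuous loop. -/
def loopIntegral : C(UnitAddCircle, ℝ) →L[ℝ] ℝ :=
  LinearMap.mkContinuous
    { toFun := fun f => ∫ t in (0 : ℝ)..1, f (t : UnitAddCircle)
      map_add' := fun f g => intervalIntegral.integral_add
        ((f.continuous.comp (AddCircle.continuous_mk' 1)).intervalIntegrable 0 1)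
        ((g.continuous.comp (AddCircle.continuous_mk' 1)).intervalIntegrable 0 1)
      map_smul' := fun r f => intervalIntegral.integral_smul r fun t : ℝ =>
        f (t : UnitAddCircle) } 1 fun f => by
    have := intervalIntegral.norm_integral_le_of_norm_le_const (a := 0) (b := 1)
      (f := fun t : ℝ => f (t : UnitAddCircle)) (C := ‖f‖) fun t _ => f.norm_coe_le_norm _
    simpa using this

/-- Coordinates on the low modes. -/
def lowEquiv (n N : ℕ) : lowModes n N ≃L[ℝ] EuclideanSpace ℝ (Fin (2 * n * N)) :=
  ContinuousLinearEquiv.ofFinrankEq (by rw [finrank_lowModes, finrank_euclideanSpace_fin])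

/-- The coordinates of the low modes of a loop. -/
def lowCoord (n N : ℕ) : H1 n →L[ℝ] EuclideanSpace ℝ (Fin (2 * n * N)) :=
  (lowEquiv n N : lowModes n N →L[ℝ] EuclideanSpace ℝ (Fin (2 * n * N))).comp
    (lowModes n N).orthogonalProjectionOnto

theorem lowCoord_lowModes {n N : ℕ} (x : lowModes n N) : lowCoord n N x = lowEquiv n N x := by
  simp [lowCoord]

theorem lowCoord_eq_zero_iff {n N : ℕ} {x : H1 n} : lowCoord n N x = 0 ↔ x ∈ highModes n N := by
  rw [highModes_eq_orthogonal, ← Submodule.orthogonalProjectionOnto_eq_zero_iff]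
  exact (lowEquiv n N).map_eq_zero_iff

namespace LegendrePair

variable {n : ℕ} {H : ℝ → PhaseSpace n → ℝ} (L : LegendrePair H)

/-- On the graph the velocity depends smoothly on the base point in the sup norm, where the
superposition operator of `H*` is smooth; this is how the limited differentiability on `ℍ₁` is
bypassed. -/
theorem contDiff_dualAction_graph {N : ℕ} (hN : 0 < L.convexity N) :
    ContDiff ℝ ∞ fun x : H1 n => dualAction H (x + (L.graphMap hN x : H1 n)) := by
  have e : (fun x : H1 n => dualAction H (x + (L.graphMap hN x : H1 n))) = fun x =>
      -(1 / 2) * innerR (L2 n) (J2 (velL (x + (L.graphMap hN x : H1 n))))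
        (curveL (x + (L.graphMap hN x : H1 n))) +
      loopIntegral (L.conj.superposition (JC (L.velC hN x))) := funext fun x => by
    rw [L.dualAction_eq, L.velL_graph, J2_loopToL2, conjInt, innerR_apply]
    congr 1
    change _ = ∫ t in (0 : ℝ)..1, L.conj.superposition (JC (L.velC hN x)) (t : UnitAddCircle)
    rw [intervalIntegral.integral_of_le zero_le_one]
    refine integral_congr_ae ?_
    filter_upwards [coeFn_loopToL2 (JC (L.velC hN x))] with t ht
    rw [L.conj.superposition_coe, ← ht]
    rfl
  rw [e]
  have h1 : ContDiff ℝ ∞ fun x : H1 n => innerR (L2 n)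
      (J2 (velL (x + (L.graphMap hN x : H1 n)))) :=
    ((innerR (L2 n)).comp (J2.comp (velL (n := n)).toContinuousLinearMap)).contDiff.comp
      (L.contDiff_graph hN)
  refine (contDiff_const.mul (h1.clm_apply (curveL.contDiff.comp (L.contDiff_graph hN)))).add ?_
  exact loopIntegral.contDiff.comp (L.conj.contDiff_superposition.comp
    (JC.contDiff.comp (L.contDiff_velC hN)))

theorem lowCoord_graph {N : ℕ} (hN : 0 < L.convexity N) (x : H1 n) :
    lowCoord n N (x + (L.graphMap hN x : H1 n)) = lowCoord n N x := by
  rw [map_add, lowCoord_eq_zero_iff.2 (L.graphMap hN x).2, add_zero]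

/-- The graph of the minimizers as a smooth graph in the sense of `SmoothGraph`. -/
def smoothGraph {N : ℕ} (hN : 0 < L.convexity N) :
    SmoothGraph (2 * n * N) (graphSet fun x : lowModes n N => L.graphMap hN (x : H1 n)) where
  param ξ := ((lowEquiv n N).symm ξ : H1 n) + (L.graphMap hN ((lowEquiv n N).symm ξ : H1 n) : H1 n)
  contDiff := (L.contDiff_graph hN).comp
    ((lowModes n N).subtypeL.comp ((lowEquiv n N).symm :
      EuclideanSpace ℝ (Fin (2 * n * N)) →L[ℝ] lowModes n N)).contDiff
  proj := lowCoord n N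
  incl := (lowModes n N).subtypeL.comp ((lowEquiv n N).symm :
    EuclideanSpace ℝ (Fin (2 * n * N)) →L[ℝ] lowModes n N)
  proj_param ξ := by
    rw [lowCoord_graph, lowCoord_lowModes, ContinuousLinearEquiv.apply_symm_apply]
  proj_incl ξ := by
    change lowCoord n N ((lowEquiv n N).symm ξ : H1 n) = ξ
    rw [lowCoord_lowModes, ContinuousLinearEquiv.apply_symm_apply]
  range_param := by
    ext z
    constructor
    · rintro ⟨ξ, rfl⟩
      exact ⟨_, rfl⟩
    · rintro ⟨x, rfl⟩
      exact ⟨lowEquiv n N x, by simp⟩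

theorem contDiff_reduced {N : ℕ} (hN : 0 < L.convexity N) :
    ContDiff ℝ ∞ (dualAction H ∘ (L.smoothGraph hN).param) :=
  (L.contDiff_dualAction_graph hN).comp (L.smoothGraph hN).incl.contDiff

/-- The differential of the parametrization of the graph. -/
def tangent {N : ℕ} (hN : 0 < L.convexity N) (ξ : EuclideanSpace ℝ (Fin (2 * n * N))) :
    EuclideanSpace ℝ (Fin (2 * n * N)) →L[ℝ] H1 n :=
  fderiv ℝ (L.smoothGraph hN).param ξ

theorem hasFDerivAt_param {N : ℕ} (hN : 0 < L.convexity N)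
    (ξ : EuclideanSpace ℝ (Fin (2 * n * N))) :
    HasFDerivAt (L.smoothGraph hN).param (L.tangent hN ξ) ξ :=
  ((L.smoothGraph hN).contDiff.differentiable (by simp) ξ).hasFDerivAt

theorem lowCoord_tangent {N : ℕ} (hN : 0 < L.convexity N)
    (ξ u : EuclideanSpace ℝ (Fin (2 * n * N))) : lowCoord n N (L.tangent hN ξ u) = u := by
  have h1 := (lowCoord n N).hasFDerivAt.comp ξ (L.hasFDerivAt_param hN ξ)
  have h2 : lowCoord n N ∘ (L.smoothGraph hN).param = id := funext (L.smoothGraph hN).proj_param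
  rw [h2] at h1
  exact congrArg (fun A => A u) (h1.unique (hasFDerivAt_id ξ))

theorem dAction_param {N : ℕ} (hN : 0 < L.convexity N)
    (ξ : EuclideanSpace ℝ (Fin (2 * n * N))) {u : H1 n} (hu : u ∈ highModes n N) :
    L.dAction ((L.smoothGraph hN).param ξ) u = 0 :=
  L.dAction_graphMap hN _ hu

/-- Two vectors with equal low coordinates differ by a high one, on which the differential vanishes.
Hence tangent vectors of the graph determine the whole differential, both for critical points and
for Palais–Smale. -/
theorem dAction_param_apply {N : ℕ} (hN : 0 < L.convexity N)
    (ξ : EuclideanSpace ℝ (Fin (2 * n * N))) (h : H1 n) :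
    L.dAction ((L.smoothGraph hN).param ξ) h =
      L.dAction ((L.smoothGraph hN).param ξ) (L.tangent hN ξ (lowCoord n N h)) := by
  rw [← sub_eq_zero, ← map_sub]
  refine L.dAction_param hN ξ (lowCoord_eq_zero_iff.1 ?_)
  rw [map_sub, lowCoord_tangent, sub_self]

theorem hasFDerivAt_reduced {N : ℕ} (hN : 0 < L.convexity N)
    (ξ : EuclideanSpace ℝ (Fin (2 * n * N))) :
    HasFDerivAt (dualAction H ∘ (L.smoothGraph hN).param)
      ((L.dAction ((L.smoothGraph hN).param ξ)).comp (L.tangent hN ξ)) ξ :=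
  (L.hasFDerivAt_dualAction _).comp ξ (L.hasFDerivAt_param hN ξ)

theorem isCritical_dualAction_iff (z : H1 n) : IsCritical (dualAction H) z ↔ L.dAction z = 0 := by
  refine ⟨fun h => (L.hasFDerivAt_dualAction z).unique h, fun h => ?_⟩
  rw [IsCritical, ← h]
  exact L.hasFDerivAt_dualAction z

theorem isCritical_param_iff {N : ℕ} (hN : 0 < L.convexity N)
    (ξ : EuclideanSpace ℝ (Fin (2 * n * N))) :
    IsCritical (dualAction H) ((L.smoothGraph hN).param ξ) ↔
      HasFDerivAt (dualAction H ∘ (L.smoothGraph hN).param)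
        (0 : EuclideanSpace ℝ (Fin (2 * n * N)) →L[ℝ] ℝ) ξ := by
  rw [L.isCritical_dualAction_iff]
  constructor
  · intro h
    have := L.hasFDerivAt_reduced hN ξ
    rwa [h, ContinuousLinearMap.zero_comp] at this
  · intro h
    have h1 := (L.hasFDerivAt_reduced hN ξ).unique h
    ext u
    rw [L.dAction_param_apply]
    exact congrArg (fun A => A (lowCoord n N u)) h1

theorem mem_graphSet_of_isCritical {N : ℕ} (hN : 0 < L.convexity N) {z : H1 n}
    (h : IsCritical (dualAction H) z) :
    z ∈ graphSet fun x : lowModes n N => L.graphMap hN (x : H1 n) := by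
  rw [L.isCritical_dualAction_iff] at h
  set x := (lowModes n N).orthogonalProjectionOnto z
  have hmem : z - (x : H1 n) ∈ highModes n N := by
    rw [highModes_eq_orthogonal]
    exact Submodule.sub_starProjection_mem_orthogonal z
  refine ⟨x, ?_⟩
  have := L.eq_graphMap hN (x := (x : H1 n)) (y := ⟨z - x, hmem⟩) fun u _ => by
    rw [add_sub_cancel, h, zero_apply]
  dsimp only
  rw [← this, add_sub_cancel]

theorem hasDerivAt_dAction_param {N : ℕ} (hN : 0 < L.convexity N)
    (ξ u : EuclideanSpace ℝ (Fin (2 * n * N))) :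
    HasDerivAt (fun s : ℝ => L.dAction ((L.smoothGraph hN).param (ξ + s • u)))
      (L.hess ((L.smoothGraph hN).param ξ) (L.tangent hN ξ u)) 0 := by
  refine hasDerivAt_comp_of_hasLineDerivAt L.norm_dAction_sub_le (L.hasLineDerivAt_dAction _ _)
    ((L.hasFDerivAt_param hN ξ).hasLineDerivAt u) (by simp)

/-- The identity `dAction_param`, for a fixed high `h`, is differentiated along the graph. -/
theorem hess_tangent {N : ℕ} (hN : 0 < L.convexity N)
    (ξ u : EuclideanSpace ℝ (Fin (2 * n * N))) {h : H1 n} (hh : h ∈ highModes n N) :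
    L.hess ((L.smoothGraph hN).param ξ) (L.tangent hN ξ u) h = 0 := by
  have h1 := hasDerivAt_clm_comp (V := H1 n →L[ℝ] ℝ) (ContinuousLinearMap.apply ℝ ℝ h)
    (L.hasDerivAt_dAction_param hN ξ u)
  have h2 : (fun s : ℝ => ContinuousLinearMap.apply ℝ ℝ h
      (L.dAction ((L.smoothGraph hN).param (ξ + s • u)))) = fun _ => 0 :=
    funext fun s => L.dAction_param hN _ hh
  rw [h2] at h1
  exact h1.unique (hasDerivAt_const _ _)

/-- In the product rule the second derivative of the parametrization is composed with the
differential of the action, which is zero at a critical point. -/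
theorem secondDiff_reduced {N : ℕ} (hN : 0 < L.convexity N)
    {ξ : EuclideanSpace ℝ (Fin (2 * n * N))}
    (hξ : IsCritical (dualAction H) ((L.smoothGraph hN).param ξ))
    (u : EuclideanSpace ℝ (Fin (2 * n * N))) :
    secondDiff (dualAction H ∘ (L.smoothGraph hN).param) ξ u =
      (L.hess ((L.smoothGraph hN).param ξ) (L.tangent hN ξ u)).comp (L.tangent hN ξ) := by
  rw [L.isCritical_dualAction_iff] at hξ
  rw [secondDiff, funext fun ξ => (L.hasFDerivAt_reduced hN ξ).fderiv]
  refine HasLineDerivAt.lineDeriv ?_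
  have h1 : DifferentiableAt ℝ (L.tangent hN) ξ :=
    ((L.smoothGraph hN).contDiff.fderiv_right (m := 1) (by
      exact (WithTop.coe_le_coe (α := ℕ∞)).2 le_top)).differentiable (by simp) ξ
  have h2 := hasDerivAt_line h1 u
  have h3 := (L.hasDerivAt_dAction_param hN ξ u).clm_comp h2
  simp only [zero_smul, add_zero, hξ, ContinuousLinearMap.zero_comp] at h3
  exact h3

theorem isReductionAt {N : ℕ} (hN : 0 < L.convexity N)
    {ξ : EuclideanSpace ℝ (Fin (2 * n * N))}
    (hξ : IsCritical (dualAction H) ((L.smoothGraph hN).param ξ)) :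
    IsReductionAt (dualAction H) ((L.smoothGraph hN).param ξ)
      (dualAction H ∘ (L.smoothGraph hN).param) ξ (L.hess ((L.smoothGraph hN).param ξ))
      (L.tangent hN ξ) (lowCoord n N) where
  left_inv := L.lowCoord_tangent hN ξ
  secondDiff_eq := L.secondDiff_dualAction _
  secondDiff_comp := L.secondDiff_reduced hN hξ
  symm := L.hess_symm _
  apply_ker u _ hh := L.hess_tangent hN ξ u (lowCoord_eq_zero_iff.1 hh)
  pos h hh h0 := by
    refine lt_of_lt_of_le ?_ (L.hess_lower _ (lowCoord_eq_zero_iff.1 hh))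
    have := norm_pos_iff.2 h0
    positivity

end LegendrePair

/-! ### The Palais–Smale condition -/

theorem normL2_loop {n : ℕ} (f : C(UnitAddCircle, PhaseSpace n)) :
    normL2 (fun t : ℝ => f (t : UnitAddCircle)) = ‖loopToL2 f‖ := by
  rw [normL2, ← Real.sqrt_sq (norm_nonneg (loopToL2 f)), L2.norm_sq,
    intervalIntegral.integral_of_le zero_le_one, intervalIntegral.integral_of_le zero_le_one]
  congr 1
  refine integral_congr_ae ?_
  filter_upwards [coeFn_loopToL2 f] with t ht
  rw [ht]

namespace LegendrePair

variable {n : ℕ} {H : ℝ → PhaseSpace n → ℝ} (L : LegendrePair H)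

theorem hamMap_lip (t : ℝ) (x y : PhaseSpace n) :
    ‖L.hamMap.toFun t x - L.hamMap.toFun t y‖ ≤ L.upGrad * ‖x - y‖ := by
  change ‖-J0 n (L.grad.toFun t x) - -J0 n (L.grad.toFun t y)‖ ≤ _
  rw [neg_sub_neg, ← map_sub, norm_J0, norm_sub_rev]
  exact L.lip_grad t x y

theorem hamVF_eq (t : ℝ) (z : PhaseSpace n) : hamVF H t z = L.hamMap.toFun t z := by
  rw [hamVF, ← L.grad_eq]
  rfl

/-- The test vector is the `u` with `J₀u' = r`, where `r` is the gradient minus its mean. The mean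
itself pairs to zero with `r`. -/
theorem norm_grad2_sub_mean_le (z : H1 n) :
    ‖L.grad2 z - mode 0 (coef 0 (L.grad2 z))‖ ≤ ‖L.dAction z‖ := by
  set r := L.grad2 z - mode 0 (coef 0 (L.grad2 z)) with hr
  have h0 : coef 0 r = 0 := by rw [hr, map_sub, coef_mode_self, sub_self]
  obtain ⟨u, hu⟩ := exists_velL_eq (-J2 r) (by rw [map_neg, coef_J2, h0, map_zero, neg_zero])
  have h1 : J2 (velL u) = r := by rw [hu, map_neg, J2_J2, neg_neg]
  have h2 : L.dAction z u = ‖r‖ ^ 2 := by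
    have e : L.grad2 z = r + mode 0 (coef 0 (L.grad2 z)) := by rw [hr, sub_add_cancel]
    rw [dAction, pairing_apply, h1]
    nth_rewrite 1 [e]
    rw [inner_add_left, inner_mode_left, h0, inner_zero_right, add_zero,
      real_inner_self_eq_norm_sq]
  have h3 := (L.dAction z).le_opNorm u
  have h4 : ‖u‖ = ‖r‖ := by rw [← velL.norm_map u, ← norm_J2, h1]
  rw [h2, h4, Real.norm_of_nonneg (by positivity)] at h3
  rcases (norm_nonneg r).eq_or_lt with h5 | h5
  · rw [← h5]
    exact (L.dAction z).opNorm_nonneg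
  · nlinarith

/-- The Hamiltonian equation satisfied by the translate of a point of the graph by the mean of
its `L²` gradient, up to the remainder of this gradient. -/
theorem exists_almost_orbit {N : ℕ} (hN : 0 < L.convexity N) (x : H1 n) :
    ∃ y : ℝ → PhaseSpace n, IsSmoothLoop y ∧
      normL2 (fun t => deriv y t - hamVF H t (y t)) ≤
        L.upGrad * ‖L.dAction (x + (L.graphMap hN x : H1 n))‖ ∧
      ‖x + (L.graphMap hN x : H1 n)‖ ≤ ‖L.hamMap.superL2 L.hamMap_lip 0‖ +
        L.upGrad * (normL2 y + ‖L.dAction (x + (L.graphMap hN x : H1 n))‖) := by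
  have hv := L.velL_graph hN x
  have hsmooth := L.isSmoothLoop_graph hN x
  set z := x + (L.graphMap hN x : H1 n)
  set v := L.velC hN x
  have ha : loopToL2 (L.gradC v) = L.grad2 z := L.loopToL2_gradC hv
  set a := L.gradC v with hadef
  set c := coef 0 (L.grad2 z) with hc
  -- Here `w = ∇H*(J₀v)`, so `v = X_H(w)` holds exactly. The loop `b` replaces the gradient `a` by
  -- its mean, so that `b' = v` while `w - b` is as small as the differential.
  set w := curveC z + a with hw
  set b := curveC z + modeLoop 0 c with hb
  have hdual : w = L.dual.superposition (JC v) := by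
    rw [hw, hadef, gradC, primitiveC_eq hv, add_sub_cancel]
  have hvw : v = L.hamMap.superposition w := by
    ext1 θ
    obtain ⟨t, rfl⟩ := QuotientAddGroup.mk_surjective θ
    change v (t : UnitAddCircle) = L.hamMap.superposition w (t : UnitAddCircle)
    rw [L.hamMap.superposition_coe]
    change _ = -J0 n (L.grad.toFun t (w (t : UnitAddCircle)))
    rw [hdual, L.dual.superposition_coe, L.grad_dual, JC_apply, J0_J0, neg_neg]
  have hmode : ∀ t : ℝ, modeLoop 0 c (t : UnitAddCircle) = c := fun t => by
    rw [modeLoop_coe]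
    simp [expJ0_zero]
  have hbt : ∀ t : ℝ, b (t : UnitAddCircle) = z.curve t + c := fun t => by
    rw [hb, ContinuousMap.add_apply, curveC_coe, hmode]
  have hr : ‖loopToL2 (w - b)‖ ≤ ‖L.dAction z‖ := by
    have : loopToL2 (w - b) = L.grad2 z - mode 0 c := by
      rw [hw, hb, add_sub_add_left_eq_sub, map_sub, ha]
      rfl
    rw [this]
    exact L.norm_grad2_sub_mean_le z
  have hderiv : ∀ t : ℝ, deriv (fun t : ℝ => b (t : UnitAddCircle)) t = v (t : UnitAddCircle) :=
    fun t => by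
      rw [funext hbt]
      exact ((H1.hasDerivAt_curve hv t).add_const c).deriv
  refine ⟨fun t : ℝ => b (t : UnitAddCircle), ?_, ?_, ?_⟩
  · rw [funext hbt]
    exact ⟨hsmooth.1.add contDiff_const, fun t => by dsimp only; rw [hsmooth.2 t]⟩
  · have e : (fun t : ℝ => deriv (fun t : ℝ => b (t : UnitAddCircle)) t -
        hamVF H t (b (t : UnitAddCircle))) =
        fun t : ℝ => (L.hamMap.superposition w - L.hamMap.superposition b) (t : UnitAddCircle) :=
      funext fun t => by
        rw [hderiv, L.hamVF_eq, ← hvw, ContinuousMap.sub_apply, L.hamMap.superposition_coe]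
    rw [e, normL2_loop, map_sub, ← L.hamMap.superL2_loopToL2 L.hamMap_lip,
      ← L.hamMap.superL2_loopToL2 L.hamMap_lip]
    refine (L.hamMap.norm_superL2_sub_le L.hamMap_lip _ _).trans ?_
    rw [← map_sub]
    exact mul_le_mul_of_nonneg_left hr L.upGrad_pos.le
  -- The `ℍ₁` norm of `z` is the `L²` norm of `X_H(w)`, which the Lipschitz bound controls by that
  -- of `w`.
  · rw [normL2_loop, ← velL.norm_map z, hv, hvw, ← L.hamMap.superL2_loopToL2 L.hamMap_lip]
    have h1 := L.hamMap.norm_superL2_sub_le L.hamMap_lip (loopToL2 w) 0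
    rw [sub_zero] at h1
    have h2 : ‖loopToL2 w‖ ≤ ‖loopToL2 b‖ + ‖L.dAction z‖ := by
      have e : loopToL2 w = loopToL2 b + loopToL2 (w - b) := by
        rw [← map_add, add_sub_cancel]
      rw [e]
      exact (norm_add_le _ _).trans (by gcongr)
    have h3 := mul_le_mul_of_nonneg_left h2 L.upGrad_pos.le
    have h4 := norm_sub_norm_le (L.hamMap.superL2 L.hamMap_lip (loopToL2 w))
      (L.hamMap.superL2 L.hamMap_lip 0)
    linarith

theorem exists_norm_le_of_dAction_small {N : ℕ} (hN : 0 < L.convexity N)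
    (hH : IsNonresonantAtInfinity H) : ∃ δ R : ℝ, 0 < δ ∧ ∀ x : H1 n,
      ‖L.dAction (x + (L.graphMap hN x : H1 n))‖ ≤ δ → ‖x + (L.graphMap hN x : H1 n)‖ ≤ R := by
  obtain ⟨ε, r, hε, -, h⟩ := hH
  have hg := L.upGrad_pos
  refine ⟨ε / L.upGrad, ‖L.hamMap.superL2 L.hamMap_lip 0‖ + L.upGrad * (r + ε / L.upGrad),
    by positivity, fun x hx => ?_⟩
  obtain ⟨y, hy, h1, h2⟩ := L.exists_almost_orbit hN x
  have h3 : normL2 y ≤ r := by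
    refine h y hy (h1.trans ?_)
    rw [le_div_iff₀ hg] at hx
    linarith
  refine h2.trans ?_
  gcongr

theorem norm_graph_sub_le {N : ℕ} (hN : 0 < L.convexity N) (x y : H1 n) :
    ‖(x + (L.graphMap hN x : H1 n)) - (y + (L.graphMap hN y : H1 n))‖ ≤
      (1 + L.lipConst / L.convexity N) * ‖x - y‖ := by
  rw [add_sub_add_comm, add_mul, one_mul]
  exact (norm_add_le _ _).trans (add_le_add_right (L.norm_graphMap_sub_le hN x y) _)

/-- Differentiating the global Lipschitz bound of the graph gives a bound independent of `ξ`. It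
converts smallness in the induced metric into smallness in the dual of `ℍ₁`. -/
theorem norm_tangent_lowCoord_le {N : ℕ} (hN : 0 < L.convexity N)
    (ξ : EuclideanSpace ℝ (Fin (2 * n * N))) (h : H1 n) :
    ‖L.tangent hN ξ (lowCoord n N h)‖ ≤ (1 + L.lipConst / L.convexity N) * ‖h‖ := by
  set x : lowModes n N := (lowModes n N).orthogonalProjectionOnto h with hx
  have hK : 0 ≤ 1 + L.lipConst / L.convexity N := by
    have := L.lipConst_pos
    positivity
  have e : lowCoord n N h = lowEquiv n N x := rfl
  have h1 : HasLineDerivAt ℝ (L.smoothGraph hN).param (L.tangent hN ξ (lowEquiv n N x)) ξ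
      (lowEquiv n N x) := (L.hasFDerivAt_param hN ξ).hasLineDerivAt _
  have h2 : HasDerivAt (fun s : ℝ => (L.smoothGraph hN).param (ξ + s • lowEquiv n N x))
      (L.tangent hN ξ (lowEquiv n N x)) 0 := h1
  rw [e]
  refine h2.le_of_lip' (by positivity) (.of_forall fun s => ?_)
  refine (L.norm_graph_sub_le hN _ _).trans ?_
  rw [← Submodule.coe_sub, ← map_sub, zero_smul, add_sub_add_left_eq_sub, sub_zero, map_smul,
    ContinuousLinearEquiv.symm_apply_apply, Submodule.coe_smul, norm_smul, sub_zero, mul_assoc,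
    mul_comm ‖s‖]
  have h3 : ‖(x : H1 n)‖ ≤ ‖h‖ := (lowModes n N).norm_orthogonalProjectionOnto_apply_le h
  gcongr

theorem norm_dAction_param_le {N : ℕ} (hN : 0 < L.convexity N)
    (ξ : EuclideanSpace ℝ (Fin (2 * n * N))) {ε : ℝ}
    (h : ∀ u, |L.dAction ((L.smoothGraph hN).param ξ) (L.tangent hN ξ u)| ≤
      ε * ‖L.tangent hN ξ u‖) :
    ‖L.dAction ((L.smoothGraph hN).param ξ)‖ ≤ |ε| * (1 + L.lipConst / L.convexity N) := by
  have hK : 0 ≤ 1 + L.lipConst / L.convexity N := by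
    have := L.lipConst_pos
    positivity
  refine ContinuousLinearMap.opNorm_le_bound _ (by positivity) fun v => ?_
  rw [L.dAction_param_apply, mul_assoc |ε|]
  refine (h _).trans ((mul_le_mul_of_nonneg_right (le_abs_self ε) (norm_nonneg _)).trans ?_)
  exact mul_le_mul_of_nonneg_left (L.norm_tangent_lowCoord_le hN ξ v) (abs_nonneg ε)

/-- The full differential tends to zero along the sequence, so non-resonance eventually bounds the
loops; their coordinates are then bounded in a finite dimensional space, and the global chart
carries a limit back. -/
theorem palaisSmale {N : ℕ} (hN : 0 < L.convexity N) (hH : IsNonresonantAtInfinity H) :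
    letI := (L.smoothGraph hN).chartedSpace
    PalaisSmaleOn (2 * n * N)
      (Subtype.val : graphSet (fun x : lowModes n N => L.graphMap hN (x : H1 n)) → H1 n)
      (fun z => dualAction H z) := by
  let _ := (L.smoothGraph hN).chartedSpace
  rintro z ⟨ε, hε, h⟩
  set G := L.smoothGraph hN with hG
  have h1 : ∀ j, ‖L.dAction (z j)‖ ≤ |ε j| * (1 + L.lipConst / L.convexity N) := fun j => by
    have e := G.param_proj (z j).2
    rw [← e]
    refine L.norm_dAction_param_le hN _ fun u => ?_
    have h2 := h j u
    rw [diffOn, diffOn, G.mfderiv_eq (L.contDiff_reduced hN), G.mfderiv_eq (f := Subtype.val) G.contDiff] at h2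
    rw [show fderiv ℝ ((fun z : graphSet (fun x : lowModes n N => L.graphMap hN (x : H1 n)) =>
      dualAction H z) ∘ G.point) (G.proj (z j)) = _ from
      (L.hasFDerivAt_reduced hN (G.proj (z j))).fderiv] at h2
    exact h2
  have h2 : Tendsto (fun j => |ε j| * (1 + L.lipConst / L.convexity N)) atTop (𝓝 0) := by
    simpa using hε.abs.mul_const (1 + L.lipConst / L.convexity N)
  obtain ⟨δ, R, hδ, hR⟩ := L.exists_norm_le_of_dAction_small hN hH
  have h3 : ∀ᶠ j in atTop, G.proj (z j) ∈ Metric.closedBall 0 (‖G.proj‖ * R) := by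
    filter_upwards [h2.eventually (ge_mem_nhds hδ)] with j hj
    obtain ⟨x, hx⟩ := (z j).2
    have h4 := (h1 j).trans hj
    rw [hx] at h4
    have h5 := hR x h4
    rw [mem_closedBall_zero_iff]
    refine (G.proj.le_opNorm _).trans (mul_le_mul_of_nonneg_left ?_ (norm_nonneg _))
    rw [hx]
    exact h5
  obtain ⟨ξ, -, φ, hφ, hlim⟩ :=
    tendsto_subseq_of_frequently_bounded Metric.isBounded_closedBall h3.frequently
  refine ⟨G.point ξ, φ, hφ, ?_⟩
  have h6 := (G.homeo.symm.continuous.tendsto ξ).comp hlim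
  refine h6.congr fun j => ?_
  exact G.point_proj (z (φ j))

end LegendrePair

end DualAction

end

/-! ### The finite dimensional reduction -/

theorem mainTheorem5 (n : ℕ) (H : ℝ → PhaseSpace n → ℝ)
    (hH : IsSmoothHamiltonian H) (hconv : IsQuadraticallyConvex H) :
    ∃ N₀ : ℕ, ∀ N : ℕ, N₀ ≤ N → ∃ Y : lowModes n N → highModes n N,
      -- (a) unique critical point on each slice, a non-degenerate global minimizer
      (∀ x : lowModes n N,
        (∀ y : highModes n N,
          IsCritical (fun y' : highModes n N => dualAction H ((x : H1 n) + (y' : H1 n))) y ↔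
            y = Y x) ∧
        IsNondegenerateAt
          (fun y' : highModes n N => dualAction H ((x : H1 n) + (y' : H1 n))) (Y x) ∧
        ∀ y : highModes n N,
          dualAction H ((x : H1 n) + (Y x : H1 n)) ≤ dualAction H ((x : H1 n) + (y : H1 n))) ∧
      -- (b) `Y` takes values in the smooth loops and is smooth for every `C^k`-norm
      (∀ x : lowModes n N, IsSmoothLoop (Y x : H1 n).curve) ∧
      (∀ k : ℕ, ∃ Yk : lowModes n N → CkLoop n k,
        (∀ x, (Yk x).curve = (Y x : H1 n).curve) ∧ ContDiff ℝ ∞ Yk) ∧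
      (∀ z ∈ graphSet Y, IsSmoothLoop z.curve) ∧
      -- the graph of `Y` is a smooth `2nN`-dimensional submanifold of `ℍ₁`
      ∃ _ : ChartedSpace (EuclideanSpace ℝ (Fin (2 * n * N))) (graphSet Y),
        IsManifold (𝓡 (2 * n * N)) ∞ (graphSet Y) ∧
        Manifold.IsSmoothEmbedding (𝓡 (2 * n * N)) 𝓘(ℝ, H1 n) ∞
          (Subtype.val : graphSet Y → H1 n) ∧
        -- (c) the restriction of the dual action to the graph is smooth
        ContMDiff (𝓡 (2 * n * N)) 𝓘(ℝ, ℝ) ∞ (fun z : graphSet Y => dualAction H z) ∧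
        -- (d) same critical points, same index and nullity
        (∀ z : H1 n, IsCritical (dualAction H) z ↔
          ∃ hz : z ∈ graphSet Y,
            IsCriticalOn (2 * n * N) (fun z' : graphSet Y => dualAction H z') ⟨z, hz⟩) ∧
        (∀ z : graphSet Y, IsCritical (dualAction H) (z : H1 n) →
          morseIndex (dualAction H) (z : H1 n) =
              morseIndexOn (2 * n * N) (fun z' : graphSet Y => dualAction H z') z ∧
            nullity (dualAction H) (z : H1 n) =
              nullityOn (2 * n * N) (fun z' : graphSet Y => dualAction H z') z) ∧
        -- (e) the Palais-Smale condition
        (IsNonresonantAtInfinity H →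
          PalaisSmaleOn (2 * n * N) (Subtype.val : graphSet Y → H1 n)
            (fun z : graphSet Y => dualAction H z)) := by
  obtain ⟨L⟩ := hH.exists_legendrePair hconv
  obtain ⟨N₀, hN₀⟩ := L.exists_convexity_pos
  refine ⟨N₀, fun N hNN => ?_⟩
  have hN := hN₀ N hNN
  let S := graphSet fun x : lowModes n N => L.graphMap hN (x : H1 n)
  let G : SmoothGraph (2 * n * N) S := L.smoothGraph hN
  let _ := G.chartedSpace
  refine ⟨fun x => L.graphMap hN x, fun x => ⟨L.isCritical_slice_iff_eq hN x,
    L.isNondegenerateAt_slice hN x _, L.dualAction_graphMap_le hN x⟩,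
    L.isSmoothLoop_graphMap hN, L.exists_contDiff_graphMap_ckLoop hN, ?_, G.chartedSpace,
    G.isManifold, G.isSmoothEmbedding, G.contMDiff_of_comp (L.contDiff_reduced hN), fun z => ?_,
    fun z hz => ?_, L.palaisSmale hN⟩
  · rintro _ ⟨x, rfl⟩
    exact L.isSmoothLoop_graph hN x
  · have h : ∀ z' : S,
        IsCritical (dualAction H) (z' : H1 n) ↔
          IsCriticalOn (2 * n * N) (fun z' : S => dualAction H z') z' := fun z' => by
      have h1 := L.isCritical_param_iff hN (G.proj z')
      rw [G.param_proj z'.2] at h1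
      exact h1.trans (G.hasMFDerivAt_iff (f := fun z' : S => dualAction H z')).symm
    exact ⟨fun hz => ⟨L.mem_graphSet_of_isCritical hN hz, (h ⟨z, _⟩).1 hz⟩,
      fun ⟨hz, hc⟩ => (h ⟨z, hz⟩).2 hc⟩
  · have h := G.param_proj z.2
    rw [← h] at hz
    have R := L.isReductionAt hN hz
    have h1 := R.morseIndex_eq
    have h2 := R.nullity_eq
    rw [show (L.smoothGraph hN).param (G.proj z) = z from h] at h1 h2
    exact ⟨h1, h2⟩
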